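/- Let $N\ge 2$ and $1<p<\infty$. Write $x=(x',x_N)\in\mathbb{R}^{N-1}\times\mathbb{R}$, and let $B'(x',r)$ be the open ball in $\mathbb{R}^{N-1}$. Let $|\eta|_{0,1}=\sup_{x'\neq y'}|\eta(x')-\eta(y')|/|x'-y'|$ be the Lipschitz seminorm. For $\Omega\subseteq\mathbb{R}^N$ open, $\dot W^{1,p}(\Omega)$ is the space of all $u\in L^1_{\mathrm{loc}}(\Omega)$ whose weak first-order partial derivatives belong to $L^p(\Omega)$. $\mathcal{H}^{N-1}$ denotes the $(N-1)$-dimensional Hausdorff measure, and $L^p_{\mathrm{loc}}(\partial\Omega)$ is taken with respect to it. There is a constant $c=c(N,p)>0$ such that the following holds for all Lipschitz functions $\eta^\pm:\mathbb{R}^{N-1}\to\mathbb{R}$ with $\eta^-<\eta^+$ everywhere. Put $\Omega=\{x\in\mathbb{R}^N : \eta^-(x')<x_N<\eta^+(x')\}$ and $L=|\eta^-|_{0,1}+|\eta^+|_{0,1}$, and let $\nu$ be the outward unit normal on $\partial\Omega$. There exists a linear operator $\operatorname{Tr}:\dot W^{1,p}(\Omega)\to L^p_{\mathrm{loc}}(\partial\Omega)$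 with the following properties. 1. $\operatorname{Tr}(u)=u$ ($\mathcal{H}^{N-1}$-a.e.) on $\partial\Omega$ for all $u\in\dot W^{1,p}(\Omega)\cap C^0(\overline\Omega)$. 2. For all $u\in\dot W^{1,p}(\Omega)$, $$\int_{\mathbb{R}^{N-1}}\frac{|\operatorname{Tr}(u)(x',\eta^+(x'))-\operatorname{Tr}(u)(x',\eta^-(x'))|^p}{(\eta^+(x')-\eta^-(x'))^{p-1}}\,dx'\le c\int_\Omega|\partial_N u|^p\,dx,$$ and, for both choices of the sign and for every real $\ell>0$ with $\ell\ge L$, $$\int_{\mathbb{R}^{N-1}}\int_{B'(0,(\eta^+(x')-\eta^-(x'))/(2\ell))}\frac{|\operatorname{Tr}(u)(x'+h',\eta^\pm(x'+h'))-\operatorname{Tr}(u)(x',\eta^\pm(x'))|^p}{|h'|^{p+N-2}}\,dh'\,dx'\le \max\{1,\tfrac1\ell\}\,(1+L)^p\,c\int_\Omega|\nabla u|^p\,dx.$$ In particular, if $L\ge1$, taking $\ell=L$ gives the screening radius $(\eta^+-\eta^-)/(2L)$ with the constant $(1+L)^pc$. 3. For all $u\in\dot W^{1,p}(\Omega)$,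 all $\psi\in C^1_c(\mathbb{R}^N)$ and all $i=1,\dots,N$, the following integrals converge absolutely and $$\int_\Omega u\,\partial_i\psi\,dx=-\int_\Omega\psi\,\partial_iu\,dx+\int_{\partial\Omega}\psi\,\operatorname{Tr}(u)\,\nu_i\,d\mathcal{H}^{N-1}.$$ This operator is unique: any linear operator $\dot W^{1,p}(\Omega)\to L^p_{\mathrm{loc}}(\partial\Omega)$ that satisfies 1, 3, and 2 with some constant $c'>0$ in place of $c$ equals $\operatorname{Tr}$. -/

import Mathlib

open MeasureTheory Set Filter
open scoped ENNReal NNReal ContDiff Topology Gradient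

noncomputable section

namespace StripTrace

/-- `ℝ^N` with its Euclidean structure. -/
abbrev Space (N : ℕ) : Type := EuclideanSpace ℝ (Fin N)

/-- The horizontal part `x'` of `x = (x', x_N)`, where `N = n + 1`. -/
def horiz {n : ℕ} (x : Space (n + 1)) : Space n :=
  WithLp.toLp 2 (fun i : Fin n => x i.castSucc)

/-- The vertical coordinate `x_N` of `x = (x', x_N)`, where `N = n + 1`. -/
def vert {n : ℕ} (x : Space (n + 1)) : ℝ := x (Fin.last n)

/-- The point `(x', t)`. -/
def join {n : ℕ} (x' : Space n) (t : ℝ) : Space (n + 1) :=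
  WithLp.toLp 2 (Fin.snoc (α := fun _ => ℝ) (fun i : Fin n => x' i) t)

/-- The classical partial derivative `∂_i φ`. -/
def pderiv {N : ℕ} (i : Fin N) (φ : Space N → ℝ) (x : Space N) : ℝ :=
  fderiv ℝ φ x (EuclideanSpace.single i 1)

/-- `L^q_loc(S)` for a measure `μ`: the `μ`-a.e. classes of real functions on `S` that are in `L^q`
on each compact subset of `S`. -/
def LpLoc {N : ℕ} (q : ℝ≥0∞) (μ : Measure (Space N)) (S : Set (Space N)) :
    Submodule ℝ (Space N →ₘ[μ.restrict S] ℝ) where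
  carrier := {f | ∀ K : Set (Space N), IsCompact K → K ⊆ S → MemLp f q (μ.restrict K)}
  zero_mem' := by
    intro K _ hKS
    have h : (⇑(0 : Space N →ₘ[μ.restrict S] ℝ)) =ᵐ[μ.restrict K] 0 :=
      ae_mono (Measure.restrict_mono_set μ hKS) AEEqFun.coeFn_zero
    exact (memLp_congr_ae h).2 MemLp.zero
  add_mem' := by
    intro f g hf hg K hK hKS
    have h : (⇑(f + g)) =ᵐ[μ.restrict K] ⇑f + ⇑g :=
      ae_mono (Measure.restrict_mono_set μ hKS) (AEEqFun.coeFn_add f g)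
    exact (memLp_congr_ae h).2 ((hf K hK hKS).add (hg K hK hKS))
  smul_mem' := by
    intro c f hf K hK hKS
    have h : (⇑(c • f)) =ᵐ[μ.restrict K] c • ⇑f :=
      ae_mono (Measure.restrict_mono_set μ hKS) (AEEqFun.coeFn_smul c f)
    exact (memLp_congr_ae h).2 ((hf K hK hKS).const_smul c)

/-- `g ∈ L^1_loc(Ω)` is the weak partial derivative `∂_i u` in `Ω` of `u ∈ L^1_loc(Ω)`. -/
def HasWeakPartial {N : ℕ} (Ω : Set (Space N)) (i : Fin N) (u g : Space N → ℝ) : Prop :=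
  (∀ K : Set (Space N), IsCompact K → K ⊆ Ω → IntegrableOn u K) ∧
  (∀ K : Set (Space N), IsCompact K → K ⊆ Ω → IntegrableOn g K) ∧
  ∀ φ : Space N → ℝ, ContDiff ℝ ∞ φ → HasCompactSupport φ → tsupport φ ⊆ Ω →
    ∫ x in Ω, u x * pderiv i φ x = - ∫ x in Ω, g x * φ x

theorem integrable_mul_test {N : ℕ} {Ω : Set (Space N)} {u φ : Space N → ℝ}
    (hu : ∀ K : Set (Space N), IsCompact K → K ⊆ Ω → IntegrableOn u K)
    (hφ : Continuous φ) (hc : HasCompactSupport φ) (hs : tsupport φ ⊆ Ω) :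
    Integrable (fun x => u x * φ x) (volume.restrict Ω) := by
  have h1 : IntegrableOn (fun x => u x * φ x) (tsupport φ) :=
    (hu _ hc hs).mul_continuousOn hφ.continuousOn hc
  have h2 : Integrable (fun x => u x * φ x) volume := by
    refine (integrableOn_iff_integrable_of_support_subset ?_).1 h1
    intro x hx
    refine subset_tsupport φ ?_
    intro h0
    exact hx (by simp [h0])
  exact h2.integrableOn

theorem continuous_pderiv {N : ℕ} (i : Fin N) {φ : Space N → ℝ} (hφ : ContDiff ℝ ∞ φ) :
    Continuous (pderiv i φ) :=
  (hφ.continuous_fderiv (by simp)).clm_apply continuous_const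

theorem tsupport_pderiv_subset {N : ℕ} (i : Fin N) (φ : Space N → ℝ) :
    tsupport (pderiv i φ) ⊆ tsupport φ :=
  tsupport_fderiv_apply_subset ℝ _

theorem HasWeakPartial.zero {N : ℕ} (Ω : Set (Space N)) (i : Fin N) :
    HasWeakPartial Ω i (0 : Space N → ℝ) 0 :=
  ⟨fun _ _ _ => integrableOn_zero, fun _ _ _ => integrableOn_zero, fun _ _ _ _ => by simp⟩

theorem HasWeakPartial.add {N : ℕ} {Ω : Set (Space N)} {i : Fin N} {u v g k : Space N → ℝ}
    (hu : HasWeakPartial Ω i u g) (hv : HasWeakPartial Ω i v k) :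
    HasWeakPartial Ω i (u + v) (g + k) := by
  refine ⟨fun K hK hKS => (hu.1 K hK hKS).add (hv.1 K hK hKS),
    fun K hK hKS => (hu.2.1 K hK hKS).add (hv.2.1 K hK hKS), fun φ h1 h2 h3 => ?_⟩
  have hd := continuous_pderiv i h1
  have hdc : HasCompactSupport (pderiv i φ) :=
    h2.of_isClosed_subset (isClosed_tsupport _) (tsupport_pderiv_subset i φ)
  have hds := (tsupport_pderiv_subset i φ).trans h3
  simp only [Pi.add_apply, add_mul]
  rw [integral_add (integrable_mul_test hu.1 hd hdc hds) (integrable_mul_test hv.1 hd hdc hds),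
    integral_add (integrable_mul_test hu.2.1 h1.continuous h2 h3)
      (integrable_mul_test hv.2.1 h1.continuous h2 h3), hu.2.2 φ h1 h2 h3, hv.2.2 φ h1 h2 h3]
  ring

theorem HasWeakPartial.smul {N : ℕ} {Ω : Set (Space N)} {i : Fin N} {u g : Space N → ℝ}
    (c : ℝ) (hu : HasWeakPartial Ω i u g) : HasWeakPartial Ω i (c • u) (c • g) := by
  refine ⟨fun K hK hKS => (hu.1 K hK hKS).smul c,
    fun K hK hKS => (hu.2.1 K hK hKS).smul c, fun φ h1 h2 h3 => ?_⟩
  simp only [Pi.smul_apply, smul_eq_mul, mul_assoc]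
  rw [integral_const_mul, integral_const_mul, hu.2.2 φ h1 h2 h3]
  ring

theorem HasWeakPartial.congr {N : ℕ} {Ω : Set (Space N)} {i : Fin N} {u v g : Space N → ℝ}
    (hu : HasWeakPartial Ω i u g) (h : v =ᵐ[volume.restrict Ω] u) : HasWeakPartial Ω i v g := by
  refine ⟨fun K hK hKS => (hu.1 K hK hKS).congr
    (ae_mono (Measure.restrict_mono_set volume hKS) h.symm), hu.2.1, fun φ h1 h2 h3 => ?_⟩
  rw [← hu.2.2 φ h1 h2 h3]
  refine integral_congr_ae ?_
  filter_upwards [h] with x hx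
  rw [hx]

/-- The homogeneous Sobolev space `Ẇ^{1,q}(Ω)` (for `Ω` open, `1 ≤ q`): the (a.e. classes of)
`u ∈ L^1_loc(Ω)` whose weak partial derivatives are in `L^q(Ω)`. -/
def HomSobolev {N : ℕ} (q : ℝ≥0∞) (Ω : Set (Space N)) :
    Submodule ℝ (Space N →ₘ[volume.restrict Ω] ℝ) where
  carrier := {u | u ∈ LpLoc 1 volume Ω ∧ ∃ g : Space N → Space N,
    MemLp g q (volume.restrict Ω) ∧ ∀ i, HasWeakPartial Ω i u (fun x => g x i)}
  zero_mem' :=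
    ⟨Submodule.zero_mem _, 0, MemLp.zero, fun i => (HasWeakPartial.zero Ω i).congr
      AEEqFun.coeFn_zero⟩
  add_mem' := by
    rintro u v ⟨hu, g, hg, hug⟩ ⟨hv, k, hk, hvk⟩
    exact ⟨Submodule.add_mem _ hu hv, g + k, hg.add hk, fun i =>
      ((hug i).add (hvk i)).congr (AEEqFun.coeFn_add u v)⟩
  smul_mem' := by
    rintro c u ⟨hu, g, hg, hug⟩
    exact ⟨Submodule.smul_mem _ c hu, c • g, hg.const_smul c, fun i =>
      ((hug i).smul c).congr (AEEqFun.coeFn_smul c u)⟩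

/-- The weak gradient `∇u` of `u ∈ Ẇ^{1,q}(Ω)` (unique up to a null set of `Ω`). -/
def weakGrad {N : ℕ} {q : ℝ≥0∞} {Ω : Set (Space N)} (u : HomSobolev q Ω) : Space N → Space N :=
  u.2.2.choose

theorem weakGrad_spec {N : ℕ} {q : ℝ≥0∞} {Ω : Set (Space N)} (u : HomSobolev q Ω) :
    MemLp (weakGrad u) q (volume.restrict Ω) ∧
      ∀ i, HasWeakPartial Ω i u.1 (fun x => weakGrad u x i) :=
  u.2.2.choose_spec

/-- The domain `Ω` between the graphs of `ηm` and `ηp`. -/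
def graphDomain {n : ℕ} (ηm ηp : Space n → ℝ) : Set (Space (n + 1)) :=
  {x | ηm (horiz x) < vert x ∧ vert x < ηp (horiz x)}

/-- The Lipschitz seminorm `|η|_{0,1}` of a Lipschitz function (`x = y` contributes `0 / 0 = 0`). -/
def lipSeminorm {n : ℕ} (η : Space n → ℝ) : ℝ :=
  ⨆ q : Space n × Space n, |η q.1 - η q.2| / dist q.1 q.2

open Classical in
/-- The outward unit normal on the boundary of `graphDomain ηm ηp`, defined almost everywhere:
`(-∇η⁺, 1) / √(1 + |∇η⁺|²)` on the graph of `η⁺`, `(∇η⁻, -1) / √(1 + |∇η⁻|²)` on that of `η⁻`. -/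
def outerNormal {n : ℕ} (ηm ηp : Space n → ℝ) (x : Space (n + 1)) : Space (n + 1) :=
  if vert x = ηp (horiz x) then
    (Real.sqrt (1 + ‖∇ ηp (horiz x)‖ ^ 2))⁻¹ • join (-∇ ηp (horiz x)) 1
  else
    (Real.sqrt (1 + ‖∇ ηm (horiz x)‖ ^ 2))⁻¹ • join (∇ ηm (horiz x)) (-1)

/-- `L^q_loc(∂Ω)` with respect to the (normalized) Hausdorff measure `ℋ^{N-1}`, `N = n + 1`. -/
abbrev BoundaryLpLoc {n : ℕ} (q : ℝ≥0∞) (Ω : Set (Space (n + 1))) :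
    Submodule ℝ (Space (n + 1) →ₘ[(Measure.euclideanHausdorffMeasure n).restrict (frontier Ω)] ℝ) :=
  LpLoc q (Measure.euclideanHausdorffMeasure n) (frontier Ω)

/-- The screened energy of `f : ℝ^n → ℝ` with screening function `σ`, with `N = n + 1`:
`∫ ∫_{B'(0,σ(x'))} |f(x'+h') - f(x')|^p / |h'|^{p+N-2} dh' dx'`. -/
def screenedEnergy {n : ℕ} (p : ℝ) (σ : Space n → ℝ) (f : Space n → ℝ) : ℝ≥0∞ :=
  ∫⁻ x, ∫⁻ h in Metric.ball (0 : Space n) (σ x),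
    ‖f (x + h) - f x‖ₑ ^ p / ‖h‖ₑ ^ (p + ((n : ℝ) + 1) - 2)

/-- The three properties of the trace operator on `Ẇ^{1,p}(Ω)`, `Ω = graphDomain ηm ηp`, with the
constant `c` in the estimates. In the third estimate `l` is any positive number with
`l ≥ L = |η⁻|_{0,1} + |η⁺|_{0,1}`; for `l = L ≥ 1` the factor `max 1 l⁻¹` is `1`. -/
structure IsTraceOperator {n : ℕ} (p : ℝ) (ηm ηp : Space n → ℝ) (c : ℝ)
    (T : HomSobolev (ENNReal.ofReal p) (graphDomain ηm ηp) →ₗ[ℝ]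
      BoundaryLpLoc (ENNReal.ofReal p) (graphDomain ηm ηp)) : Prop where
  /-- `Tr u = u` on `∂Ω` if `u` has a representative `v` that is continuous on the closure. -/
  eq_of_continuousOn : ∀ (u : HomSobolev (ENNReal.ofReal p) (graphDomain ηm ηp))
    (v : Space (n + 1) → ℝ), ContinuousOn v (closure (graphDomain ηm ηp)) →
    (u.1 : Space (n + 1) → ℝ) =ᵐ[volume.restrict (graphDomain ηm ηp)] v →
    ((T u).1 : Space (n + 1) → ℝ)
      =ᵐ[(Measure.euclideanHausdorffMeasure n).restrict (frontier (graphDomain ηm ηp))] v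
  difference_bound : ∀ u : HomSobolev (ENNReal.ofReal p) (graphDomain ηm ηp),
    ∫⁻ x, ‖(T u).1 (join x (ηp x)) - (T u).1 (join x (ηm x))‖ₑ ^ p
        / ENNReal.ofReal ((ηp x - ηm x) ^ (p - 1))
      ≤ ENNReal.ofReal c * ∫⁻ x in graphDomain ηm ηp, ‖weakGrad u x (Fin.last n)‖ₑ ^ p
  screened_bound : ∀ u : HomSobolev (ENNReal.ofReal p) (graphDomain ηm ηp),
    ∀ l : ℝ, 0 < l → lipSeminorm ηm + lipSeminorm ηp ≤ l → ∀ η ∈ ({ηm, ηp} : Set (Space n → ℝ)),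
    screenedEnergy p (fun x => (ηp x - ηm x) / (2 * l)) (fun x => (T u).1 (join x (η x)))
      ≤ ENNReal.ofReal (max 1 l⁻¹ * (1 + (lipSeminorm ηm + lipSeminorm ηp)) ^ p * c)
        * ∫⁻ x in graphDomain ηm ηp, ‖weakGrad u x‖ₑ ^ p
  /-- Integration by parts; all three integrals converge absolutely. -/
  integral_by_parts : ∀ (u : HomSobolev (ENNReal.ofReal p) (graphDomain ηm ηp))
    (ψ : Space (n + 1) → ℝ), ContDiff ℝ 1 ψ → HasCompactSupport ψ → ∀ i : Fin (n + 1),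
    IntegrableOn (fun x => u.1 x * pderiv i ψ x) (graphDomain ηm ηp) ∧
    IntegrableOn (fun x => ψ x * weakGrad u x i) (graphDomain ηm ηp) ∧
    IntegrableOn (fun x => ψ x * (T u).1 x * outerNormal ηm ηp x i)
      (frontier (graphDomain ηm ηp)) (Measure.euclideanHausdorffMeasure n) ∧
    ∫ x in graphDomain ηm ηp, u.1 x * pderiv i ψ x
      = - (∫ x in graphDomain ηm ηp, ψ x * weakGrad u x i)
        + ∫ x in frontier (graphDomain ηm ηp),
            ψ x * (T u).1 x * outerNormal ηm ηp x i ∂(Measure.euclideanHausdorffMeasure n)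

end StripTrace

end

/-! A function in `HomSobolev` is absolutely continuous on almost every vertical segment of the
domain, and its derivative there is in `L^p`, hence in `L^1`, of the segment. So it has limits at
both ends; these limits `fm` and `fp` are the trace (`IsVertTrace`, `exists_isVertTrace`). The
source of this is a fundamental theorem of calculus along segments for weak derivatives
(`HasWeakDir.ae_sub_eq`), proved by duality. Endpoint values depend only on the a.e. class of `u`,
which gives linearity and agreement with continuous representatives.

The difference `fp - fm` is the integral of `∂_N u` over the segment, so Hölder's inequality gives
the first estimate with constant 1. For the screened estimate, the surface points over `x` and `x +
h` are joined by a path of three legs: vertically to depth `κ‖h‖`, horizontally by `h`, vertically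
back to the surface. The path stays in the domain if `κ` exceeds the Lipschitz constant `Λ` of the
graph by less than `min 1 l` and `‖h‖` is below the screening radius. The vertical legs are
controlled by Hardy's inequality (`lintegral_verticalPart_le`). The horizontal leg is controlled by
a change of variables whose height map expands distances by `κ - Λ` (`lintegral_horizontalPart_le`);
this is the origin of the factor `max 1 l⁻¹`. Fubini supplies one `κ` that serves almost every pair
`(x, h)` (`exists_depth`). Finite screened energy puts the trace in `L^p_loc`.

For integration by parts, the weak derivative is tested against `ψ (1 - χ⁺ - χ⁻)` with Lipschitz
cutoffs near the graphs. The large derivatives of the cutoffs are removed by one-dimensional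
integration by parts on vertical lines, which leaves boundary terms and remainders that vanish in
the limit (`IsVertTrace.integral_by_parts`). The area formula for Lipschitz graphs
(`restrict_range_graphMap`) turns the boundary terms into integrals for `ℋ^n`; it is proved by
comparing small pieces of the graph with linear images of the base.

Uniqueness uses integration by parts in the vertical direction alone, since the last component of
the normal never vanishes. -/

noncomputable section

namespace StripTrace

/-! ### Coordinates `x = (x', x_N)` -/

section Coordinates

variable {n : ℕ}

@[simp] theorem join_castSucc (x : Space n) (t : ℝ) (i : Fin n) : join x t i.castSucc = x i := by
  simp [join]

@[simp] theorem join_last (x : Space n) (t : ℝ) : join x t (Fin.last n) = t := by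
  simp [join]

@[simp] theorem horiz_apply (x : Space (n + 1)) (i : Fin n) : horiz x i = x i.castSucc := rfl

@[simp] theorem horiz_join (x : Space n) (t : ℝ) : horiz (join x t) = x := by
  ext i; simp

@[simp] theorem vert_join (x : Space n) (t : ℝ) : vert (join x t) = t := by
  simp [vert]

@[simp] theorem join_horiz_vert (x : Space (n + 1)) : join (horiz x) (vert x) = x := by
  ext i
  refine Fin.lastCases ?_ (fun j => ?_) i <;> simp [vert]

theorem join_add (x y : Space n) (s t : ℝ) : join (x + y) (s + t) = join x s + join y t := by
  ext i
  refine Fin.lastCases ?_ (fun j => ?_) i <;> simp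

theorem join_smul (c : ℝ) (x : Space n) (t : ℝ) : join (c • x) (c * t) = c • join x t := by
  ext i
  refine Fin.lastCases ?_ (fun j => ?_) i <;> simp

theorem norm_join_sq (x : Space n) (t : ℝ) : ‖join x t‖ ^ 2 = ‖x‖ ^ 2 + t ^ 2 := by
  simp [EuclideanSpace.norm_sq_eq, Fin.sum_univ_castSucc]

theorem norm_join (x : Space n) (t : ℝ) : ‖join x t‖ = √(‖x‖ ^ 2 + t ^ 2) := by
  rw [← norm_join_sq, Real.sqrt_sq (norm_nonneg _)]

theorem join_sub_join (x y : Space n) (s t : ℝ) :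
    join x s - join y t = join (x - y) (s - t) := by
  rw [sub_eq_iff_eq_add, ← join_add]; simp

theorem single_last_eq_join :
    (EuclideanSpace.single (Fin.last n) 1 : Space (n + 1)) = join 0 1 := by
  ext i
  refine Fin.lastCases ?_ (fun j => ?_) i
  · simp
  · simp

theorem single_castSucc_eq_join (j : Fin n) :
    (EuclideanSpace.single j.castSucc 1 : Space (n + 1)) = join (EuclideanSpace.single j 1) 0 := by
  ext i
  refine Fin.lastCases ?_ (fun k => ?_) i
  · simp
  · simp

/-- The splitting `x = (x', x_N)` as a continuous linear equivalence. -/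
def joinL (n : ℕ) : (Space n × ℝ) ≃L[ℝ] Space (n + 1) :=
  LinearEquiv.toContinuousLinearEquiv
    { toFun := fun q => join q.1 q.2
      invFun := fun x => (horiz x, vert x)
      left_inv := fun q => by simp
      right_inv := fun x => by simp
      map_add' := fun q r => join_add _ _ _ _
      map_smul' := fun c q => join_smul _ _ _ }

@[simp] theorem joinL_apply (q : Space n × ℝ) : joinL n q = join q.1 q.2 := rfl

@[simp] theorem joinL_symm_apply (x : Space (n + 1)) : (joinL n).symm x = (horiz x, vert x) := rfl

theorem continuous_join : Continuous fun q : Space n × ℝ => join q.1 q.2 := (joinL n).continuous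

@[fun_prop]
theorem continuous_join_comp {α : Type*} [TopologicalSpace α] {f : α → Space n} {g : α → ℝ}
    (hf : Continuous f) (hg : Continuous g) : Continuous fun a => join (f a) (g a) :=
  continuous_join.comp (hf.prodMk hg)

@[fun_prop]
theorem measurable_join_comp {α : Type*} [MeasurableSpace α] {f : α → Space n} {g : α → ℝ}
    (hf : Measurable f) (hg : Measurable g) : Measurable fun a => join (f a) (g a) :=
  continuous_join.measurable.comp (hf.prodMk hg)

@[fun_prop]
theorem continuous_horiz : Continuous (horiz (n := n)) :=
  continuous_fst.comp (joinL n).symm.continuous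

@[fun_prop]
theorem continuous_vert : Continuous (vert (n := n)) :=
  continuous_snd.comp (joinL n).symm.continuous

@[fun_prop]
theorem measurable_horiz : Measurable (horiz (n := n)) := continuous_horiz.measurable

@[fun_prop]
theorem measurable_vert : Measurable (vert (n := n)) := continuous_vert.measurable

theorem lipschitzWith_horiz : LipschitzWith 1 (horiz (n := n)) := by
  refine LipschitzWith.of_dist_le_mul fun x y => ?_
  rw [NNReal.coe_one, one_mul, dist_eq_norm, dist_eq_norm]
  have h : x - y = join (horiz x - horiz y) (vert x - vert y) := by
    rw [← join_sub_join, join_horiz_vert, join_horiz_vert]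
  refine (sq_le_sq₀ (norm_nonneg _) (norm_nonneg _)).1 ?_
  rw [h, norm_join_sq]
  nlinarith [sq_nonneg (vert x - vert y)]

theorem lipschitzWith_vert : LipschitzWith 1 (vert (n := n)) := by
  refine LipschitzWith.of_dist_le_mul fun x y => ?_
  rw [NNReal.coe_one, one_mul, dist_eq_norm, dist_eq_norm, Real.norm_eq_abs]
  have h : x - y = join (horiz x - horiz y) (vert x - vert y) := by
    rw [← join_sub_join, join_horiz_vert, join_horiz_vert]
  rw [h, norm_join]
  exact Real.abs_le_sqrt (by nlinarith [sq_nonneg ‖horiz x - horiz y‖])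

theorem measurePreserving_join :
    MeasurePreserving (fun q : Space n × ℝ => join q.1 q.2) := by
  have h1 : MeasurePreserving (Prod.map (WithLp.ofLp : Space n → (Fin n → ℝ)) (id : ℝ → ℝ)) :=
    (PiLp.volume_preserving_ofLp (Fin n)).prod (MeasurePreserving.id volume)
  have h2 : MeasurePreserving (Prod.swap : (Fin n → ℝ) × ℝ → ℝ × (Fin n → ℝ)) :=
    Measure.measurePreserving_swap
  have h3 := (volume_preserving_piFinSuccAbove (fun _ : Fin (n + 1) => ℝ) (Fin.last n)).symm
  have h4 := PiLp.volume_preserving_toLp (Fin (n + 1))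
  have h5 := h4.comp (h3.comp (h2.comp h1))
  convert! h5 using 1
  ext q i
  refine Fin.lastCases ?_ (fun j => ?_) i <;>
  simp [join, MeasurableEquiv.piFinSuccAbove, Fin.insertNthEquiv]

theorem measurableEmbedding_join :
    MeasurableEmbedding (fun q : Space n × ℝ => join q.1 q.2) :=
  (joinL n).toHomeomorph.measurableEmbedding

theorem ae_join_iff {P : Space (n + 1) → Prop} :
    (∀ᵐ z, P z) ↔ ∀ᵐ q : Space n × ℝ, P (join q.1 q.2) := by
  rw [← measurePreserving_join.map_eq, measurableEmbedding_join.ae_map_iff]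

/-- The graph parametrization `x' ↦ (x', η x')`. -/
def graphMap (η : Space n → ℝ) (x : Space n) : Space (n + 1) := join x (η x)

@[simp] theorem horiz_graphMap (η : Space n → ℝ) (x : Space n) : horiz (graphMap η x) = x := by
  simp [graphMap]

@[simp] theorem vert_graphMap (η : Space n → ℝ) (x : Space n) : vert (graphMap η x) = η x := by
  simp [graphMap]

theorem mem_range_graphMap {η : Space n → ℝ} {z : Space (n + 1)} :
    z ∈ range (graphMap η) ↔ vert z = η (horiz z) := by
  constructor
  · rintro ⟨x, rfl⟩; simp
  · intro h; exact ⟨horiz z, by rw [graphMap, ← h, join_horiz_vert]⟩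

theorem continuous_graphMap {η : Space n → ℝ} (hη : Continuous η) : Continuous (graphMap η) := by
  unfold graphMap; fun_prop

theorem graphMap_injective (η : Space n → ℝ) : Function.Injective (graphMap η) :=
  Function.LeftInverse.injective (g := horiz) (horiz_graphMap η)

theorem isClosed_range_graphMap {η : Space n → ℝ} (hη : Continuous η) :
    IsClosed (range (graphMap η)) := by
  have : range (graphMap η) = {z | vert z = η (horiz z)} := by ext z; exact mem_range_graphMap
  rw [this]
  exact isClosed_eq (by fun_prop) (by fun_prop)

theorem measurableEmbedding_graphMap {η : Space n → ℝ} (hη : Continuous η) :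
    MeasurableEmbedding (graphMap η) :=
  (continuous_graphMap hη).measurableEmbedding (graphMap_injective η)

end Coordinates

/-! ### The domain between two graphs -/

section Domain

variable {n : ℕ} {ηm ηp : Space n → ℝ}

theorem join_mem_graphDomain {x : Space n} {t : ℝ} :
    join x t ∈ graphDomain ηm ηp ↔ ηm x < t ∧ t < ηp x := by
  simp [graphDomain]

theorem isOpen_graphDomain (hm : Continuous ηm) (hp : Continuous ηp) :
    IsOpen (graphDomain ηm ηp) := by
  have h1 : IsOpen {z : Space (n + 1) | ηm (horiz z) < vert z} :=
    isOpen_lt (by fun_prop) (by fun_prop)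
  have h2 : IsOpen {z : Space (n + 1) | vert z < ηp (horiz z)} :=
    isOpen_lt (by fun_prop) (by fun_prop)
  exact h1.inter h2

/-- The nontrivial inclusion needs only vertical approximation: a point over `x` is a limit of
points of the open segment over the same `x`. -/
theorem closure_graphDomain (hm : Continuous ηm) (hp : Continuous ηp) (hlt : ∀ x, ηm x < ηp x) :
    closure (graphDomain ηm ηp) = {z | ηm (horiz z) ≤ vert z ∧ vert z ≤ ηp (horiz z)} := by
  apply Subset.antisymm
  · refine closure_minimal (fun z hz => ⟨hz.1.le, hz.2.le⟩) ?_
    have h1 : IsClosed {z : Space (n + 1) | ηm (horiz z) ≤ vert z} :=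
      isClosed_le (by fun_prop) (by fun_prop)
    have h2 : IsClosed {z : Space (n + 1) | vert z ≤ ηp (horiz z)} :=
      isClosed_le (by fun_prop) (by fun_prop)
    exact h1.inter h2
  · intro z hz
    have h1 : vert z ∈ closure (Ioo (ηm (horiz z)) (ηp (horiz z))) := by
      rw [closure_Ioo (hlt _).ne]; exact hz
    have h2 : MapsTo (fun t => join (horiz z) t) (Ioo (ηm (horiz z)) (ηp (horiz z)))
        (graphDomain ηm ηp) := fun t ht => join_mem_graphDomain.2 ht
    have h3 := map_mem_closure (f := fun t => join (horiz z) t) (by fun_prop) h1 h2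
    simpa using h3

theorem frontier_graphDomain (hm : Continuous ηm) (hp : Continuous ηp) (hlt : ∀ x, ηm x < ηp x) :
    frontier (graphDomain ηm ηp) = range (graphMap ηp) ∪ range (graphMap ηm) := by
  rw [frontier, (isOpen_graphDomain hm hp).interior_eq, closure_graphDomain hm hp hlt]
  ext z
  have := hlt (horiz z)
  simp only [Set.mem_sdiff, mem_ofPred_eq, graphDomain, mem_union, mem_range_graphMap]
  grind

theorem disjoint_range_graphMap (hlt : ∀ x, ηm x < ηp x) :
    Disjoint (range (graphMap ηp)) (range (graphMap ηm)) := by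
  rw [Set.disjoint_left]
  intro z h1 h2
  rw [mem_range_graphMap] at h1 h2
  have := hlt (horiz z)
  linarith

/-- A real supremum has the default value 0 when the set is unbounded; the Lipschitz hypothesis
supplies the bound that makes `lipSeminorm` a genuine supremum. -/
theorem abs_sub_le_lipSeminorm {η : Space n → ℝ} (h : ∃ K : ℝ≥0, LipschitzWith K η)
    (x y : Space n) : |η x - η y| ≤ lipSeminorm η * dist x y := by
  obtain ⟨K, hK⟩ := h
  rcases eq_or_ne x y with rfl | hxy
  · simp
  · have hd : 0 < dist x y := dist_pos.2 hxy
    rw [← div_le_iff₀ hd]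
    refine le_ciSup (f := fun q : Space n × Space n => |η q.1 - η q.2| / dist q.1 q.2) ?_ (x, y)
    refine ⟨K, ?_⟩
    rintro _ ⟨q, rfl⟩
    have := hK.dist_le_mul q.1 q.2
    rw [Real.dist_eq] at this
    exact div_le_of_le_mul₀ dist_nonneg K.2 this

theorem lipSeminorm_nonneg (η : Space n → ℝ) : 0 ≤ lipSeminorm η :=
  Real.iSup_nonneg fun q => by positivity

end Domain

end StripTrace

end

noncomputable section

namespace StripTrace

/-! ### The area formula for Lipschitz graphs -/

section Area

/-- The hypothesis forces `f` to factor through `g` on `s` by a `K`-Lipschitz map, obtained by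
composing `f` with a right inverse of `g`. Comparing two maps on the same parameter set lets the
graph be measured against a linear image in both directions. -/
theorem euclideanHausdorffMeasure_image_le {α Y Z : Type*} [MetricSpace Y] [MetricSpace Z]
    [MeasurableSpace Y] [BorelSpace Y] [MeasurableSpace Z] [BorelSpace Z]
    {d : ℕ} {K : ℝ≥0} {f : α → Y} {g : α → Z} {s : Set α}
    (h : ∀ x ∈ s, ∀ y ∈ s, dist (f x) (f y) ≤ K * dist (g x) (g y)) :
    Measure.euclideanHausdorffMeasure d (f '' s) ≤
      (K : ℝ≥0∞) ^ d * Measure.euclideanHausdorffMeasure d (g '' s) := by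
  rcases s.eq_empty_or_nonempty with rfl | ⟨x₀, hx₀⟩
  · simp
  have : Nonempty α := ⟨x₀⟩
  set r := Function.invFunOn g s
  have hr : ∀ x ∈ s, r (g x) ∈ s ∧ g (r (g x)) = g x := fun x hx =>
    Function.invFunOn_pos ⟨x, hx, rfl⟩
  have hfr : ∀ x ∈ s, f (r (g x)) = f x := by
    intro x hx
    have := h _ (hr x hx).1 x hx
    rw [(hr x hx).2, dist_self, mul_zero] at this
    exact dist_le_zero.1 this
  have hL : LipschitzOnWith K (f ∘ r) (g '' s) := by
    refine LipschitzOnWith.of_dist_le_mul ?_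
    rintro _ ⟨x, hx, rfl⟩ _ ⟨y, hy, rfl⟩
    simp only [Function.comp, hfr x hx, hfr y hy]
    exact h x hx y hy
  have him : (f ∘ r) '' (g '' s) = f '' s := by
    rw [image_image]
    exact image_congr fun x hx => hfr x hx
  have h1 := hL.hausdorffMeasure_image_le (d := d) (by positivity)
  rw [him, ENNReal.rpow_natCast] at h1
  simp only [Measure.euclideanHausdorffMeasure_def, Measure.smul_apply, ENNReal.smul_def,
    smul_eq_mul]
  rw [mul_left_comm]
  gcongr

variable {n : ℕ}

/-- The area density `√(1 + |∇η|²)` of the graph of `η`. -/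
def areaDensity (η : Space n → ℝ) (x : Space n) : ℝ := √(1 + ‖∇ η x‖ ^ 2)

/-- The square root of `1 + a aᵀ`. -/
def stretch (a : Space n) : Space n →ₗ[ℝ] Space n :=
  LinearMap.transvection (innerSL ℝ a : Space n →ₗ[ℝ] ℝ) ((1 + √(1 + ‖a‖ ^ 2))⁻¹ • a)

theorem stretch_apply (a v : Space n) :
    stretch a v = v + inner ℝ a v • (1 + √(1 + ‖a‖ ^ 2))⁻¹ • a := by
  simp [stretch, LinearMap.transvection.apply]

theorem norm_stretch_sq (a v : Space n) :
    ‖stretch a v‖ ^ 2 = ‖v‖ ^ 2 + inner ℝ a v ^ 2 := by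
  have hs : √(1 + ‖a‖ ^ 2) ^ 2 = 1 + ‖a‖ ^ 2 := Real.sq_sqrt (by positivity)
  have hs0 : 0 ≤ √(1 + ‖a‖ ^ 2) := Real.sqrt_nonneg _
  rw [stretch_apply, smul_smul, norm_add_sq_real, inner_smul_right, norm_smul, mul_pow,
    real_inner_comm a v, Real.norm_eq_abs, sq_abs]
  set s := √(1 + ‖a‖ ^ 2)
  have h1 : ‖a‖ ^ 2 = s ^ 2 - 1 := by linarith
  have : 1 + s ≠ 0 := by positivity
  rw [h1]
  field_simp
  ring

/-- With `s = √(1 + ‖a‖²)`, the transvection has determinant `1 + ‖a‖² / (1 + s)`, which is `s`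
because `‖a‖² = (s - 1)(s + 1)`. -/
theorem det_stretch (a : Space n) : LinearMap.det (stretch a) = √(1 + ‖a‖ ^ 2) := by
  have hs : √(1 + ‖a‖ ^ 2) ^ 2 = 1 + ‖a‖ ^ 2 := Real.sq_sqrt (by positivity)
  have hs0 : 0 ≤ √(1 + ‖a‖ ^ 2) := Real.sqrt_nonneg _
  rw [stretch, LinearMap.transvection.det]
  simp only [ContinuousLinearMap.coe_coe, innerSL_apply_apply, inner_smul_right,
    real_inner_self_eq_norm_sq]
  set s := √(1 + ‖a‖ ^ 2)
  have h1 : ‖a‖ ^ 2 = s ^ 2 - 1 := by linarith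
  have : 1 + s ≠ 0 := by positivity
  rw [h1]
  field_simp
  ring

theorem euclideanHausdorffMeasure_stretch_image (a : Space n) (s : Set (Space n)) :
    Measure.euclideanHausdorffMeasure n (stretch a '' s) =
      ENNReal.ofReal (√(1 + ‖a‖ ^ 2)) * volume s := by
  rw [EuclideanSpace.euclideanHausdorffMeasure_eq_volume, Measure.addHaar_image_linearMap,
    det_stretch, abs_of_nonneg (Real.sqrt_nonneg _)]

/-- A hyperplane of slope `a` is thus isometric to the image of `stretch a` in the base, where the
Hausdorff measure is Lebesgue measure and the determinant gives the area density. -/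
theorem norm_join_inner (a v : Space n) : ‖join v (inner ℝ a v)‖ = ‖stretch a v‖ := by
  rw [← sq_eq_sq₀ (norm_nonneg _) (norm_nonneg _), norm_join_sq, norm_stretch_sq]

theorem norm_le_norm_stretch (a v : Space n) : ‖v‖ ≤ ‖stretch a v‖ := by
  rw [← sq_le_sq₀ (norm_nonneg _) (norm_nonneg _), norm_stretch_sq]
  nlinarith [sq_nonneg (inner ℝ a v)]

theorem abs_norm_join_sub_le (v : Space n) (s t : ℝ) :
    |‖join v s‖ - ‖join v t‖| ≤ |s - t| := by
  refine (abs_norm_sub_norm_le _ _).trans ?_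
  rw [join_sub_join, norm_join]
  simp [Real.sqrt_sq_eq_abs]

/-- An error `ε‖x - y‖` in the linear approximation of `η` becomes a relative error `ε` in
distances, since `stretch a` does not shorten vectors. -/
theorem abs_dist_graphMap_sub_le {η : Space n → ℝ} {a x y : Space n} {ε : ℝ} (hε : 0 ≤ ε)
    (h : |η x - η y - inner ℝ a (x - y)| ≤ ε * ‖x - y‖) :
    |dist (graphMap η x) (graphMap η y) - dist (stretch a x) (stretch a y)| ≤
      ε * dist (stretch a x) (stretch a y) := by
  rw [dist_eq_norm, dist_eq_norm, graphMap, graphMap, join_sub_join, ← map_sub, ← norm_join_inner]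
  refine (abs_norm_join_sub_le _ _ _).trans (h.trans ?_)
  rw [norm_join_inner]
  gcongr
  exact norm_le_norm_stretch _ _

theorem graph_measure_le {η : Space n → ℝ} {a : Space n} {ε : ℝ≥0} {s : Set (Space n)}
    (h : ∀ x ∈ s, ∀ y ∈ s, |η x - η y - inner ℝ a (x - y)| ≤ ε * ‖x - y‖) :
    Measure.euclideanHausdorffMeasure n (graphMap η '' s) ≤
      ((1 + ε : ℝ≥0) : ℝ≥0∞) ^ n * (ENNReal.ofReal (√(1 + ‖a‖ ^ 2)) * volume s) := by
  rw [← euclideanHausdorffMeasure_stretch_image]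
  refine euclideanHausdorffMeasure_image_le fun x hx y hy => ?_
  have h1 := (abs_le.1 (abs_dist_graphMap_sub_le ε.coe_nonneg (h x hx y hy))).2
  have h2 : dist (graphMap η x) (graphMap η y) ≤
      (1 + ε) * dist (stretch a x) (stretch a y) := by linarith
  exact h2

theorem le_graph_measure {η : Space n → ℝ} {a : Space n} {ε : ℝ≥0} {s : Set (Space n)}
    (hε : ε < 1) (h : ∀ x ∈ s, ∀ y ∈ s, |η x - η y - inner ℝ a (x - y)| ≤ ε * ‖x - y‖) :
    ENNReal.ofReal (√(1 + ‖a‖ ^ 2)) * volume s ≤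
      (((1 - ε)⁻¹ : ℝ≥0) : ℝ≥0∞) ^ n *
        Measure.euclideanHausdorffMeasure n (graphMap η '' s) := by
  rw [← euclideanHausdorffMeasure_stretch_image]
  refine euclideanHausdorffMeasure_image_le fun x hx y hy => ?_
  have := (abs_le.1 (abs_dist_graphMap_sub_le ε.coe_nonneg (h x hx y hy))).1
  have h1 : (0 : ℝ) < 1 - ε := by
    have : (ε : ℝ) < 1 := by exact_mod_cast hε
    linarith
  rw [NNReal.coe_inv, NNReal.coe_sub hε.le, NNReal.coe_one, inv_mul_eq_div, le_div_iff₀ h1]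
  have h2 : dist (stretch a x) (stretch a y) * (1 - ε) ≤
      dist (graphMap η x) (graphMap η y) := by linarith
  exact h2

theorem measurable_gradient (η : Space n → ℝ) : Measurable (∇ η) :=
  (InnerProductSpace.toDual ℝ (Space n)).symm.continuous.measurable.comp (measurable_fderiv ℝ η)

theorem measurable_areaDensity (η : Space n → ℝ) : Measurable (areaDensity η) := by
  have := measurable_gradient η
  unfold areaDensity
  fun_prop

theorem one_le_areaDensity (η : Space n → ℝ) (x : Space n) : 1 ≤ areaDensity η x :=
  Real.one_le_sqrt.2 (by nlinarith [sq_nonneg ‖∇ η x‖])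

/-- The density is `‖(a, 1)‖`, so the triangle inequality applies; since `‖(b, 1)‖ ≥ 1`, the
additive error is also a relative one. -/
theorem sqrt_one_add_norm_sq_le {a b : Space n} {ε : ℝ} (h : ‖a - b‖ ≤ ε) :
    √(1 + ‖a‖ ^ 2) ≤ (1 + ε) * √(1 + ‖b‖ ^ 2) := by
  have h1 : ∀ c : Space n, √(1 + ‖c‖ ^ 2) = ‖join c 1‖ := fun c => by
    rw [norm_join]; congr 1; ring
  have h2 : 1 ≤ √(1 + ‖b‖ ^ 2) := Real.one_le_sqrt.2 (by nlinarith [sq_nonneg ‖b‖])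
  have h3 : ‖join a 1‖ ≤ ‖join b 1‖ + ‖join a 1 - join b 1‖ := by
    simpa using norm_add_le (join b 1) (join a 1 - join b 1)
  have h4 : ‖join a 1 - join b 1‖ = ‖a - b‖ := by
    rw [join_sub_join, norm_join]; simp
  have h5 : 0 ≤ ε := (norm_nonneg _).trans h
  rw [h4] at h3
  rw [← h1, ← h1] at h3
  nlinarith

theorem lintegral_areaDensity_le {η : Space n → ℝ} {a : Space n} {ε : ℝ≥0} {s : Set (Space n)}
    (hs : MeasurableSet s) (h : ∀ x ∈ s, ‖∇ η x - a‖ ≤ ε) :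
    ∫⁻ x in s, ENNReal.ofReal (areaDensity η x) ≤
      ((1 + ε : ℝ≥0) : ℝ≥0∞) * (ENNReal.ofReal (√(1 + ‖a‖ ^ 2)) * volume s) := by
  rw [← mul_assoc, ← setLIntegral_const]
  refine setLIntegral_mono' hs fun x hx => ?_
  rw [← ENNReal.ofReal_coe_nnreal, ← ENNReal.ofReal_mul (by positivity)]
  exact ENNReal.ofReal_le_ofReal (by simpa [areaDensity] using sqrt_one_add_norm_sq_le (h x hx))

theorem le_lintegral_areaDensity {η : Space n → ℝ} {a : Space n} {ε : ℝ≥0} {s : Set (Space n)}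
    (hs : MeasurableSet s) (h : ∀ x ∈ s, ‖∇ η x - a‖ ≤ ε) :
    ENNReal.ofReal (√(1 + ‖a‖ ^ 2)) * volume s ≤
      ((1 + ε : ℝ≥0) : ℝ≥0∞) * ∫⁻ x in s, ENNReal.ofReal (areaDensity η x) := by
  rw [← setLIntegral_const, ← lintegral_const_mul' _ _ (by simp)]
  refine setLIntegral_mono' hs fun x hx => ?_
  rw [← ENNReal.ofReal_coe_nnreal, ← ENNReal.ofReal_mul (by positivity)]
  refine ENNReal.ofReal_le_ofReal ?_
  simpa [areaDensity] using sqrt_one_add_norm_sq_le (a := a) (b := ∇ η x) (ε := ε)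
    (by rw [norm_sub_rev]; exact h x hx)

theorem measure_le_of_forall_inter_le {α : Type*} [MeasurableSpace α] {μ ν : Measure α}
    {A : Set α} {t : ℕ → Set α} (ht : ∀ k, MeasurableSet (t k)) (hA : MeasurableSet A)
    (hd : Pairwise (Function.onFun Disjoint t))
    (hc : A ⊆ ⋃ k, t k) (h : ∀ k, μ (A ∩ t k) ≤ ν (A ∩ t k)) : μ A ≤ ν A := by
  have h1 : A = ⋃ k, A ∩ t k := by rw [← inter_iUnion, inter_eq_left.2 hc]
  have h2 : Pairwise (Function.onFun Disjoint fun k => A ∩ t k) := fun i j hij =>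
    (hd hij).mono inter_subset_right inter_subset_right
  rw [h1, measure_iUnion h2 fun k => hA.inter (ht k), measure_iUnion h2 fun k => hA.inter (ht k)]
  exact ENNReal.tsum_le_tsum h

/-- The base is first cut into sets on which the gradient stays in a ball of radius `ε / 2`, and
each of these into pieces where `η` is nearly linear. The linear map attached to a piece is the
derivative at some point of the same gradient slice, so it is within `ε` of every gradient on the
piece. -/
theorem exists_partition_graph {η : Space n → ℝ} {A : Set (Space n)}
    (hd : ∀ x ∈ A, DifferentiableAt ℝ η x) {ε : ℝ≥0} (hε : 0 < ε) :
    ∃ (t : ℕ × ℕ → Set (Space n)) (a : ℕ × ℕ → Space n),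
      Pairwise (Function.onFun Disjoint t) ∧ (∀ k, MeasurableSet (t k)) ∧ A ⊆ ⋃ k, t k ∧
      (∀ k, ∀ x ∈ A ∩ t k, ∀ y ∈ A ∩ t k,
        |η x - η y - inner ℝ (a k) (x - y)| ≤ ε * ‖x - y‖) ∧
      ∀ k, ∀ x ∈ A ∩ t k, ‖∇ η x - a k‖ ≤ ε := by
  obtain ⟨q, hq⟩ := TopologicalSpace.exists_dense_seq (Space n)
  set B : ℕ → Set (Space n) := fun m => ∇ η ⁻¹' Metric.ball (q m) (ε / 2) with hB
  have hBm : ∀ m, MeasurableSet (B m) := fun m => measurable_gradient η Metric.isOpen_ball.measurableSet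
  have hBc : ⋃ m, B m = univ := by
    refine eq_univ_of_forall fun x => mem_iUnion.2 ?_
    obtain ⟨m, hm⟩ := hq.exists_dist_lt (∇ η x) (half_pos (NNReal.coe_pos.2 hε))
    exact ⟨m, hm⟩
  have hex : ∀ m, _ := fun m => exists_partition_approximatesLinearOn_of_hasFDerivWithinAt η
    (A ∩ disjointed B m) (fderiv ℝ η)
    (fun x hx => (hd x hx.1).hasFDerivAt.hasFDerivWithinAt) (fun _ => ε) (fun _ => hε.ne')
  choose t L htd htm htc htL hL using hex
  refine ⟨fun k => disjointed B k.1 ∩ t k.1 k.2,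
    fun k => (InnerProductSpace.toDual ℝ (Space n)).symm (L k.1 k.2), ?_, ?_, ?_, ?_, ?_⟩
  · rintro ⟨i, j⟩ ⟨i', j'⟩ hne
    rcases eq_or_ne i i' with rfl | hi
    · exact (htd i (fun h => hne (congrArg (Prod.mk i) h))).mono inter_subset_right inter_subset_right
    · exact (disjoint_disjointed B hi).mono inter_subset_left inter_subset_left
  · exact fun k => (MeasurableSet.disjointed hBm _).inter (htm _ _)
  · intro x hx
    have : x ∈ ⋃ m, disjointed B m := by rw [iUnion_disjointed, hBc]; trivial
    obtain ⟨m, hm⟩ := mem_iUnion.1 this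
    obtain ⟨j, hj⟩ := mem_iUnion.1 (htc m ⟨hx, hm⟩)
    exact mem_iUnion.2 ⟨(m, j), hm, hj⟩
  · intro k x hx y hy
    have := htL k.1 k.2 x ⟨⟨hx.1, hx.2.1⟩, hx.2.2⟩ y ⟨⟨hy.1, hy.2.1⟩, hy.2.2⟩
    rw [Real.norm_eq_abs] at this
    rw [InnerProductSpace.toDual_symm_apply]
    exact this
  · intro k x hx
    obtain ⟨y, hy, hLy⟩ := hL k.1 ⟨x, hx.1, hx.2.1⟩ k.2
    have hx' : x ∈ disjointed B k.1 := hx.2.1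
    have h1 : x ∈ B k.1 := disjointed_subset B k.1 hx'
    have h2 : y ∈ B k.1 := disjointed_subset B k.1 hy.2
    simp only [hB, mem_preimage] at h1 h2
    beta_reduce
    rw [hLy]
    change ‖∇ η x - ∇ η y‖ ≤ ε
    rw [← dist_eq_norm]
    rw [Metric.mem_ball] at h1 h2
    have := dist_triangle_right (∇ η x) (∇ η y) (q k.1)
    linarith

/-- The measure `x ↦ √(1 + |∇η|²) dx` on the base of the graph of `η`. -/
def areaMeasure (η : Space n → ℝ) : Measure (Space n) :=
  volume.withDensity fun x => ENNReal.ofReal (areaDensity η x)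

/-- On each piece both measures are compared with the measure of the same linear image; the errors
are relative, so they survive summation over countably many pieces. -/
theorem comap_graphMap_apply_le {η : Space n → ℝ} (hη : Continuous η) {A : Set (Space n)}
    (hA : MeasurableSet A) (hd : ∀ x ∈ A, DifferentiableAt ℝ η x) {ε : ℝ≥0} (hε : 0 < ε)
    (hε1 : ε < 1) :
    (Measure.euclideanHausdorffMeasure n).comap (graphMap η) A ≤
      (((1 + ε : ℝ≥0) : ℝ≥0∞) ^ n * (1 + ε : ℝ≥0)) * areaMeasure η A ∧
    areaMeasure η A ≤ ((1 + ε : ℝ≥0) * (((1 - ε)⁻¹ : ℝ≥0) : ℝ≥0∞) ^ n) *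
      (Measure.euclideanHausdorffMeasure n).comap (graphMap η) A := by
  obtain ⟨t, a, htd, htm, htc, h1, h2⟩ := exists_partition_graph hd hε
  obtain ⟨e⟩ : Nonempty (ℕ ≃ ℕ × ℕ) := ⟨Nat.pairEquiv.symm⟩
  have key : ∀ {μ ν : Measure (Space n)}, (∀ k, μ (A ∩ t k) ≤ ν (A ∩ t k)) → μ A ≤ ν A := by
    intro μ ν h
    refine measure_le_of_forall_inter_le (t := fun k => t (e k)) (fun k => htm _) hA
      (fun i j hij => htd (e.injective.ne hij)) ?_ fun k => h _
    rwa [e.surjective.iUnion_comp t]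
  have hE := measurableEmbedding_graphMap hη
  constructor
  · rw [← smul_eq_mul, ← Measure.smul_apply]
    refine key fun k => ?_
    have hm := hA.inter (htm k)
    rw [hE.comap_apply, Measure.smul_apply, areaMeasure, withDensity_apply _ hm, smul_eq_mul,
      mul_assoc]
    refine (graph_measure_le (h1 k)).trans ?_
    exact mul_le_mul_right (le_lintegral_areaDensity hm (h2 k)) _
  · rw [← smul_eq_mul _ ((Measure.euclideanHausdorffMeasure n).comap (graphMap η) A),
      ← Measure.smul_apply]
    refine key fun k => ?_
    have hm := hA.inter (htm k)
    rw [Measure.smul_apply, hE.comap_apply, areaMeasure, withDensity_apply _ hm, smul_eq_mul,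
      mul_assoc]
    refine (lintegral_areaDensity_le hm (h2 k)).trans ?_
    exact mul_le_mul_right (le_graph_measure hε1 (h1 k)) _

theorem comap_graphMap_apply_of_differentiable {η : Space n → ℝ} (hη : Continuous η)
    {A : Set (Space n)} (hA : MeasurableSet A) (hd : ∀ x ∈ A, DifferentiableAt ℝ η x) :
    (Measure.euclideanHausdorffMeasure n).comap (graphMap η) A = areaMeasure η A := by
  set X := (Measure.euclideanHausdorffMeasure n).comap (graphMap η) A
  have hev : ∀ᶠ ε : ℝ≥0 in 𝓝[>] 0, 0 < ε ∧ ε < 1 :=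
    (eventually_mem_nhdsWithin).and (mem_nhdsWithin_of_mem_nhds (Iio_mem_nhds zero_lt_one))
  have lim : ∀ (Y : ℝ≥0∞) (c : ℝ≥0 → ℝ≥0), ContinuousAt c 0 → c 0 = 1 →
      Tendsto (fun ε => (c ε : ℝ≥0∞) * Y) (𝓝[>] 0) (𝓝 Y) := by
    intro Y c hc h0
    have h1 : Tendsto (fun ε => (c ε : ℝ≥0∞)) (𝓝[>] 0) (𝓝 1) := by
      have := hc.tendsto
      rw [h0] at this
      exact (ENNReal.tendsto_coe.2 this).mono_left nhdsWithin_le_nhds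
    have := ENNReal.Tendsto.mul_const h1 (b := Y) (Or.inl one_ne_zero)
    rwa [one_mul] at this
  apply le_antisymm
  · refine ge_of_tendsto (lim (areaMeasure η A) (fun ε => (1 + ε) ^ n * (1 + ε)) ?_ (by simp)) ?_
    · fun_prop
    · filter_upwards [hev] with ε hε
      simpa using (comap_graphMap_apply_le hη hA hd hε.1 hε.2).1
  · refine ge_of_tendsto (lim X (fun ε => (1 + ε) * ((1 - ε)⁻¹) ^ n) ?_ (by simp)) ?_
    · have : ContinuousAt (fun ε : ℝ≥0 => (1 - ε)⁻¹) 0 :=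
        ContinuousAt.inv₀ (by fun_prop) (by simp)
      fun_prop
    · filter_upwards [hev] with ε hε
      simpa only [ENNReal.coe_mul, ENNReal.coe_pow] using
        (comap_graphMap_apply_le hη hA hd hε.1 hε.2).2

/-- The graph map is `(1 + K)`-Lipschitz. This disposes of the points where `η` is not
differentiable, a null set by Rademacher's theorem. -/
theorem comap_graphMap_null {η : Space n → ℝ} {K : ℝ≥0} (hη : LipschitzWith K η)
    {A : Set (Space n)} (hA : volume A = 0) :
    Measure.euclideanHausdorffMeasure n (graphMap η '' A) = 0 := by
  have h1 := euclideanHausdorffMeasure_image_le (d := n) (K := 1 + K) (f := graphMap η)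
    (g := (id : Space n → Space n)) (s := A) ?_
  · rw [image_id, EuclideanSpace.euclideanHausdorffMeasure_eq_volume, hA, mul_zero] at h1
    exact le_antisymm h1 zero_le
  · intro x _ y _
    rw [dist_eq_norm, graphMap, graphMap, join_sub_join, norm_join]
    have h2 := hη.dist_le_mul x y
    rw [Real.dist_eq, dist_eq_norm] at h2
    rw [id, id, dist_eq_norm]
    push_cast
    refine Real.sqrt_le_iff.2 ⟨by positivity, ?_⟩
    have h3 : (η x - η y) ^ 2 ≤ (K * ‖x - y‖) ^ 2 := by
      rw [← sq_abs (η x - η y)]; gcongr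
    nlinarith [mul_nonneg K.2 (sq_nonneg ‖x - y‖)]

/-- The area formula for the graph of a Lipschitz function. -/
theorem restrict_range_graphMap {η : Space n → ℝ} {K : ℝ≥0} (hη : LipschitzWith K η) :
    (Measure.euclideanHausdorffMeasure n).restrict (range (graphMap η)) =
      (areaMeasure η).map (graphMap η) := by
  have hE := measurableEmbedding_graphMap hη.continuous
  rw [← hE.map_comap]
  congr 1
  ext A hA
  set D := {x | DifferentiableAt ℝ η x}
  have hD : MeasurableSet D := measurableSet_of_differentiableAt ℝ η
  have hDc : volume (A \ D) = 0 := by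
    have h1 : volume Dᶜ = 0 := hη.ae_differentiableAt
    exact measure_mono_null (fun x hx => hx.2) h1
  rw [← measure_inter_add_sdiff A hD, ← measure_inter_add_sdiff (μ := areaMeasure η) A hD,
    comap_graphMap_apply_of_differentiable hη.continuous (hA.inter hD) fun x hx => hx.2,
    hE.comap_apply, comap_graphMap_null hη hDc,
    show areaMeasure η (A \ D) = 0 from withDensity_absolutelyContinuous _ _ hDc]

/-- The density is at least 1, so the two measures have the same null sets. -/
theorem ae_areaMeasure_iff {η : Space n → ℝ} {P : Space n → Prop} :
    (∀ᵐ x ∂areaMeasure η, P x) ↔ ∀ᵐ x, P x := by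
  have h1 : areaMeasure η ≪ volume := withDensity_absolutelyContinuous _ _
  have h2 : volume ≪ areaMeasure η := by
    refine withDensity_absolutelyContinuous' (measurable_areaDensity η).ennreal_ofReal.aemeasurable
      (ae_of_all _ fun x => ?_)
    have := one_le_areaDensity η x
    simp only [ne_eq, ENNReal.ofReal_eq_zero, not_le]
    linarith
  exact ⟨fun h => h2.ae_le h, fun h => h1.ae_le h⟩

variable {ηm ηp : Space n → ℝ}

theorem restrict_frontier_graphDomain {Km Kp : ℝ≥0} (hm : LipschitzWith Km ηm)
    (hp : LipschitzWith Kp ηp) (hlt : ∀ x, ηm x < ηp x) :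
    (Measure.euclideanHausdorffMeasure n).restrict (frontier (graphDomain ηm ηp)) =
      (areaMeasure ηp).map (graphMap ηp) + (areaMeasure ηm).map (graphMap ηm) := by
  rw [frontier_graphDomain hm.continuous hp.continuous hlt, Measure.restrict_union
    (disjoint_range_graphMap hlt) (isClosed_range_graphMap hm.continuous).measurableSet,
    restrict_range_graphMap hm, restrict_range_graphMap hp]

theorem ae_frontier_iff {Km Kp : ℝ≥0} (hm : LipschitzWith Km ηm)
    (hp : LipschitzWith Kp ηp) (hlt : ∀ x, ηm x < ηp x) {P : Space (n + 1) → Prop} :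
    (∀ᵐ z ∂(Measure.euclideanHausdorffMeasure n).restrict (frontier (graphDomain ηm ηp)), P z) ↔
      (∀ᵐ x, P (graphMap ηp x)) ∧ ∀ᵐ x, P (graphMap ηm x) := by
  rw [restrict_frontier_graphDomain hm hp hlt, ae_add_measure_iff,
    (measurableEmbedding_graphMap hp.continuous).ae_map_iff,
    (measurableEmbedding_graphMap hm.continuous).ae_map_iff, ae_areaMeasure_iff,
    ae_areaMeasure_iff]

end Area

end StripTrace

end

noncomputable section

namespace StripTrace

/-! ### Weak directional derivatives and difference quotients -/

section WeakDir

variable {N : ℕ} {Ω : Set (Space N)} {e : Space N} {u g : Space N → ℝ}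

/-- `g ∈ L^1_loc(Ω)` is the weak derivative in `Ω` of `u ∈ L^1_loc(Ω)` along the vector `e`. -/
def HasWeakDir (Ω : Set (Space N)) (e : Space N) (u g : Space N → ℝ) : Prop :=
  (∀ K : Set (Space N), IsCompact K → K ⊆ Ω → IntegrableOn u K) ∧
  (∀ K : Set (Space N), IsCompact K → K ⊆ Ω → IntegrableOn g K) ∧
  ∀ φ : Space N → ℝ, ContDiff ℝ ∞ φ → HasCompactSupport φ → tsupport φ ⊆ Ω →
    ∫ x in Ω, u x * fderiv ℝ φ x e = - ∫ x in Ω, g x * φ x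

theorem fderiv_apply_eq_sum (φ : Space N → ℝ) (x e : Space N) :
    fderiv ℝ φ x e = ∑ i, e i * pderiv i φ x := by
  conv_lhs => rw [← (EuclideanSpace.basisFun (Fin N) ℝ).sum_repr e]
  simp [pderiv]

/-- At least one coordinate is needed, because the local integrability of `u` is read off from one
of the partial derivatives. -/
theorem HasWeakPartial.hasWeakDir [NeZero N] {G : Space N → Space N}
    (h : ∀ i, HasWeakPartial Ω i u fun x => G x i) (e : Space N) :
    HasWeakDir Ω e u fun x => inner ℝ e (G x) := by
  have hin : (fun x => inner ℝ e (G x)) = fun x => ∑ i, e i * G x i := by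
    ext x
    simp [PiLp.inner_apply, mul_comm]
  refine ⟨(h 0).1, fun K hK hKΩ => ?_, fun φ h1 h2 h3 => ?_⟩
  · rw [hin]
    exact integrable_finsetSum _ fun i _ => ((h i).2.1 K hK hKΩ).const_mul _
  · rw [hin]
    simp only [fderiv_apply_eq_sum, Finset.mul_sum, Finset.sum_mul]
    rw [integral_finsetSum, integral_finsetSum, ← Finset.sum_neg_distrib]
    · refine Finset.sum_congr rfl fun i _ => ?_
      have := (h i).2.2 φ h1 h2 h3
      simp only [mul_left_comm _ (e i), mul_assoc]
      rw [integral_const_mul, integral_const_mul, this]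
      ring
    · intro i _
      simp only [mul_assoc]
      exact (integrable_mul_test (h i).2.1 h1.continuous h2 h3).const_mul _
    · intro i _
      simp only [mul_left_comm _ (e i)]
      refine (integrable_mul_test (h i).1 (continuous_pderiv i h1) ?_ ?_).const_mul _
      · exact h2.of_isClosed_subset (isClosed_tsupport _) (tsupport_pderiv_subset i φ)
      · exact (tsupport_pderiv_subset i φ).trans h3

theorem HasWeakDir.smul (h : HasWeakDir Ω e u g) (c : ℝ) :
    HasWeakDir Ω (c • e) u (fun x => c * g x) := by
  refine ⟨h.1, fun K hK hKΩ => (h.2.1 K hK hKΩ).const_mul c, fun φ h1 h2 h3 => ?_⟩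
  simp only [map_smul, smul_eq_mul, mul_left_comm _ c, mul_assoc]
  rw [integral_const_mul, integral_const_mul, h.2.2 φ h1 h2 h3]
  ring

theorem HasWeakDir.congr_right {k : Space N → ℝ} (h : HasWeakDir Ω e u g)
    (hk : k =ᵐ[volume.restrict Ω] g) : HasWeakDir Ω e u k := by
  refine ⟨h.1, fun K hK hKS => (h.2.1 K hK hKS).congr
    (ae_mono (Measure.restrict_mono_set volume hKS) hk.symm), fun φ h1 h2 h3 => ?_⟩
  rw [h.2.2 φ h1 h2 h3]
  congr 1
  refine integral_congr_ae ?_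
  filter_upwards [hk] with x hx
  rw [hx]

/-- This lets Fubini's theorem be applied to `g (z + s • e)` jointly in `s` and `z`, including
measurability for a `g` that is only a.e. strongly measurable. -/
theorem measurePreserving_shear (e : Space N) (ν : Measure ℝ) [SFinite ν] :
    MeasurePreserving (fun q : ℝ × Space N => (q.1, q.2 + q.1 • e)) (ν.prod volume)
      (ν.prod volume) := by
  refine (MeasurePreserving.id ν).skew_product (g := fun s z => z + s • e) ?_ ?_
  · unfold Function.uncurry; fun_prop
  · exact ae_of_all _ fun s => map_add_right_eq_self _ _

/-- The unit interval as a finite measure. -/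
abbrev unitInt : Measure ℝ := volume.restrict (Ioc 0 1)

theorem integrable_prod_mul_shift {φ : Space N → ℝ} (hg : Integrable g) (hφ : Continuous φ)
    (hc : HasCompactSupport φ) (e : Space N) :
    Integrable (fun q : ℝ × Space N => g q.2 * φ (q.2 - q.1 • e)) (unitInt.prod volume) := by
  obtain ⟨C, hC⟩ := hφ.bounded_above_of_compact_support hc
  refine (hg.comp_snd unitInt).mul_bdd (c := C) ?_ (ae_of_all _ fun q => hC _)
  have : Continuous fun q : ℝ × Space N => φ (q.2 - q.1 • e) := by fun_prop
  exact this.aestronglyMeasurable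

theorem integrable_average_shift (hg : Integrable g) (e : Space N) :
    Integrable fun z => ∫ s in (0 : ℝ)..1, g (z + s • e) := by
  have h1 := ((measurePreserving_shear e unitInt).integrable_comp
    (hg.comp_snd unitInt).1).2 (hg.comp_snd unitInt)
  have h2 := h1.integral_prod_right
  simpa only [intervalIntegral.integral_of_le zero_le_one, Function.comp_apply] using h2

theorem integral_mul_average_shift {φ : Space N → ℝ} (hg : Integrable g) (hφ : Continuous φ)
    (hc : HasCompactSupport φ) (e : Space N) :
    ∫ z, φ z * ∫ s in (0 : ℝ)..1, g (z + s • e) =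
      ∫ s, (∫ z, g z * φ (z - s • e)) ∂unitInt := by
  have h0 := integrable_prod_mul_shift hg hφ hc e
  have hS := measurePreserving_shear e unitInt
  have h1 := (hS.integrable_comp h0.1).2 h0
  have h2 : ∀ s : ℝ, ∫ z, g z * φ (z - s • e) = ∫ z, φ z * g (z + s • e) := by
    intro s
    rw [← integral_add_right_eq_self _ (s • e)]
    simp [mul_comm]
  simp only [h2, intervalIntegral.integral_of_le zero_le_one]
  rw [integral_integral_swap]
  · simp only [integral_const_mul]
  · simpa [Function.comp_def, Function.uncurry_def, mul_comm] using h1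

theorem integral_mul_sub_shift {φ : Space N → ℝ} (hu : Integrable u) (hφ : Continuous φ)
    (hc : HasCompactSupport φ) (e : Space N) :
    ∫ z, φ z * (u (z + e) - u z) = ∫ z, u z * (φ (z - e) - φ z) := by
  obtain ⟨C, hC⟩ := hφ.bounded_above_of_compact_support hc
  have i1 : Integrable fun z => u z * φ z :=
    hu.mul_bdd (c := C) hφ.aestronglyMeasurable (ae_of_all _ hC)
  have i2 : Integrable fun z => u z * φ (z - e) :=
    hu.mul_bdd (c := C) (by fun_prop) (ae_of_all _ fun z => hC _)
  have i3 : Integrable fun z => φ z * u (z + e) := by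
    have := i2.comp_add_right e
    simpa [mul_comm] using this
  simp only [mul_sub]
  rw [integral_sub i3 (by simpa [mul_comm] using i1), integral_sub i2 i1,
    ← integral_add_right_eq_self (fun z => u z * φ (z - e)) e]
  simp [mul_comm]

/-- The translation is moved from `u` to `φ`, the difference of `φ` is written as the integral of
its derivative along the segment, and the weak derivative is used for each translate of `φ`
separately. -/
theorem integral_mul_sub_shift_of_smooth {φ : Space N → ℝ} (hu : Integrable u)
    (hφ : ContDiff ℝ ∞ φ) (hc : HasCompactSupport φ) (e : Space N)
    (h : ∀ s ∈ Ioc (0 : ℝ) 1,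
      ∫ z, u z * fderiv ℝ φ (z - s • e) e = - ∫ z, g z * φ (z - s • e)) :
    ∫ z, φ z * (u (z + e) - u z) = ∫ s, (∫ z, g z * φ (z - s • e)) ∂unitInt := by
  rw [integral_mul_sub_shift hu hφ.continuous hc]
  have hd : Continuous fun z => fderiv ℝ φ z e :=
    (hφ.continuous_fderiv (by simp)).clm_apply continuous_const
  have hdc : HasCompactSupport fun z => fderiv ℝ φ z e :=
    hc.of_isClosed_subset (isClosed_tsupport _) (tsupport_fderiv_apply_subset ℝ _)
  have h1 : ∀ z, φ (z - e) - φ z = - ∫ s, fderiv ℝ φ (z - s • e) e ∂unitInt := by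
    intro z
    have hder : ∀ s ∈ uIcc (0 : ℝ) 1,
        HasDerivAt (fun s : ℝ => φ (z - s • e)) (- fderiv ℝ φ (z - s • e) e) s := by
      intro s _
      have e1 : HasDerivAt (fun s : ℝ => z - s • e) (-((1 : ℝ) • e)) s :=
        ((hasDerivAt_id s).smul_const e).const_sub z
      have e2 := ((hφ.differentiable (by simp)) (z - s • e)).hasFDerivAt.comp_hasDerivAt s e1
      simpa [Function.comp_def] using e2
    have hci : IntervalIntegrable (fun s : ℝ => - fderiv ℝ φ (z - s • e) e) volume 0 1 := by
      have : Continuous fun s : ℝ => - fderiv ℝ φ (z - s • e) e :=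
        (hd.comp (by fun_prop : Continuous fun s : ℝ => z - s • e)).neg
      exact this.intervalIntegrable _ _
    have := intervalIntegral.integral_eq_sub_of_hasDerivAt hder hci
    rw [intervalIntegral.integral_of_le zero_le_one, integral_neg] at this
    simpa using this.symm
  simp only [h1, mul_neg, ← integral_const_mul]
  rw [integral_neg, integral_integral_swap, ← integral_neg]
  · refine setIntegral_congr_fun measurableSet_Ioc fun s hs => ?_
    rw [h s hs, neg_neg]
  · have := integrable_prod_mul_shift hu hd hdc e
    exact this.swap

theorem isOpen_forall_segment (hΩ : IsOpen Ω) (e : Space N) :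
    IsOpen {z | ∀ s ∈ Icc (0 : ℝ) 1, z + s • e ∈ Ω} := by
  rw [isOpen_iff_mem_nhds]
  intro z hz
  refine isCompact_Icc.eventually_forall_of_forall_eventually fun s hs => ?_
  have : Continuous fun q : Space N × ℝ => q.1 + q.2 • e := by fun_prop
  exact this.continuousAt.eventually (hΩ.mem_nhds (hz s hs))

theorem isCompact_sweep {K : Set (Space N)} (hK : IsCompact K) (e : Space N) :
    IsCompact ((fun q : Space N × ℝ => q.1 + q.2 • e) '' (K ×ˢ Icc (0 : ℝ) 1)) :=
  (hK.prod isCompact_Icc).image (by fun_prop)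

/-- The fundamental theorem of calculus along segments for weak derivatives. -/
theorem HasWeakDir.ae_sub_eq (hΩ : IsOpen Ω) (h : HasWeakDir Ω e u g) :
    ∀ᵐ z, (∀ s ∈ Icc (0 : ℝ) 1, z + s • e ∈ Ω) →
      u (z + e) - u z = ∫ s in (0 : ℝ)..1, g (z + s • e) := by
  set Ω' := {z | ∀ s ∈ Icc (0 : ℝ) 1, z + s • e ∈ Ω}
  have hΩ' : IsOpen Ω' := isOpen_forall_segment hΩ e
  set sw : Set (Space N) → Set (Space N) := fun K =>
    (fun q : Space N × ℝ => q.1 + q.2 • e) '' (K ×ˢ Icc (0 : ℝ) 1) with hsw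
  have sw_mem : ∀ {K : Set (Space N)} {z : Space N} {s : ℝ}, z ∈ K → s ∈ Icc (0 : ℝ) 1 →
      z + s • e ∈ sw K := fun {K z s} hz hs => ⟨(z, s), ⟨hz, hs⟩, rfl⟩
  have sw_sub : ∀ {K : Set (Space N)}, K ⊆ Ω' → sw K ⊆ Ω := by
    rintro K hK _ ⟨⟨z, s⟩, ⟨hz, hs⟩, rfl⟩
    exact hK hz s hs
  -- Local integrability is made global by cutting `u` and `g` off outside the set swept out by `K`
  -- along `e`; for base points in `K` the identity sees only values inside this set.
  have key : ∀ K : Set (Space N), IsCompact K → K ⊆ Ω' →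
      ∃ u' g' : Space N → ℝ, Integrable u' ∧ Integrable g' ∧
      (∀ z ∈ sw K, u' z = u z ∧ g' z = g z) ∧ ∀ z ∉ sw K, u' z = 0 ∧ g' z = 0 := by
    intro K hK hKΩ
    have hm : MeasurableSet (sw K) := (isCompact_sweep hK e).measurableSet
    refine ⟨(sw K).indicator u, (sw K).indicator g, ?_, ?_, ?_, ?_⟩
    · exact (h.1 _ (isCompact_sweep hK e) (sw_sub hKΩ)).integrable_indicator hm
    · exact (h.2.1 _ (isCompact_sweep hK e) (sw_sub hKΩ)).integrable_indicator hm
    · intro z hz; simp [hz]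
    · intro z hz; simp [hz]
  have agree : ∀ {K : Set (Space N)} {u' g' : Space N → ℝ},
      (∀ z ∈ sw K, u' z = u z ∧ g' z = g z) → ∀ z ∈ K,
      u' (z + e) - u' z - ∫ s in (0 : ℝ)..1, g' (z + s • e) =
      u (z + e) - u z - ∫ s in (0 : ℝ)..1, g (z + s • e) := by
    intro K u' g' hK z hz
    have h1 := (hK _ (sw_mem hz ⟨zero_le_one, le_rfl⟩)).1
    have h0 := (hK _ (sw_mem hz ⟨le_rfl, zero_le_one⟩)).1
    rw [one_smul] at h1
    rw [zero_smul, add_zero] at h0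
    rw [h0, h1]
    congr 1
    refine intervalIntegral.integral_congr fun s hs => ?_
    rw [uIcc_of_le zero_le_one] at hs
    exact (hK _ (sw_mem hz hs)).2
  -- The identity follows from the fundamental lemma of the calculus of variations on the open set
  -- of starting points whose whole segment lies in `Ω`.
  have main := hΩ'.ae_eq_zero_of_integral_contDiff_smul_eq_zero (μ := volume)
    (f := fun z => u (z + e) - u z - ∫ s in (0 : ℝ)..1, g (z + s • e)) ?_ ?_
  · filter_upwards [main] with z hz hz'
    exact sub_eq_zero.1 (hz hz')
  · rw [locallyIntegrableOn_iff hΩ'.isLocallyClosed]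
    intro K hKΩ hK
    obtain ⟨u', g', hu', hg', he, -⟩ := key K hK hKΩ
    have : Integrable fun z => u' (z + e) - u' z - ∫ s in (0 : ℝ)..1, g' (z + s • e) :=
      ((hu'.comp_add_right e).sub hu').sub (integrable_average_shift hg' e)
    exact this.integrableOn.congr_fun (agree he) hK.measurableSet
  · intro φ hφ hc hs
    obtain ⟨u', g', hu', hg', he, he0⟩ := key _ hc hs
    have e1 : ∀ z, φ z • (u (z + e) - u z - ∫ s in (0 : ℝ)..1, g (z + s • e)) =
        φ z * (u' (z + e) - u' z) - φ z * ∫ s in (0 : ℝ)..1, g' (z + s • e) := by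
      intro z
      by_cases hz : z ∈ tsupport φ
      · rw [← agree he z hz, smul_eq_mul, mul_sub]
      · rw [image_eq_zero_of_notMem_tsupport hz]; simp
    have bound := hφ.continuous.bounded_above_of_compact_support hc
    obtain ⟨C, hC⟩ := bound
    rw [integral_congr_ae (ae_of_all _ e1), integral_sub, integral_mul_average_shift hg'
      hφ.continuous hc, integral_mul_sub_shift_of_smooth hu' hφ hc (g := g'), sub_self]
    · intro s hs
      have hs' : s ∈ Icc (0 : ℝ) 1 := ⟨hs.1.le, hs.2⟩
      set ψ : Space N → ℝ := fun z => φ (z - s • e) with hψ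
      have t1 : tsupport ψ ⊆ sw (tsupport φ) := by
        have h1 : tsupport ψ = (Homeomorph.subRight (s • e)) ⁻¹' tsupport φ :=
          tsupport_comp_eq_preimage φ (Homeomorph.subRight (s • e))
        rw [h1]
        intro z hz
        have := sw_mem (K := tsupport φ) hz hs'
        simpa using this
      have h1 := h.2.2 ψ (hφ.comp (by fun_prop)) (hc.comp_homeomorph (Homeomorph.subRight (s • e)))
        (t1.trans (sw_sub ‹_›))
      have h2 : ∀ z, fderiv ℝ ψ z e = fderiv ℝ φ (z - s • e) e := fun z => by
        rw [hψ, fderiv_comp_sub]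
      have z1 : ∀ z ∉ tsupport ψ, fderiv ℝ ψ z e = 0 := fun z hz =>
        image_eq_zero_of_notMem_tsupport (f := fun z => fderiv ℝ ψ z e)
          fun hh => hz (tsupport_fderiv_apply_subset ℝ e hh)
      rw [setIntegral_eq_integral_of_forall_compl_eq_zero,
        setIntegral_eq_integral_of_forall_compl_eq_zero] at h1
      · calc _ = ∫ z, u z * fderiv ℝ ψ z e := by
              refine integral_congr_ae (ae_of_all _ fun z => ?_)
              simp only [← h2]
              by_cases hz : z ∈ tsupport ψ
              · rw [(he z (t1 hz)).1]
              · rw [z1 z hz]; simp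
          _ = _ := h1
          _ = _ := by
              congr 1
              refine integral_congr_ae (ae_of_all _ fun z => ?_)
              simp only
              by_cases hz : z ∈ tsupport ψ
              · rw [(he z (t1 hz)).2]
              · have : φ (z - s • e) = 0 := image_eq_zero_of_notMem_tsupport (f := ψ) hz
                simp [ψ, this]
      · intro z hz
        rw [image_eq_zero_of_notMem_tsupport fun hh => hz (sw_sub ‹_› (t1 hh)), mul_zero]
      · intro z hz
        rw [z1 z fun hh => hz (sw_sub ‹_› (t1 hh)), mul_zero]
    · exact ((hu'.comp_add_right e).sub hu').bdd_mul (c := C) hφ.continuous.aestronglyMeasurable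
        (ae_of_all _ hC)
    · exact (integrable_average_shift hg' e).bdd_mul (c := C) hφ.continuous.aestronglyMeasurable
        (ae_of_all _ hC)

end WeakDir

end StripTrace

end

noncomputable section

namespace StripTrace

/-! ### Lipschitz test functions for weak derivatives -/

section WeakDirLipschitz

variable {N : ℕ} {Ω : Set (Space N)} {e : Space N} {u g : Space N → ℝ}

/-- Here `φ` need not be differentiable: the a.e. identity for differences of `u` is integrated
against `φ`, and only then is the translation moved to `φ`. Division by `t` produces a difference
quotient of `φ`. -/
theorem HasWeakDir.integral_diffQuot (hΩ : IsOpen Ω) (h : HasWeakDir Ω e u g) {φ : Space N → ℝ}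
    (hφ : Continuous φ) (hc : HasCompactSupport φ) {K : Set (Space N)}
    (hu : Integrable (K.indicator u)) (hg : Integrable (K.indicator g)) (hKΩ : K ⊆ Ω)
    {t : ℝ} (ht : t ≠ 0)
    (hK : ∀ z ∈ tsupport φ, ∀ s ∈ Icc (0 : ℝ) 1, z + s • t • e ∈ K) :
    ∫ z, K.indicator u z * (t⁻¹ * (φ (z + t • -e) - φ z)) =
      ∫ s, (∫ z, K.indicator g z * φ (z - s • t • e)) ∂unitInt := by
  have h1 : ∀ᵐ z, φ z * (K.indicator u (z + t • e) - K.indicator u z) =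
      φ z * ∫ s in (0 : ℝ)..1, t * K.indicator g (z + s • t • e) := by
    filter_upwards [(h.smul t).ae_sub_eq hΩ] with z hz
    by_cases hzK : z ∈ tsupport φ
    · rw [indicator_of_mem (by simpa using hK z hzK 1 ⟨zero_le_one, le_rfl⟩),
        indicator_of_mem (by simpa using hK z hzK 0 ⟨le_rfl, zero_le_one⟩),
        hz fun s hs => hKΩ (hK z hzK s hs)]
      congr 1
      refine intervalIntegral.integral_congr fun s hs => ?_
      rw [uIcc_of_le zero_le_one] at hs
      simp [indicator_of_mem (hK z hzK s hs)]
    · rw [image_eq_zero_of_notMem_tsupport hzK]; simp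
  have h2 := integral_congr_ae h1
  rw [integral_mul_sub_shift hu hφ hc, integral_mul_average_shift (hg.const_mul t) hφ hc] at h2
  simp only [mul_assoc, integral_const_mul] at h2
  simp only [mul_left_comm _ t⁻¹, integral_const_mul, smul_neg, ← sub_eq_add_neg]
  rw [h2, inv_mul_cancel_left₀ ht]

/-- Lipschitz test functions are admissible in the definition of the weak derivative. -/
theorem HasWeakDir.integral_lipschitz (hΩ : IsOpen Ω) (h : HasWeakDir Ω e u g)
    {φ : Space N → ℝ} {C : ℝ≥0} (hφ : LipschitzWith C φ) (hc : HasCompactSupport φ)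
    (hs : tsupport φ ⊆ Ω) :
    ∫ x in Ω, u x * fderiv ℝ φ x e = - ∫ x in Ω, g x * φ x := by
  obtain ⟨δ, hδ, hδΩ⟩ := hc.isCompact.exists_cthickening_subset_open hΩ hs
  set K := Metric.cthickening δ (tsupport φ) with hKdef
  have hKc : IsCompact K := hc.isCompact.cthickening
  have hKm : MeasurableSet K := hKc.measurableSet
  have hu : Integrable (K.indicator u) := (h.1 K hKc hδΩ).integrable_indicator hKm
  have hg : Integrable (K.indicator g) := (h.2.1 K hKc hδΩ).integrable_indicator hKm
  have hsub : tsupport φ ⊆ K := Metric.self_subset_cthickening _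
  obtain ⟨B, hB⟩ := hφ.continuous.bounded_above_of_compact_support hc
  -- These step sizes tend to 0 and satisfy `t k * ‖e‖ ≤ δ`, so that the translates stay in the
  -- `δ`-neighbourhood `K`; the summand 1 covers `e = 0`.
  set t : ℕ → ℝ := fun k => δ / (‖e‖ + 1) / (k + 1) with htdef
  have htpos : ∀ k, 0 < t k := fun k => by positivity
  have ht0 : Tendsto t atTop (𝓝 0) := by
    have := (tendsto_one_div_add_atTop_nhds_zero_nat (𝕜 := ℝ)).const_mul (δ / (‖e‖ + 1))
    simpa [t, div_eq_mul_inv] using this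
  have htK : ∀ k, ∀ z ∈ tsupport φ, ∀ s ∈ Icc (0 : ℝ) 1, z + s • t k • e ∈ K := by
    intro k z hz s hs
    refine Metric.mem_cthickening_of_dist_le _ z _ _ hz ?_
    rw [dist_eq_norm, add_sub_cancel_left, norm_smul, norm_smul, Real.norm_eq_abs,
      Real.norm_eq_abs, abs_of_nonneg hs.1, abs_of_pos (htpos k)]
    have h1 : t k * ‖e‖ ≤ δ := by
      have h3 : t k ≤ δ / (‖e‖ + 1) := div_le_self (by positivity) (by simp)
      calc t k * ‖e‖ ≤ δ / (‖e‖ + 1) * (‖e‖ + 1) := by gcongr; simp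
        _ = δ := by field_simp
    calc s * (t k * ‖e‖) ≤ 1 * (t k * ‖e‖) := by
          gcongr
          exact hs.2
      _ ≤ δ := by rw [one_mul]; exact h1
  have heq : ∀ k, ∫ z, K.indicator u z * ((t k)⁻¹ * (φ (z + t k • -e) - φ z)) =
      ∫ q, K.indicator g q.2 * φ (q.2 - q.1 • t k • e) ∂unitInt.prod volume := fun k => by
    rw [h.integral_diffQuot hΩ hφ.continuous hc hu hg hδΩ (htpos k).ne' (htK k),
      integral_prod _ (integrable_prod_mul_shift hg hφ.continuous hc _)]
  have lim1 : Tendsto (fun k => ∫ z, K.indicator u z * ((t k)⁻¹ * (φ (z + t k • -e) - φ z)))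
      atTop (𝓝 (∫ z, K.indicator u z * fderiv ℝ φ z (-e))) := by
    refine tendsto_integral_of_dominated_convergence (fun z => ‖K.indicator u z‖ * (C * ‖e‖))
      (fun k => ?_) (hu.norm.mul_const _) (fun k => ae_of_all _ fun z => ?_) ?_
    · refine hu.1.mul (Continuous.aestronglyMeasurable ?_)
      have := hφ.continuous
      fun_prop
    · rw [norm_mul]
      gcongr
      rw [norm_mul, norm_inv, Real.norm_eq_abs (t k), abs_of_pos (htpos k),
        inv_mul_le_iff₀ (htpos k)]
      have := hφ.dist_le_mul (z + t k • -e) z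
      rw [dist_eq_norm, dist_eq_norm, add_sub_cancel_left, norm_smul, norm_neg,
        Real.norm_eq_abs (t k), abs_of_pos (htpos k)] at this
      linarith
    -- By Rademacher's theorem the difference quotients converge almost everywhere; the Lipschitz
    -- constant gives the dominating function.
    · filter_upwards [hφ.ae_differentiableAt (μ := volume)] with z hz
      refine Tendsto.const_mul _ ?_
      have := hz.hasFDerivAt.lim (-e) (c := fun k => (t k)⁻¹) (l := atTop) ?_
      · simpa using this
      · have h1 : Tendsto t atTop (𝓝[>] 0) :=
          tendsto_nhdsWithin_iff.2 ⟨ht0, Eventually.of_forall htpos⟩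
        exact tendsto_norm_atTop_atTop.comp (tendsto_inv_nhdsGT_zero.comp h1)
  have lim2 : Tendsto (fun k => ∫ q, K.indicator g q.2 * φ (q.2 - q.1 • t k • e)
      ∂unitInt.prod volume) atTop (𝓝 (∫ q, K.indicator g q.2 * φ q.2 ∂unitInt.prod volume)) := by
    have hg2 := hg.comp_snd unitInt
    refine tendsto_integral_of_dominated_convergence (fun q => ‖K.indicator g q.2‖ * B)
      (fun k => ?_) (hg2.norm.mul_const _) (fun k => ae_of_all _ fun z => ?_)
      (ae_of_all _ fun q => ?_)
    · refine hg2.1.mul (Continuous.aestronglyMeasurable ?_)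
      have := hφ.continuous
      fun_prop
    · rw [norm_mul]
      gcongr
      exact hB _
    · refine Tendsto.const_mul _ ?_
      have h1 : Tendsto (fun k => q.2 - q.1 • t k • e) atTop (𝓝 (q.2 - q.1 • (0 : ℝ) • e)) :=
        ((ht0.smul_const e).const_smul q.1).const_sub q.2
      have h2 := (hφ.continuous.tendsto (q.2 - q.1 • (0 : ℝ) • e)).comp h1
      simpa [Function.comp_def] using h2
  have h3 := tendsto_nhds_unique lim1 ((tendsto_congr heq).2 lim2)
  have h4 : ∫ q, K.indicator g q.2 * φ q.2 ∂unitInt.prod volume = ∫ z, K.indicator g z * φ z := by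
    have hi : Integrable fun z => K.indicator g z * φ z :=
      hg.mul_bdd (c := B) hφ.continuous.aestronglyMeasurable (ae_of_all _ hB)
    rw [integral_prod _ (hi.comp_snd unitInt)]
    simp
  rw [h4] at h3
  have zero : ∀ z ∉ tsupport φ, fderiv ℝ φ z e = 0 := fun z hz =>
    image_eq_zero_of_notMem_tsupport (f := fun z => fderiv ℝ φ z e)
      fun hh => hz (tsupport_fderiv_apply_subset ℝ e hh)
  rw [setIntegral_eq_integral_of_forall_compl_eq_zero,
    setIntegral_eq_integral_of_forall_compl_eq_zero]
  · have e1 : ∫ z, u z * fderiv ℝ φ z e = - ∫ z, K.indicator u z * fderiv ℝ φ z (-e) := by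
      rw [← integral_neg]
      congr 1 with z
      by_cases hz : z ∈ tsupport φ
      · simp [indicator_of_mem (hsub hz)]
      · simp [zero z hz]
    have e2 : ∫ z, g z * φ z = ∫ z, K.indicator g z * φ z := by
      congr 1 with z
      by_cases hz : z ∈ tsupport φ
      · simp [indicator_of_mem (hsub hz)]
      · simp [image_eq_zero_of_notMem_tsupport hz]
    rw [e1, e2, h3]
  · intro z hz
    rw [image_eq_zero_of_notMem_tsupport fun hh => hz (hs hh), mul_zero]
  · intro z hz
    rw [zero z fun hh => hz (hs hh), mul_zero]

end WeakDirLipschitz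

end StripTrace

end

noncomputable section

namespace StripTrace

/-! ### Absolute continuity on vertical lines and the traces on the two graphs -/

section Slices

theorem measurableSet_mem_Ioo {α : Type*} [MeasurableSpace α] {f a b : α → ℝ} (hf : Measurable f)
    (ha : Measurable a) (hb : Measurable b) : MeasurableSet {x | f x ∈ Ioo (a x) (b x)} := by
  have h1 : MeasurableSet {x | a x < f x} := measurableSet_lt ha hf
  have h2 : MeasurableSet {x | f x < b x} := measurableSet_lt hf hb
  exact h1.inter h2

theorem measurableSet_mem_Ioc {α : Type*} [MeasurableSpace α] {f a b : α → ℝ} (hf : Measurable f)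
    (ha : Measurable a) (hb : Measurable b) : MeasurableSet {x | f x ∈ Ioc (a x) (b x)} := by
  have h1 : MeasurableSet {x | a x < f x} := measurableSet_lt ha hf
  have h2 : MeasurableSet {x | f x ≤ b x} := measurableSet_le hf hb
  exact h1.inter h2

theorem intervalIntegrable_of_integrableOn_Ioo {G : ℝ → ℝ} {a b s t : ℝ}
    (hG : IntegrableOn G (Ioo a b)) (hs : s ∈ Icc a b) (ht : t ∈ Icc a b) :
    IntervalIntegrable G volume s t := by
  rw [intervalIntegrable_iff]
  rw [← integrableOn_Icc_iff_integrableOn_Ioo] at hG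
  exact hG.mono_set ((uIoc_subset_uIcc).trans (uIcc_subset_Icc hs ht))

/-- A single good base point `t₀` suffices: as `τ` runs over almost all reals, `t₀ + τ` runs over
almost every point of the interval. -/
theorem exists_ae_eq_const_add_integral {G w : ℝ → ℝ} {a b : ℝ} (hab : a < b)
    (hG : IntegrableOn G (Ioo a b))
    (h : ∀ᵐ t, ∀ᵐ τ, t ∈ Ioo a b → t + τ ∈ Ioo a b →
      w (t + τ) - w t = ∫ s in (0 : ℝ)..1, τ * G (t + s * τ)) :
    ∃ c, ∀ᵐ t ∂volume.restrict (Ioo a b), w t = c + ∫ s in a..t, G s := by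
  have hne : (ae (volume.restrict (Ioo a b))).NeBot := by
    rw [ae_neBot, ne_eq, Measure.restrict_eq_zero, Real.volume_Ioo, ENNReal.ofReal_eq_zero]
    linarith
  have h1 := (ae_restrict_of_ae (s := Ioo a b) h).and (ae_restrict_mem measurableSet_Ioo)
  obtain ⟨t₀, ht₀, ht₀'⟩ := h1.exists
  refine ⟨w t₀ - ∫ s in a..t₀, G s, ?_⟩
  rw [ae_restrict_iff' measurableSet_Ioo]
  have h2 := (measurePreserving_sub_right volume t₀).quasiMeasurePreserving.ae ht₀
  filter_upwards [h2] with t ht htI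
  have h3 := ht ht₀' (by simpa using htI)
  rw [add_sub_cancel] at h3
  have h4 : ∫ s in (0 : ℝ)..1, (t - t₀) * G (t₀ + s * (t - t₀)) = ∫ s in t₀..t, G s := by
    rw [intervalIntegral.integral_const_mul]
    have := intervalIntegral.smul_integral_comp_add_mul (a := 0) (b := 1) G (t - t₀) t₀
    simpa [mul_comm] using this
  have i1 := intervalIntegrable_of_integrableOn_Ioo hG ⟨le_rfl, hab.le⟩ (Ioo_subset_Icc_self ht₀')
  have i2 := intervalIntegrable_of_integrableOn_Ioo hG (Ioo_subset_Icc_self ht₀')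
    (Ioo_subset_Icc_self htI)
  have h5 := intervalIntegral.integral_add_adjacent_intervals i1 i2
  rw [h4] at h3
  linarith

variable {n : ℕ} {ηm ηp : Space n → ℝ}

theorem measurableSet_graphDomain (hm : Continuous ηm) (hp : Continuous ηp) :
    MeasurableSet (graphDomain ηm ηp) := (isOpen_graphDomain hm hp).measurableSet

theorem lintegral_graphDomain (hm : Continuous ηm) (hp : Continuous ηp)
    {F : Space (n + 1) → ℝ≥0∞} (hF : Measurable F) :
    ∫⁻ z in graphDomain ηm ηp, F z = ∫⁻ x, ∫⁻ t in Ioo (ηm x) (ηp x), F (join x t) := by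
  have hD := measurableSet_graphDomain hm hp
  rw [← lintegral_indicator hD, ← measurePreserving_join.lintegral_comp (hF.indicator hD),
    Measure.volume_eq_prod, lintegral_prod (fun q => (graphDomain ηm ηp).indicator F (join q.1 q.2))
      ((hF.indicator hD).comp measurePreserving_join.measurable).aemeasurable]
  refine lintegral_congr fun x => ?_
  rw [← lintegral_indicator measurableSet_Ioo]
  refine lintegral_congr fun t => ?_
  simp only [indicator, join_mem_graphDomain, mem_Ioo]

theorem integrableOn_graphDomain_iff (hm : Continuous ηm) (hp : Continuous ηp)
    {F : Space (n + 1) → ℝ} :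
    IntegrableOn F (graphDomain ηm ηp) ↔ Integrable (fun q : Space n × ℝ =>
      (Ioo (ηm q.1) (ηp q.1)).indicator (fun t => F (join q.1 t)) q.2) := by
  have hD := measurableSet_graphDomain hm hp
  rw [← integrable_indicator_iff hD,
    ← measurePreserving_join.integrable_comp_emb measurableEmbedding_join]
  refine integrable_congr (ae_of_all _ fun q => ?_)
  simp only [Function.comp, indicator, join_mem_graphDomain, mem_Ioo]

theorem integral_graphDomain (hm : Continuous ηm) (hp : Continuous ηp)
    {F : Space (n + 1) → ℝ} (hF : IntegrableOn F (graphDomain ηm ηp)) :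
    Integrable (fun x => ∫ t in Ioo (ηm x) (ηp x), F (join x t)) ∧
    ∫ z in graphDomain ηm ηp, F z = ∫ x, ∫ t in Ioo (ηm x) (ηp x), F (join x t) := by
  have hD := measurableSet_graphDomain hm hp
  have hi := (integrableOn_graphDomain_iff hm hp).1 hF
  have h1 : ∀ x, ∫ t, (Ioo (ηm x) (ηp x)).indicator (fun t => F (join x t)) t =
      ∫ t in Ioo (ηm x) (ηp x), F (join x t) := fun x => integral_indicator measurableSet_Ioo
  constructor
  · have := hi.integral_prod_left
    simpa only [h1] using this
  · rw [← integral_indicator hD,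
      ← measurePreserving_join.integral_comp measurableEmbedding_join]
    have e1 : ∀ q : Space n × ℝ, (graphDomain ηm ηp).indicator F (join q.1 q.2) =
        (Ioo (ηm q.1) (ηp q.1)).indicator (fun t => F (join q.1 t)) q.2 := fun q => by
      simp only [indicator, join_mem_graphDomain, mem_Ioo]
    simp only [e1]
    rw [Measure.volume_eq_prod, integral_prod _ hi]
    simp only [h1]

theorem ae_graphDomain_iff (hm : Continuous ηm) (hp : Continuous ηp)
    {P : Space (n + 1) → Prop} (h : ∀ᵐ z ∂volume.restrict (graphDomain ηm ηp), P z) :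
    ∀ᵐ x, ∀ᵐ t ∂volume.restrict (Ioo (ηm x) (ηp x)), P (join x t) := by
  rw [ae_restrict_iff' (measurableSet_graphDomain hm hp), ae_join_iff, Measure.volume_eq_prod] at h
  filter_upwards [Measure.ae_ae_of_ae_prod h] with x hx
  rw [ae_restrict_iff' measurableSet_Ioo]
  filter_upwards [hx] with t ht htI
  exact ht (join_mem_graphDomain.2 htI)

/-- `fm` and `fp` are the boundary values, on the graphs of `ηm` and `ηp`, of a function `u` that
is absolutely continuous with derivative `g` on almost every vertical segment. -/
def IsVertTrace (ηm ηp : Space n → ℝ) (u g : Space (n + 1) → ℝ) (fm fp : Space n → ℝ) : Prop :=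
  ∀ᵐ x, IntegrableOn (fun t => g (join x t)) (Ioo (ηm x) (ηp x)) ∧
    (∀ᵐ t ∂volume.restrict (Ioo (ηm x) (ηp x)),
      u (join x t) = fm x + ∫ s in ηm x..t, g (join x s)) ∧
    fp x = fm x + ∫ s in ηm x..ηp x, g (join x s)

/-- By Fubini almost every slice of `g` is in `L^p`, and the slices are bounded intervals. -/
theorem ae_integrableOn_slice (hm : Continuous ηm) (hp : Continuous ηp)
    {g : Space (n + 1) → ℝ} (hg : Measurable g) {p : ℝ} (h1p : 1 ≤ p)
    (hgp : ∫⁻ z in graphDomain ηm ηp, ‖g z‖ₑ ^ p ≠ ⊤) :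
    ∀ᵐ x, IntegrableOn (fun t => g (join x t)) (Ioo (ηm x) (ηp x)) := by
  have hF : Measurable fun z => ‖g z‖ₑ ^ p := by fun_prop
  rw [lintegral_graphDomain hm hp hF] at hgp
  have hmeas : Measurable fun x => ∫⁻ t in Ioo (ηm x) (ηp x), ‖g (join x t)‖ₑ ^ p := by
    have hset : MeasurableSet {q : Space n × ℝ | q.2 ∈ Ioo (ηm q.1) (ηp q.1)} :=
      measurableSet_mem_Ioo (by fun_prop) (by fun_prop) (by fun_prop)
    have : Measurable fun q : Space n × ℝ =>
        {q : Space n × ℝ | q.2 ∈ Ioo (ηm q.1) (ηp q.1)}.indicator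
          (fun q => ‖g (join q.1 q.2)‖ₑ ^ p) q :=
      Measurable.indicator (by fun_prop) hset
    convert! this.lintegral_prod_right' (ν := volume) using 2 with x
    rw [← lintegral_indicator measurableSet_Ioo]
    rfl
  filter_upwards [ae_lt_top hmeas hgp] with x hx
  have hp0 : 0 < p := by linarith
  have hml : MemLp (fun t => g (join x t)) (ENNReal.ofReal p)
      (volume.restrict (Ioo (ηm x) (ηp x))) := by
    refine ⟨(by fun_prop : Measurable fun t => g (join x t)).aestronglyMeasurable, ?_⟩
    rw [eLpNorm_lt_top_iff_lintegral_rpow_enorm_lt_top (by simpa using hp0) ENNReal.ofReal_ne_top,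
      ENNReal.toReal_ofReal hp0.le]
    exact hx
  exact hml.integrable (by simpa using h1p)

theorem exists_isVertTrace (hm : Continuous ηm) (hp : Continuous ηp) (hlt : ∀ x, ηm x < ηp x)
    {u g : Space (n + 1) → ℝ} (hu : Measurable u) (hg : Measurable g)
    (h : HasWeakDir (graphDomain ηm ηp) (EuclideanSpace.single (Fin.last n) 1) u g)
    (hgi : ∀ᵐ x, IntegrableOn (fun t => g (join x t)) (Ioo (ηm x) (ηp x))) :
    ∃ fm fp : Space n → ℝ, Measurable fm ∧ Measurable fp ∧ IsVertTrace ηm ηp u g fm fp := by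
  -- For a fixed vertical shift `τ` this is the fundamental theorem of calculus along segments; the
  -- segment stays in the domain because vertical slices are intervals.
  have step : ∀ τ : ℝ, ∀ᵐ q : Space n × ℝ, q.2 ∈ Ioo (ηm q.1) (ηp q.1) →
      q.2 + τ ∈ Ioo (ηm q.1) (ηp q.1) →
      u (join q.1 (q.2 + τ)) - u (join q.1 q.2) =
        ∫ s in (0 : ℝ)..1, τ * g (join q.1 (q.2 + s * τ)) := by
    intro τ
    have h1 := (h.smul τ).ae_sub_eq (isOpen_graphDomain hm hp)
    rw [ae_join_iff] at h1
    have h2 : ∀ (q : Space n × ℝ) (s : ℝ), join q.1 q.2 +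
        s • τ • EuclideanSpace.single (Fin.last n) 1 = join q.1 (q.2 + s * τ) := by
      intro q s
      rw [single_last_eq_join, ← join_smul, ← join_smul, ← join_add]
      simp
    have h3 : ∀ q : Space n × ℝ, join q.1 q.2 + τ • EuclideanSpace.single (Fin.last n) 1 =
        join q.1 (q.2 + τ) := fun q => by simpa using h2 q 1
    simp only [h2, h3] at h1
    filter_upwards [h1] with q hq hq1 hq2
    refine hq fun s hs => join_mem_graphDomain.2 ?_
    have : q.2 + s * τ = (1 - s) * q.2 + s * (q.2 + τ) := by ring
    rw [this]
    exact (convex_Ioo (ηm q.1) (ηp q.1)) hq1 hq2 (by linarith [hs.2]) hs.1 (by ring)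
  have hmeas : MeasurableSet {q : ℝ × (Space n × ℝ) | q.2.2 ∈ Ioo (ηm q.2.1) (ηp q.2.1) →
      q.2.2 + q.1 ∈ Ioo (ηm q.2.1) (ηp q.2.1) →
      u (join q.2.1 (q.2.2 + q.1)) - u (join q.2.1 q.2.2) =
        ∫ s in (0 : ℝ)..1, q.1 * g (join q.2.1 (q.2.2 + s * q.1))} := by
    have m1 : MeasurableSet {q : ℝ × (Space n × ℝ) | q.2.2 ∈ Ioo (ηm q.2.1) (ηp q.2.1)} :=
      measurableSet_mem_Ioo (by fun_prop) (by fun_prop) (by fun_prop)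
    have m2 : MeasurableSet {q : ℝ × (Space n × ℝ) | q.2.2 + q.1 ∈ Ioo (ηm q.2.1) (ηp q.2.1)} :=
      measurableSet_mem_Ioo (by fun_prop) (by fun_prop) (by fun_prop)
    have m3 : Measurable fun q : ℝ × (Space n × ℝ) =>
        ∫ s in (0 : ℝ)..1, q.1 * g (join q.2.1 (q.2.2 + s * q.1)) := by
      simp only [intervalIntegral.integral_of_le zero_le_one]
      have : StronglyMeasurable fun r : (ℝ × (Space n × ℝ)) × ℝ =>
          r.1.1 * g (join r.1.2.1 (r.1.2.2 + r.2 * r.1.1)) :=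
        Measurable.stronglyMeasurable (by fun_prop)
      exact this.integral_prod_right'.measurable
    have m4 : MeasurableSet {q : ℝ × (Space n × ℝ) |
        u (join q.2.1 (q.2.2 + q.1)) - u (join q.2.1 q.2.2) =
        ∫ s in (0 : ℝ)..1, q.1 * g (join q.2.1 (q.2.2 + s * q.1))} :=
      measurableSet_eq_fun (by fun_prop) m3
    exact m1.imp (m2.imp m4)
  -- The exceptional set depends on `τ`. Exchanging the quantifiers by Fubini gives, at almost every
  -- point, the identity for almost every `τ`, as the one-dimensional lemma requires.
  have step2 := (Measure.ae_ae_comm hmeas).1 (ae_of_all volume step)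
  rw [Measure.volume_eq_prod] at step2
  have step3 := Measure.ae_ae_of_ae_prod step2
  set D : Set (Space n × ℝ) := {q | q.2 ∈ Ioo (ηm q.1) (ηp q.1)} with hD
  have hDm : MeasurableSet D := measurableSet_mem_Ioo (by fun_prop) (by fun_prop) (by fun_prop)
  set S : Set ((Space n × ℝ) × ℝ) := {r | r.2 ∈ Ioc (ηm r.1.1) r.1.2} with hS
  have hSm : MeasurableSet S := measurableSet_mem_Ioc (by fun_prop) (by fun_prop) (by fun_prop)
  -- The primitive of `g` from the lower graph, written with an indicator so that its joint
  -- measurability follows from Fubini.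
  set prim : Space n × ℝ → ℝ := fun q =>
    ∫ s, S.indicator (fun r => g (join r.1.1 r.2)) (q, s) with hprim
  have prim_eq : ∀ q : Space n × ℝ, ηm q.1 ≤ q.2 →
      prim q = ∫ s in ηm q.1..q.2, g (join q.1 s) := by
    intro q hq
    rw [intervalIntegral.integral_of_le hq, ← integral_indicator measurableSet_Ioc]
    rfl
  have prim_meas : Measurable prim := by
    have : StronglyMeasurable (S.indicator fun r : (Space n × ℝ) × ℝ => g (join r.1.1 r.2)) :=
      StronglyMeasurable.indicator (Measurable.stronglyMeasurable (by fun_prop)) hSm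
    exact this.integral_prod_right'.measurable
  -- On almost every line `u` minus its primitive is a.e. constant and equals the lower boundary
  -- value. Taking the mean over the segment selects this constant measurably in `x`.
  set fm : Space n → ℝ := fun x => (ηp x - ηm x)⁻¹ *
    ∫ t, D.indicator (fun q => u (join q.1 q.2) - prim q) (x, t) with hfm
  have fm_meas : Measurable fm := by
    have : StronglyMeasurable (D.indicator fun q => u (join q.1 q.2) - prim q) :=
      StronglyMeasurable.indicator (Measurable.stronglyMeasurable (by fun_prop)) hDm
    have h2 := (this.integral_prod_right' (ν := volume)).measurable
    exact Measurable.mul (by fun_prop) h2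
  refine ⟨fm, fun x => fm x + prim (x, ηp x), fm_meas, by fun_prop, ?_⟩
  filter_upwards [step3, hgi] with x hx hgx
  refine ⟨hgx, ?_, by rw [prim_eq _ (hlt x).le]⟩
  obtain ⟨c, hc⟩ := exists_ae_eq_const_add_integral (w := fun t => u (join x t)) (hlt x) hgx hx
  have hfx : fm x = c := by
    have h1 : ∫ t, D.indicator (fun q => u (join q.1 q.2) - prim q) (x, t) =
        ∫ t in Ioo (ηm x) (ηp x), c := by
      have e1 : ∀ t, D.indicator (fun q => u (join q.1 q.2) - prim q) (x, t) =
          (Ioo (ηm x) (ηp x)).indicator (fun t => u (join x t) - prim (x, t)) t := fun t => rfl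
      simp only [e1]
      rw [integral_indicator measurableSet_Ioo]
      refine integral_congr_ae ?_
      filter_upwards [hc, ae_restrict_mem measurableSet_Ioo] with t ht htI
      rw [ht, prim_eq _ htI.1.le]
      ring
    have h2 : 0 < ηp x - ηm x := sub_pos.2 (hlt x)
    rw [hfm]
    beta_reduce
    rw [h1, setIntegral_const, smul_eq_mul, Measure.real, Real.volume_Ioo,
      ENNReal.toReal_ofReal h2.le, inv_mul_cancel_left₀ h2.ne']
  rw [hfx]
  exact hc

end Slices

end StripTrace

end

noncomputable section

namespace StripTrace

/-! ### Integration by parts -/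

section ByParts

/-- One-dimensional integration by parts on `(a, b)`. -/
theorem setIntegral_mul_deriv_of_ae_eq {G w ζ ζ' : ℝ → ℝ} {a b c : ℝ} (hab : a < b)
    (hG : IntegrableOn G (Ioo a b))
    (hw : ∀ᵐ t ∂volume.restrict (Ioo a b), w t = c + ∫ s in a..t, G s)
    (hζ : ∀ t, HasDerivAt ζ (ζ' t) t) (hζ' : Continuous ζ') :
    ∫ t in Ioo a b, w t * ζ' t =
      (c + ∫ s in a..b, G s) * ζ b - c * ζ a - ∫ t in Ioo a b, G t * ζ t := by
  have hGi := intervalIntegrable_of_integrableOn_Ioo hG ⟨le_rfl, hab.le⟩ ⟨hab.le, le_rfl⟩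
  set W : ℝ → ℝ := fun t => c + ∫ s in a..t, G s with hW
  have hW1 : AbsolutelyContinuousOnInterval W a b := by
    have h1 := hGi.absolutelyContinuousOnInterval_intervalIntegral (c := a) (by simp)
    have h2 : AbsolutelyContinuousOnInterval (fun _ : ℝ => c) a b :=
      (LipschitzWith.const c).lipschitzOnWith.absolutelyContinuousOnInterval (K := 0)
    exact h2.add h1
  have hder : deriv ζ = ζ' := funext fun t => (hζ t).deriv
  have hζ1 : AbsolutelyContinuousOnInterval ζ a b := by
    have h1 : ContDiff ℝ 1 ζ := by
      rw [contDiff_one_iff_deriv]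
      exact ⟨fun t => (hζ t).differentiableAt, by rwa [hder]⟩
    exact h1.contDiffOn.absolutelyContinuousOnInterval
  have h1 := hW1.integral_mul_deriv_eq_deriv_mul hζ1
  have e1 : ∫ t in Ioo a b, w t * ζ' t = ∫ t in a..b, W t * deriv ζ t := by
    rw [intervalIntegral.integral_of_le hab.le, integral_Ioc_eq_integral_Ioo]
    refine integral_congr_ae ?_
    filter_upwards [hw] with t ht
    rw [ht, hder]
  have e2 : ∫ t in Ioo a b, G t * ζ t = ∫ t in a..b, deriv W t * ζ t := by
    rw [intervalIntegral.integral_of_le hab.le, integral_Ioc_eq_integral_Ioo]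
    refine integral_congr_ae ?_
    filter_upwards [ae_restrict_of_ae hGi.ae_hasDerivAt_integral,
      ae_restrict_mem measurableSet_Ioo] with t ht htI
    have ht' : t ∈ uIcc a b := by rw [uIcc_of_le hab.le]; exact Ioo_subset_Icc_self htI
    rw [((ht ht' a (by simp)).const_add c).deriv]
  rw [e1, e2, h1, hW]
  simp

variable {n : ℕ} {ηm ηp : Space n → ℝ} {u g : Space (n + 1) → ℝ} {fm fp : Space n → ℝ}

/-- Integrability over the part of the domain above any compact set of the base. -/
def IntegrableOverCompacts (ηm ηp : Space n → ℝ) (u : Space (n + 1) → ℝ) : Prop :=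
  ∀ K : Set (Space n), IsCompact K → IntegrableOn u (graphDomain ηm ηp ∩ horiz ⁻¹' K)

theorem IntegrableOverCompacts.mul (hu : IntegrableOverCompacts ηm ηp u)
    {K : Set (Space n)} (hK : IsCompact K) {w : Space (n + 1) → ℝ}
    (hw : AEStronglyMeasurable w) {C : ℝ} (hC : ∀ z, ‖w z‖ ≤ C) (h0 : ∀ z, horiz z ∉ K → w z = 0) :
    IntegrableOn (fun z => u z * w z) (graphDomain ηm ηp) := by
  have h1 : IntegrableOn (fun z => u z * w z) (graphDomain ηm ηp ∩ horiz ⁻¹' K) :=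
    Integrable.mul_bdd (hu K hK) hw.restrict (ae_of_all _ hC)
  have hKm : MeasurableSet (horiz ⁻¹' K : Set (Space (n + 1))) :=
    measurable_horiz hK.measurableSet
  rw [IntegrableOn, inter_comm, ← Measure.restrict_restrict hKm] at h1
  refine (integrableOn_iff_integrable_of_support_subset ?_).1 h1
  intro z hz
  by_contra hzK
  exact hz (by simp [h0 z hzK])

/-- On almost every vertical segment `|u|` is at most `|fm|` plus the integral of `|g|` over the
segment, and over a compact part of the base the segments have bounded length. So `u` is integrable
up to the boundary, not only locally inside. -/
theorem IsVertTrace.integrableOverCompacts (h : IsVertTrace ηm ηp u g fm fp)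
    (hm : Continuous ηm) (hp : Continuous ηp) (hlt : ∀ x, ηm x < ηp x) (hu : Measurable u)
    (hg : IntegrableOverCompacts ηm ηp g)
    (hfm : ∀ K : Set (Space n), IsCompact K → IntegrableOn fm K) :
    IntegrableOverCompacts ηm ηp u := by
  intro K hK
  have hKm : MeasurableSet (horiz ⁻¹' K : Set (Space (n + 1))) :=
    measurable_horiz hK.measurableSet
  have hind : ∀ (F : Space (n + 1) → ℝ),
      IntegrableOn F (graphDomain ηm ηp ∩ horiz ⁻¹' K) ↔
      IntegrableOn ((horiz ⁻¹' K).indicator F) (graphDomain ηm ηp) := fun F => by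
    rw [IntegrableOn, IntegrableOn, integrable_indicator_iff hKm, IntegrableOn,
      Measure.restrict_restrict hKm, inter_comm]
  have hgK := (hind g).1 (hg K hK)
  rw [hind, integrableOn_graphDomain_iff hm hp]
  have hslice : ∀ (F : Space (n + 1) → ℝ) (x : Space n) (t : ℝ),
      (horiz ⁻¹' K).indicator F (join x t) = K.indicator (fun _ => F (join x t)) x := by
    intro F x t
    by_cases hx : x ∈ K
    · rw [indicator_of_mem hx, indicator_of_mem (by rwa [mem_preimage, horiz_join])]
    · rw [indicator_of_notMem hx, indicator_of_notMem (by rwa [mem_preimage, horiz_join])]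
  obtain ⟨hgi, -⟩ := integral_graphDomain hm hp hgK.norm
  have hmeas : AEStronglyMeasurable (fun q : Space n × ℝ => (Ioo (ηm q.1) (ηp q.1)).indicator
      (fun t => (horiz ⁻¹' K).indicator u (join q.1 t)) q.2) (volume.prod volume) := by
    have h1 : Measurable (fun q : Space n × ℝ => (horiz ⁻¹' K).indicator u (join q.1 q.2)) :=
      (hu.indicator hKm).comp (by fun_prop)
    have h2 : MeasurableSet {q : Space n × ℝ | q.2 ∈ Ioo (ηm q.1) (ηp q.1)} :=
      measurableSet_mem_Ioo (by fun_prop) (by fun_prop) (by fun_prop)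
    exact (h1.indicator h2).aestronglyMeasurable
  have hbound : ∀ᵐ x, ∀ᵐ t ∂volume.restrict (Ioo (ηm x) (ηp x)),
      ‖(horiz ⁻¹' K).indicator u (join x t)‖ ≤ ‖K.indicator fm x‖ +
        ∫ t in Ioo (ηm x) (ηp x), ‖(horiz ⁻¹' K).indicator g (join x t)‖ := by
    filter_upwards [h] with x hx
    filter_upwards [hx.2.1, ae_restrict_mem measurableSet_Ioo] with t ht htI
    by_cases hxK : x ∈ K
    · simp only [hslice, indicator_of_mem hxK]
      rw [ht]
      refine (norm_add_le _ _).trans (add_le_add le_rfl ?_)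
      rw [intervalIntegral.integral_of_le htI.1.le, integral_Ioc_eq_integral_Ioo]
      refine (norm_integral_le_integral_norm _).trans ?_
      exact setIntegral_mono_set hx.1.norm (ae_of_all _ fun _ => norm_nonneg _)
        (Ioo_subset_Ioo_right htI.2.le).eventuallyLE
    · simp [hslice, indicator_of_notMem hxK]
  have hδ : ∃ B, ∀ x ∈ K, ηp x - ηm x ≤ B := by
    obtain ⟨B, hB⟩ := (hK.image (f := fun x => ηp x - ηm x) (by fun_prop)).bddAbove
    exact ⟨B, fun x hx => hB ⟨x, hx, rfl⟩⟩
  obtain ⟨B, hB⟩ := hδ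
  set M : Space n → ℝ := fun x => ‖K.indicator fm x‖ +
        ∫ t in Ioo (ηm x) (ηp x), ‖(horiz ⁻¹' K).indicator g (join x t)‖ with hM
  have hMi : Integrable M := ((hfm K hK).integrable_indicator hK.measurableSet).norm.add hgi
  have hM0 : ∀ x, 0 ≤ M x := fun x => by positivity
  have hMK : ∀ x ∉ K, M x = 0 := fun x hx => by
    simp [hM, hslice, indicator_of_notMem hx]
  rw [Measure.volume_eq_prod, integrable_prod_iff hmeas]
  have hslm : ∀ x, AEStronglyMeasurable (fun t => (horiz ⁻¹' K).indicator u (join x t))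
      (volume.restrict (Ioo (ηm x) (ηp x))) := fun x =>
    ((hu.indicator hKm).comp (by fun_prop : Measurable fun t => join x t)).aestronglyMeasurable
  constructor
  · filter_upwards [hbound] with x hx
    rw [integrable_indicator_iff measurableSet_Ioo]
    exact Integrable.of_bound (hslm x) (M x) hx
  · refine Integrable.mono' (hMi.const_mul B) hmeas.norm.integral_prod_right' ?_
    filter_upwards [hbound] with x hx
    have h1 : ∀ t, ‖(Ioo (ηm x) (ηp x)).indicator
        (fun t => (horiz ⁻¹' K).indicator u (join x t)) t‖ = (Ioo (ηm x) (ηp x)).indicator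
        (fun t => ‖(horiz ⁻¹' K).indicator u (join x t)‖) t := fun t =>
      norm_indicator_eq_indicator_norm _ _
    simp only [h1]
    rw [integral_indicator measurableSet_Ioo, Real.norm_of_nonneg (by positivity)]
    have hfin : volume.real (Ioo (ηm x) (ηp x)) = ηp x - ηm x := by
      rw [Measure.real, Real.volume_Ioo, ENNReal.toReal_ofReal (sub_pos.2 (hlt x)).le]
    have h2 : ∫ t in Ioo (ηm x) (ηp x), ‖(horiz ⁻¹' K).indicator u (join x t)‖ ≤
        ∫ t in Ioo (ηm x) (ηp x), M x :=
      integral_mono_ae (Integrable.of_bound (hslm x) (M x) hx).norm (integrable_const _) hx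
    rw [setIntegral_const, hfin, smul_eq_mul] at h2
    refine h2.trans ?_
    by_cases hxK : x ∈ K
    · exact mul_le_mul_of_nonneg_right (hB x hxK) (hM0 x)
    · rw [hMK x hxK]; simp

/-- Integration by parts in the vertical direction against `c(x') χ(x) ψ(x)`. -/
theorem IsVertTrace.integral_mul_vertical (h : IsVertTrace ηm ηp u g fm fp)
    (hm : Continuous ηm) (hp : Continuous ηp) (hlt : ∀ x, ηm x < ηp x)
    (hu : IntegrableOverCompacts ηm ηp u) (hg : IntegrableOverCompacts ηm ηp g)
    {ψ χ b : Space (n + 1) → ℝ} {c vm vp : Space n → ℝ} (hψ : ContDiff ℝ 1 ψ)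
    (hψc : HasCompactSupport ψ) (hχ : ∀ x t, HasDerivAt (fun t => χ (join x t)) (b (join x t)) t)
    (hχc : Continuous χ) (hχ1 : ∀ z, ‖χ z‖ ≤ 1) (hb : Continuous b) {C B : ℝ}
    (hbB : ∀ z, ‖b z‖ ≤ B) (hc : Measurable c) (hcC : ∀ x, ‖c x‖ ≤ C)
    (hvp : ∀ x, ψ (join x (ηp x)) ≠ 0 → χ (join x (ηp x)) = vp x)
    (hvm : ∀ x, ψ (join x (ηm x)) ≠ 0 → χ (join x (ηm x)) = vm x) :
    ∫ z in graphDomain ηm ηp, u z * (c (horiz z) * ψ z * b z) =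
      (∫ x, c x * (fp x * (ψ (join x (ηp x)) * vp x) - fm x * (ψ (join x (ηm x)) * vm x))) -
      ∫ z in graphDomain ηm ηp, (g z * (c (horiz z) * ψ z * χ z) +
        u z * (c (horiz z) * fderiv ℝ ψ z (EuclideanSpace.single (Fin.last n) 1) * χ z)) := by
  set K : Set (Space n) := horiz '' tsupport ψ with hKdef
  have hK : IsCompact K := hψc.isCompact.image continuous_horiz
  have hψ0 : ∀ z, horiz z ∉ K → ψ z = 0 := fun z hz =>
    image_eq_zero_of_notMem_tsupport fun hh => hz ⟨z, hh, rfl⟩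
  set dψ : Space (n + 1) → ℝ := fun z => fderiv ℝ ψ z (EuclideanSpace.single (Fin.last n) 1)
    with hdψ
  have hdψc : Continuous dψ := (hψ.continuous_fderiv (by simp)).clm_apply continuous_const
  have hdψ0 : ∀ z, horiz z ∉ K → dψ z = 0 := fun z hz =>
    image_eq_zero_of_notMem_tsupport (f := dψ)
      fun hh => hz ⟨z, tsupport_fderiv_apply_subset ℝ _ hh, rfl⟩
  obtain ⟨P, hP⟩ := hψ.continuous.bounded_above_of_compact_support hψc
  obtain ⟨Q, hQ⟩ := hdψc.bounded_above_of_compact_support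
    (hψc.of_isClosed_subset (isClosed_tsupport _) (tsupport_fderiv_apply_subset ℝ _))
  have hP0 : 0 ≤ P := (norm_nonneg _).trans (hP 0)
  have hQ0 : 0 ≤ Q := (norm_nonneg _).trans (hQ 0)
  have hC0 : 0 ≤ C := (norm_nonneg _).trans (hcC 0)
  have hψm := hψ.continuous.measurable
  have hdψm := hdψc.measurable
  have hχm := hχc.measurable
  have hbm := hb.measurable
  have i1 : IntegrableOn (fun z => u z * (c (horiz z) * ψ z * b z)) (graphDomain ηm ηp) := by
    refine hu.mul hK (Measurable.aestronglyMeasurable (by fun_prop)) (C := C * P * B)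
      (fun z => ?_) fun z hz => by simp [hψ0 z hz]
    rw [norm_mul, norm_mul]
    gcongr
    exacts [hcC _, hP _, hbB _]
  have i2 : IntegrableOn (fun z => g z * (c (horiz z) * ψ z * χ z)) (graphDomain ηm ηp) := by
    refine hg.mul hK (Measurable.aestronglyMeasurable (by fun_prop)) (C := C * P * 1)
      (fun z => ?_) fun z hz => by simp [hψ0 z hz]
    rw [norm_mul, norm_mul]
    gcongr
    exacts [hcC _, hP _, hχ1 _]
  have i3 : IntegrableOn (fun z => u z * (c (horiz z) * dψ z * χ z)) (graphDomain ηm ηp) := by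
    refine hu.mul hK (Measurable.aestronglyMeasurable (by fun_prop)) (C := C * Q * 1)
      (fun z => ?_) fun z hz => by simp [hdψ0 z hz]
    rw [norm_mul, norm_mul]
    gcongr
    exacts [hcC _, hQ _, hχ1 _]
  obtain ⟨j1, e1⟩ := integral_graphDomain hm hp i1
  obtain ⟨j2, e2⟩ := integral_graphDomain hm hp (i2.add i3)
  simp only [Pi.add_apply] at j2 e2
  rw [e1, e2, eq_sub_iff_add_eq, ← integral_add j1 j2]
  refine integral_congr_ae ?_
  have s1 := (integrableOn_graphDomain_iff hm hp).1 i1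
  have s2 := (integrableOn_graphDomain_iff hm hp).1 i2
  have s3 := (integrableOn_graphDomain_iff hm hp).1 i3
  rw [Measure.volume_eq_prod] at s1 s2 s3
  filter_upwards [h, s1.prod_right_ae, s2.prod_right_ae, s3.prod_right_ae] with x hx h1 h2 h3
  rw [integrable_indicator_iff measurableSet_Ioo] at h1 h2 h3
  simp only [horiz_join] at h1 h2 h3 ⊢
  have hder : ∀ t, HasDerivAt (fun t => ψ (join x t) * χ (join x t))
      (dψ (join x t) * χ (join x t) + ψ (join x t) * b (join x t)) t := by
    intro t
    have d1 : HasDerivAt (fun t => join x t) (EuclideanSpace.single (Fin.last n) 1) t := by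
      have : (fun t => join x t) = fun t : ℝ => join x 0 +
          t • (EuclideanSpace.single (Fin.last n) 1 : Space (n + 1)) := by
        ext1 t
        rw [single_last_eq_join, ← join_smul, ← join_add]
        simp
      rw [this]
      simpa using ((hasDerivAt_id t).smul_const
        (EuclideanSpace.single (Fin.last n) 1 : Space (n + 1))).const_add (join x 0)
    have d2 : HasDerivAt (fun t => ψ (join x t)) (dψ (join x t)) t :=
      ((hψ.differentiable (by simp)) (join x t)).hasFDerivAt.comp_hasDerivAt t d1
    exact d2.mul (hχ x t)
  have hcont : Continuous fun t =>
      dψ (join x t) * χ (join x t) + ψ (join x t) * b (join x t) := by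
    have := hψ.continuous
    fun_prop
  have key := setIntegral_mul_deriv_of_ae_eq (hlt x) hx.1 hx.2.1 hder hcont
  rw [← hx.2.2] at key
  have hvp' : ψ (join x (ηp x)) * χ (join x (ηp x)) = ψ (join x (ηp x)) * vp x := by
    by_cases h0 : ψ (join x (ηp x)) = 0
    · simp [h0]
    · rw [hvp x h0]
  have hvm' : ψ (join x (ηm x)) * χ (join x (ηm x)) = ψ (join x (ηm x)) * vm x := by
    by_cases h0 : ψ (join x (ηm x)) = 0
    · simp [h0]
    · rw [hvm x h0]
  rw [hvp', hvm'] at key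
  have h23 : IntegrableOn (fun t => g (join x t) * (c x * ψ (join x t) * χ (join x t)) +
      u (join x t) * (c x * dψ (join x t) * χ (join x t))) (Ioo (ηm x) (ηp x)) := h2.add h3
  rw [← integral_add h1 h23]
  have e4 : ∫ t in Ioo (ηm x) (ηp x), (u (join x t) * (c x * ψ (join x t) * b (join x t)) +
      (g (join x t) * (c x * ψ (join x t) * χ (join x t)) +
        u (join x t) * (c x * dψ (join x t) * χ (join x t)))) =
      c x * ∫ t in Ioo (ηm x) (ηp x), (u (join x t) *
        (dψ (join x t) * χ (join x t) + ψ (join x t) * b (join x t)) +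
        g (join x t) * (ψ (join x t) * χ (join x t))) := by
    rw [← integral_const_mul]
    congr 1 with t
    ring
  -- Integrability on the slice is known only for the products with `c x`; if `c x ≠ 0` this factor
  -- is divided out, otherwise both sides vanish.
  by_cases hc0 : c x = 0
  · rw [e4]
    simp [hc0]
  have e5 : ∀ {F : ℝ → ℝ}, IntegrableOn (fun t => c x * F t) (Ioo (ηm x) (ηp x)) →
      IntegrableOn F (Ioo (ηm x) (ηp x)) := by
    intro F hF
    have := hF.const_mul (c x)⁻¹
    simpa [IntegrableOn, hc0] using this
  have k1 : IntegrableOn (fun t => u (join x t) * (ψ (join x t) * b (join x t)))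
      (Ioo (ηm x) (ηp x)) := e5 (h1.congr (ae_of_all _ fun t => by ring))
  have k2 : IntegrableOn (fun t => g (join x t) * (ψ (join x t) * χ (join x t)))
      (Ioo (ηm x) (ηp x)) := e5 (h2.congr (ae_of_all _ fun t => by ring))
  have k3 : IntegrableOn (fun t => u (join x t) * (dψ (join x t) * χ (join x t)))
      (Ioo (ηm x) (ηp x)) := e5 (h3.congr (ae_of_all _ fun t => by ring))
  have k4 : IntegrableOn (fun t => u (join x t) * (dψ (join x t) * χ (join x t) +
      ψ (join x t) * b (join x t))) (Ioo (ηm x) (ηp x)) :=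
    (k3.add k1).congr (ae_of_all _ fun t => by simp only [Pi.add_apply]; ring)
  refine e4.trans ?_
  rw [integral_add k4 k2, key]
  ring

end ByParts

end StripTrace

end

noncomputable section

namespace StripTrace

/-! ### A smooth cutoff on the line -/

section Cutoff

/-- A smooth nonincreasing function that is `1` on `(-∞, 1]` and `0` on `[2, ∞)`. -/
def cutoff (s : ℝ) : ℝ := 1 - Real.smoothTransition (s - 1)

theorem cutoff_of_le {s : ℝ} (h : s ≤ 1) : cutoff s = 1 := by
  simp [cutoff, Real.smoothTransition.zero_of_nonpos (by linarith : s - 1 ≤ 0)]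

theorem cutoff_of_ge {s : ℝ} (h : 2 ≤ s) : cutoff s = 0 := by
  simp [cutoff, Real.smoothTransition.one_of_one_le (by linarith : 1 ≤ s - 1)]

theorem cutoff_nonneg (s : ℝ) : 0 ≤ cutoff s :=
  sub_nonneg.2 (Real.smoothTransition.le_one _)

theorem cutoff_le_one (s : ℝ) : cutoff s ≤ 1 :=
  sub_le_self _ (Real.smoothTransition.nonneg _)

theorem contDiff_cutoff : ContDiff ℝ 1 cutoff := by
  unfold cutoff
  exact contDiff_const.sub ((Real.smoothTransition.contDiff (n := 1)).comp
    (contDiff_id.sub contDiff_const))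

theorem continuous_cutoff : Continuous cutoff := contDiff_cutoff.continuous

theorem continuous_deriv_cutoff : Continuous (deriv cutoff) :=
  contDiff_cutoff.continuous_deriv le_rfl

theorem hasDerivAt_cutoff (s : ℝ) : HasDerivAt cutoff (deriv cutoff s) s :=
  (contDiff_cutoff.differentiable (by simp) s).hasDerivAt

theorem exists_norm_deriv_cutoff_le : ∃ B : ℝ≥0, ∀ s, ‖deriv cutoff s‖₊ ≤ B := by
  have hsupp : HasCompactSupport (deriv cutoff) := by
    refine HasCompactSupport.intro (K := Icc 0 3) isCompact_Icc fun s hs => ?_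
    rw [mem_Icc, not_and_or, not_le, not_le] at hs
    rcases hs with hs | hs
    · have : cutoff =ᶠ[𝓝 s] fun _ => 1 := by
        filter_upwards [Iio_mem_nhds hs] with r hr
        exact cutoff_of_le (by linarith [mem_Iio.1 hr])
      rw [this.deriv_eq, deriv_const]
    · have : cutoff =ᶠ[𝓝 s] fun _ => 0 := by
        filter_upwards [Ioi_mem_nhds hs] with r hr
        exact cutoff_of_ge (by linarith [mem_Ioi.1 hr])
      rw [this.deriv_eq, deriv_const]
  obtain ⟨B, hB⟩ := continuous_deriv_cutoff.bounded_above_of_compact_support hsupp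
  refine ⟨B.toNNReal, fun s => ?_⟩
  rw [← NNReal.coe_le_coe, Real.coe_toNNReal _ ((norm_nonneg _).trans (hB s))]
  exact hB s

theorem exists_lipschitzWith_cutoff : ∃ B : ℝ≥0, LipschitzWith B cutoff := by
  obtain ⟨B, hB⟩ := exists_norm_deriv_cutoff_le
  exact ⟨B, lipschitzWith_of_nnnorm_deriv_le (contDiff_cutoff.differentiable (by simp)) hB⟩

theorem lipschitzWith_mul_of_bounded {α : Type*} [PseudoMetricSpace α] {f g : α → ℝ}
    {Kf Kg Cf Cg : ℝ≥0} (hf : LipschitzWith Kf f) (hg : LipschitzWith Kg g)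
    (hCf : ∀ x, |f x| ≤ Cf) (hCg : ∀ x, |g x| ≤ Cg) :
    LipschitzWith (Kf * Cg + Cf * Kg) fun x => f x * g x := by
  refine LipschitzWith.of_dist_le_mul fun x y => ?_
  have h1 := hf.dist_le_mul x y
  have h2 := hg.dist_le_mul x y
  rw [Real.dist_eq] at h1 h2 ⊢
  have : f x * g x - f y * g y = (f x - f y) * g x + f y * (g x - g y) := by ring
  rw [this]
  calc |(f x - f y) * g x + f y * (g x - g y)| ≤ |f x - f y| * |g x| + |f y| * |g x - g y| := by
        rw [← abs_mul, ← abs_mul]; exact abs_add_le _ _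
    _ ≤ (Kf * dist x y) * Cg + Cf * (Kg * dist x y) := by
        gcongr
        exacts [hCg x, hCf y]
    _ = _ := by push_cast; ring

end Cutoff

/-! ### Integration by parts up to the two Lipschitz graphs -/

section ByPartsGeneral

variable {n : ℕ} {ηm ηp : Space n → ℝ}

/-- `x ↦ e_N - ∂_{e'} η(x')`: the normal component of `e`, times the area density. -/
def conormal (η : Space n → ℝ) (e : Space (n + 1)) (x : Space n) : ℝ :=
  vert e - fderiv ℝ η x (horiz e)

theorem measurable_conormal (η : Space n → ℝ) (e : Space (n + 1)) :
    Measurable (conormal η e) :=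
  measurable_const.sub (measurable_fderiv_apply_const ℝ η (horiz e))

theorem norm_conormal_le {η : Space n → ℝ} {K : ℝ≥0} (hη : LipschitzWith K η)
    (e : Space (n + 1)) (x : Space n) : ‖conormal η e x‖ ≤ ‖vert e‖ + K * ‖horiz e‖ := by
  refine (norm_sub_le _ _).trans (add_le_add le_rfl ?_)
  refine (ContinuousLinearMap.le_opNorm _ _).trans ?_
  gcongr
  exact norm_fderiv_le_of_lipschitz ℝ hη

/-- This is how `conormal` enters: differentiating a function of the height difference to a graph
along `e` produces minus the conormal. -/
theorem hasFDerivAt_heightDiff {η : Space n → ℝ} {z : Space (n + 1)}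
    (hη : DifferentiableAt ℝ η (horiz z)) :
    ∃ L : Space (n + 1) →L[ℝ] ℝ, HasFDerivAt (fun z => η (horiz z) - vert z) L z ∧
      ∀ e, L e = - conormal η e (horiz z) := by
  set H : Space (n + 1) →L[ℝ] Space n :=
    (ContinuousLinearMap.fst ℝ (Space n) ℝ).comp ((joinL n).symm : Space (n + 1) →L[ℝ] _)
  set V : Space (n + 1) →L[ℝ] ℝ :=
    (ContinuousLinearMap.snd ℝ (Space n) ℝ).comp ((joinL n).symm : Space (n + 1) →L[ℝ] _)
  have hH : HasFDerivAt (horiz (n := n)) H z := H.hasFDerivAt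
  have hV : HasFDerivAt (vert (n := n)) V z := V.hasFDerivAt
  refine ⟨(fderiv ℝ η (horiz z)).comp H - V, (hη.hasFDerivAt.comp z hH).sub hV, fun e => ?_⟩
  change fderiv ℝ η (horiz z) (horiz e) - vert e = _
  rw [conormal]
  ring

theorem ae_horiz {P : Space n → Prop} (h : ∀ᵐ x, P x) : ∀ᵐ z : Space (n + 1), P (horiz z) := by
  rw [ae_join_iff, Measure.volume_eq_prod]
  simp only [horiz_join]
  exact Measure.quasiMeasurePreserving_fst.ae h

theorem lipschitzWith_heightDiff {η : Space n → ℝ} {K : ℝ≥0} (hη : LipschitzWith K η) :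
    LipschitzWith (K + 1) fun z : Space (n + 1) => η (horiz z) - vert z := by
  simpa using (hη.comp lipschitzWith_horiz).sub lipschitzWith_vert

theorem tendsto_integral_mul_zero {α : Type*} [MeasurableSpace α] {μ : Measure α} {F : α → ℝ}
    {χ : ℕ → α → ℝ} (hF : Integrable F μ) (hχ : ∀ k, AEStronglyMeasurable (χ k) μ)
    (h1 : ∀ k z, ‖χ k z‖ ≤ 1) (h0 : ∀ᵐ z ∂μ, Tendsto (fun k => χ k z) atTop (𝓝 0)) :
    Tendsto (fun k => ∫ z, F z * χ k z ∂μ) atTop (𝓝 0) := by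
  have := tendsto_integral_of_dominated_convergence (μ := μ) (F := fun k z => F z * χ k z)
    (f := fun _ => 0) (fun z => ‖F z‖) (fun k => hF.1.mul (hχ k)) hF.norm
    (fun k => ae_of_all _ fun z => ?_) ?_
  · simpa using this
  · rw [norm_mul]
    exact mul_le_of_le_one_right (norm_nonneg _) (h1 k z)
  · filter_upwards [h0] with z hz
    simpa using hz.const_mul (F z)

/-- Testing the weak derivative against `ψ (1 - χ⁺ - χ⁻)`, where `χ^±` are cutoffs near the two
graphs. -/
theorem HasWeakDir.integral_test_cutoff {Km Kp : ℝ≥0} (hm : LipschitzWith Km ηm)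
    (hp : LipschitzWith Kp ηp) {e : Space (n + 1)} {u g : Space (n + 1) → ℝ}
    (h : HasWeakDir (graphDomain ηm ηp) e u g)
    {ψ : Space (n + 1) → ℝ} (hψ : ContDiff ℝ 1 ψ) (hψc : HasCompactSupport ψ) {k : ℝ} (hk : 0 < k)
    (hkδ : ∀ z ∈ tsupport ψ, 4 ≤ k * (ηp (horiz z) - ηm (horiz z))) :
    ∫ z in graphDomain ηm ηp, u z * (fderiv ℝ ψ z e *
        (1 - cutoff (k * (ηp (horiz z) - vert z)) - cutoff (k * (vert z - ηm (horiz z)))) -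
        ψ z * (conormal ηp e (horiz z) * -(deriv cutoff (k * (ηp (horiz z) - vert z)) * k) +
          conormal ηm e (horiz z) * (deriv cutoff (k * (vert z - ηm (horiz z))) * k))) =
    - ∫ z in graphDomain ηm ηp, g z * (ψ z *
        (1 - cutoff (k * (ηp (horiz z) - vert z)) - cutoff (k * (vert z - ηm (horiz z))))) := by
  set χp : Space (n + 1) → ℝ := fun z => cutoff (k * (ηp (horiz z) - vert z)) with hχp
  set χm : Space (n + 1) → ℝ := fun z => cutoff (k * (vert z - ηm (horiz z))) with hχm
  obtain ⟨B, hB⟩ := exists_lipschitzWith_cutoff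
  have hmul : ∀ {f : Space (n + 1) → ℝ} {C : ℝ≥0}, LipschitzWith C f →
      LipschitzWith (B * (‖k‖₊ * C)) fun z => cutoff (k * f z) := fun {f C} hf =>
    hB.comp ((lipschitzWith_smul k).comp hf)
  have lp : LipschitzWith (B * (‖k‖₊ * (Kp + 1))) χp := hmul (lipschitzWith_heightDiff hp)
  have lm : LipschitzWith (B * (‖k‖₊ * (Km + 1))) χm := by
    refine hmul ?_
    convert! (lipschitzWith_heightDiff hm).neg using 2
    simp
  have lχ := (LipschitzWith.const (α := Space (n + 1)) (1 : ℝ)).sub lp |>.sub lm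
  obtain ⟨P, hP⟩ := hψ.continuous.bounded_above_of_compact_support hψc
  obtain ⟨C, hC⟩ := hψ.lipschitzWith_of_hasCompactSupport hψc (by simp)
  have hP0 : 0 ≤ P := (norm_nonneg _).trans (hP 0)
  have lφ := lipschitzWith_mul_of_bounded (Cf := P.toNNReal) (Cg := 1) hC lχ
    (fun z => by rw [Real.coe_toNNReal _ hP0]; exact hP z) (fun z => by
      have h1 := cutoff_nonneg (k * (ηp (horiz z) - vert z))
      have h2 := cutoff_nonneg (k * (vert z - ηm (horiz z)))
      have h3 := cutoff_le_one (k * (ηp (horiz z) - vert z))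
      have h4 := cutoff_le_one (k * (vert z - ηm (horiz z)))
      simp only [hχp, hχm, NNReal.coe_one]
      rw [abs_le]
      constructor <;> linarith)
  set φ : Space (n + 1) → ℝ := fun z => ψ z * (1 - χp z - χm z) with hφ
  have hφc : HasCompactSupport φ := hψc.mul_right
  have hsupp : tsupport φ ⊆ graphDomain ηm ηp := by
    have hcm := hm.continuous
    have hcp := hp.continuous
    -- Over the support of `ψ` the two scaled heights add up to at least 4. Where one of them is
    -- below 1, its cutoff is 1 and the other one is 0, so `φ` vanishes. Hence `φ` lives on a closed
    -- set inside the domain.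
    set F : Set (Space (n + 1)) := tsupport ψ ∩ ({z | 1 ≤ k * (ηp (horiz z) - vert z)} ∩
      {z | 1 ≤ k * (vert z - ηm (horiz z))}) with hF
    have hFc : IsClosed F := (isClosed_tsupport ψ).inter
      ((isClosed_le (by fun_prop) (by fun_prop)).inter (isClosed_le (by fun_prop) (by fun_prop)))
    have hsub : tsupport φ ⊆ F := by
      refine closure_minimal (fun z hz => ?_) hFc
      have hzψ : z ∈ tsupport ψ := by
        refine subset_tsupport ψ fun h0 => hz ?_
        simp [hφ, h0]
      have hδ := hkδ z hzψ
      refine ⟨hzψ, ?_, ?_⟩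
      · rw [mem_ofPred_eq]
        by_contra! hlt
        refine hz ?_
        have e1 : χp z = 1 := cutoff_of_le hlt.le
        have e2 : χm z = 0 := cutoff_of_ge (by linarith)
        simp [hφ, e1, e2]
      · rw [mem_ofPred_eq]
        by_contra! hlt
        refine hz ?_
        have e1 : χm z = 1 := cutoff_of_le hlt.le
        have e2 : χp z = 0 := cutoff_of_ge (by linarith)
        simp [hφ, e1, e2]
    refine hsub.trans fun z hz => ⟨?_, ?_⟩
    · have h1 : 1 ≤ k * (vert z - ηm (horiz z)) := hz.2.2
      have := pos_of_mul_pos_right (by linarith : 0 < k * (vert z - ηm (horiz z))) hk.le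
      linarith
    · have h1 : 1 ≤ k * (ηp (horiz z) - vert z) := hz.2.1
      have := pos_of_mul_pos_right (by linarith : 0 < k * (ηp (horiz z) - vert z)) hk.le
      linarith
  have hI := isOpen_graphDomain hm.continuous hp.continuous
  rw [← h.integral_lipschitz hI lφ hφc hsupp]
  refine integral_congr_ae (ae_restrict_of_ae ?_)
  filter_upwards [ae_horiz (hm.ae_differentiableAt (μ := volume)),
    ae_horiz (hp.ae_differentiableAt (μ := volume))] with z hzm hzp
  congr 1
  obtain ⟨Lp, hLp, hLpe⟩ := hasFDerivAt_heightDiff hzp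
  obtain ⟨Lm, hLm, hLme⟩ := hasFDerivAt_heightDiff hzm
  have dp : HasFDerivAt χp (deriv cutoff (k * (ηp (horiz z) - vert z)) • (k • Lp)) z :=
    (hasDerivAt_cutoff _).comp_hasFDerivAt z (hLp.const_mul k)
  have hLm' : HasFDerivAt (fun z : Space (n + 1) => vert z - ηm (horiz z)) (-Lm) z := by
    convert! hLm.neg using 1
    ext z
    simp
  have dm : HasFDerivAt χm (deriv cutoff (k * (vert z - ηm (horiz z))) • (k • -Lm)) z :=
    (hasDerivAt_cutoff _).comp_hasFDerivAt z (hLm'.const_mul k)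
  have dψ := (hψ.differentiable (by simp) z).hasFDerivAt
  have dφ := dψ.mul (((hasFDerivAt_const (1 : ℝ) z).sub dp).sub dm)
  rw [show fderiv ℝ φ z = _ from dφ.fderiv]
  simp only [hχp, hχm, FunLike.coe_add, FunLike.coe_smul, FunLike.coe_sub, Pi.add_apply, Pi.smul_apply,
    Pi.sub_apply, smul_eq_mul, FunLike.coe_neg, Pi.neg_apply, hLpe, hLme, FunLike.coe_zero,
    Pi.zero_apply]
  ring

/-- Integration by parts on the domain between two Lipschitz graphs. -/
theorem IsVertTrace.integral_by_parts {Km Kp : ℝ≥0} (hm : LipschitzWith Km ηm)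
    (hp : LipschitzWith Kp ηp) (hlt : ∀ x, ηm x < ηp x) {e : Space (n + 1)}
    {u g gN : Space (n + 1) → ℝ} {fm fp : Space n → ℝ}
    (h : HasWeakDir (graphDomain ηm ηp) e u g) (ht : IsVertTrace ηm ηp u gN fm fp)
    (hu : IntegrableOverCompacts ηm ηp u) (hg : IntegrableOverCompacts ηm ηp g)
    (hgN : IntegrableOverCompacts ηm ηp gN)
    (hfm : ∀ K : Set (Space n), IsCompact K → IntegrableOn fm K)
    (hfp : ∀ K : Set (Space n), IsCompact K → IntegrableOn fp K)
    {ψ : Space (n + 1) → ℝ} (hψ : ContDiff ℝ 1 ψ) (hψc : HasCompactSupport ψ) :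
    IntegrableOn (fun z => u z * fderiv ℝ ψ z e) (graphDomain ηm ηp) ∧
    IntegrableOn (fun z => g z * ψ z) (graphDomain ηm ηp) ∧
    Integrable (fun x => conormal ηp e x * (fp x * ψ (join x (ηp x)))) ∧
    Integrable (fun x => conormal ηm e x * (fm x * ψ (join x (ηm x)))) ∧
    ∫ z in graphDomain ηm ηp, u z * fderiv ℝ ψ z e = - (∫ z in graphDomain ηm ηp, g z * ψ z) +
      ((∫ x, conormal ηp e x * (fp x * ψ (join x (ηp x)))) -
        ∫ x, conormal ηm e x * (fm x * ψ (join x (ηm x)))) := by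
  have hcm := hm.continuous
  have hcp := hp.continuous
  set K : Set (Space n) := horiz '' tsupport ψ with hKdef
  have hK : IsCompact K := hψc.isCompact.image continuous_horiz
  have hψ0 : ∀ z, horiz z ∉ K → ψ z = 0 := fun z hz =>
    image_eq_zero_of_notMem_tsupport fun hh => hz ⟨z, hh, rfl⟩
  obtain ⟨P, hP⟩ := hψ.continuous.bounded_above_of_compact_support hψc
  have hP0 : 0 ≤ P := (norm_nonneg _).trans (hP 0)
  have hψm := hψ.continuous.measurable
  have hd : ∀ v : Space (n + 1), Continuous (fun z => fderiv ℝ ψ z v) ∧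
      (∃ Q, ∀ z, ‖fderiv ℝ ψ z v‖ ≤ Q) ∧ ∀ z, horiz z ∉ K → fderiv ℝ ψ z v = 0 := by
    intro v
    have h1 : Continuous (fun z => fderiv ℝ ψ z v) :=
      (hψ.continuous_fderiv (by simp)).clm_apply continuous_const
    refine ⟨h1, h1.bounded_above_of_compact_support
      (hψc.of_isClosed_subset (isClosed_tsupport _) (tsupport_fderiv_apply_subset ℝ _)),
      fun z hz => image_eq_zero_of_notMem_tsupport (f := fun z => fderiv ℝ ψ z v)
        fun hh => hz ⟨z, tsupport_fderiv_apply_subset ℝ _ hh, rfl⟩⟩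
  have bdry : ∀ {η f : Space n → ℝ} {Kη : ℝ≥0}, LipschitzWith Kη η →
      (∀ K : Set (Space n), IsCompact K → IntegrableOn f K) →
      Integrable (fun x => conormal η e x * (f x * ψ (join x (η x)))) := by
    intro η f Kη hη hf
    have hcη := hη.continuous
    have hmc := measurable_conormal η e
    have h1 : IntegrableOn (fun x => f x * (conormal η e x * ψ (join x (η x)))) K := by
      refine Integrable.mul_bdd (c := (‖vert e‖ + Kη * ‖horiz e‖) * P) (hf K hK)
        (Measurable.aestronglyMeasurable (by fun_prop)) (ae_of_all _ fun x => ?_)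
      rw [norm_mul]
      gcongr
      exacts [norm_conormal_le hη e x, hP _]
    have h2 := (integrableOn_iff_integrable_of_support_subset ?_).1 h1
    · exact h2.congr (ae_of_all _ fun x => by ring)
    · intro x hx
      by_contra hxK
      exact hx (by simp [hψ0 (join x (η x)) (by simpa using hxK)])
  obtain ⟨hec, ⟨Q, hQ⟩, he0⟩ := hd e
  set eN : Space (n + 1) := EuclideanSpace.single (Fin.last n) 1 with heN
  obtain ⟨hNc, ⟨QN, hQN⟩, hN0⟩ := hd eN
  have i1 : IntegrableOn (fun z => u z * fderiv ℝ ψ z e) (graphDomain ηm ηp) :=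
    hu.mul hK hec.aestronglyMeasurable hQ he0
  have i2 : IntegrableOn (fun z => g z * ψ z) (graphDomain ηm ηp) :=
    hg.mul hK hψ.continuous.aestronglyMeasurable hP hψ0
  have j : ∀ {η : Space n → ℝ} {Kη : ℝ≥0}, LipschitzWith Kη η → IntegrableOn
      (fun z => gN z * (conormal η e (horiz z) * ψ z) +
        u z * (conormal η e (horiz z) * fderiv ℝ ψ z eN)) (graphDomain ηm ηp) := by
    intro η Kη hη
    have hmc := measurable_conormal η e
    have hNm := hNc.measurable
    refine (hgN.mul hK (C := (‖vert e‖ + Kη * ‖horiz e‖) * P)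
      (Measurable.aestronglyMeasurable (by fun_prop)) (fun z => ?_)
        fun z hz => by simp [hψ0 z hz]).add
      (hu.mul hK (C := (‖vert e‖ + Kη * ‖horiz e‖) * QN)
        (Measurable.aestronglyMeasurable (by fun_prop)) (fun z => ?_)
        fun z hz => by simp [hN0 z hz])
    · rw [norm_mul]
      gcongr
      exacts [norm_conormal_le hη e _, hP _]
    · rw [norm_mul]
      gcongr
      exacts [norm_conormal_le hη e _, hQN _]
  refine ⟨i1, i2, bdry hp hfp, bdry hm hfm, ?_⟩
  set D := graphDomain ηm ηp with hDdef
  set χp : ℕ → Space (n + 1) → ℝ := fun k z => cutoff (k * (ηp (horiz z) - vert z)) with hχp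
  set χm : ℕ → Space (n + 1) → ℝ := fun k z => cutoff (k * (vert z - ηm (horiz z))) with hχm
  have χp_cont : ∀ k, Continuous (χp k) := fun k => continuous_cutoff.comp (by fun_prop)
  have χm_cont : ∀ k, Continuous (χm k) := fun k => continuous_cutoff.comp (by fun_prop)
  have cut1 : ∀ s, ‖cutoff s‖ ≤ 1 := fun s => by
    rw [Real.norm_of_nonneg (cutoff_nonneg s)]; exact cutoff_le_one s
  have lim0 : ∀ {r : ℝ}, 0 < r → Tendsto (fun k : ℕ => cutoff (k * r)) atTop (𝓝 0) := by
    intro r hr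
    refine tendsto_const_nhds.congr' ?_
    have : Tendsto (fun k : ℕ => (k : ℝ) * r) atTop atTop :=
      tendsto_natCast_atTop_atTop.atTop_mul_const hr
    filter_upwards [this.eventually_ge_atTop 2] with k hk
    exact (cutoff_of_ge hk).symm
  have hDm : MeasurableSet D := measurableSet_graphDomain hcm hcp
  have limp : ∀ {F : Space (n + 1) → ℝ}, IntegrableOn F D →
      Tendsto (fun k => ∫ z in D, F z * χp k z) atTop (𝓝 0) := fun {F} hF =>
    tendsto_integral_mul_zero hF (fun k => (χp_cont k).aestronglyMeasurable)
      (fun k z => cut1 _) (by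
        filter_upwards [ae_restrict_mem hDm] with z hz
        exact lim0 (sub_pos.2 hz.2))
  have limm : ∀ {F : Space (n + 1) → ℝ}, IntegrableOn F D →
      Tendsto (fun k => ∫ z in D, F z * χm k z) atTop (𝓝 0) := fun {F} hF =>
    tendsto_integral_mul_zero hF (fun k => (χm_cont k).aestronglyMeasurable)
      (fun k z => cut1 _) (by
        filter_upwards [ae_restrict_mem hDm] with z hz
        exact lim0 (sub_pos.2 hz.1))
  have mulχ : ∀ {F : Space (n + 1) → ℝ} {χ : Space (n + 1) → ℝ}, IntegrableOn F D →
      Continuous χ → (∀ z, ‖χ z‖ ≤ 1) → IntegrableOn (fun z => F z * χ z) D :=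
    fun {F χ} hF hχ h1 => Integrable.mul_bdd hF hχ.aestronglyMeasurable (ae_of_all _ h1)
  set F1 : Space (n + 1) → ℝ := fun z => u z * fderiv ℝ ψ z e + g z * ψ z with hF1
  set F2 : Space (n + 1) → ℝ := fun z => gN z * (conormal ηp e (horiz z) * ψ z) +
        u z * (conormal ηp e (horiz z) * fderiv ℝ ψ z eN) with hF2
  set F3 : Space (n + 1) → ℝ := fun z => gN z * (conormal ηm e (horiz z) * ψ z) +
        u z * (conormal ηm e (horiz z) * fderiv ℝ ψ z eN) with hF3
  have k1 : IntegrableOn F1 D := i1.add i2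
  have k2 : IntegrableOn F2 D := j hp
  have k3 : IntegrableOn F3 D := j hm
  set X := ∫ x, conormal ηp e x * (fp x * ψ (join x (ηp x))) with hX
  set Y := ∫ x, conormal ηm e x * (fm x * ψ (join x (ηm x))) with hY
  -- All four terms vanish by dominated convergence: the cutoffs are bounded by 1 and tend to 0 at
  -- every point of the open domain.
  have hlim : Tendsto (fun k => (∫ z in D, F1 z * χp k z) + (∫ z in D, F1 z * χm k z) -
      (∫ z in D, F2 z * χp k z) - ∫ z in D, F3 z * χm k z) atTop (𝓝 (0 + 0 - 0 - 0)) :=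
    (((limp k1).add (limm k1)).sub (limp k2)).sub (limm k3)
  -- The least width of the domain over the compact support of `ψ`; for `k * δ ≥ 4` the two boundary
  -- layers do not interact.
  obtain ⟨δ, hδ0, hδ⟩ : ∃ δ > 0, ∀ z ∈ tsupport ψ, δ ≤ ηp (horiz z) - ηm (horiz z) := by
    rcases (tsupport ψ).eq_empty_or_nonempty with hemp | hne
    · exact ⟨1, one_pos, fun z hz => by simp [hemp] at hz⟩
    · obtain ⟨z₀, -, hz₀⟩ := hψc.isCompact.exists_isMinOn hne
        (f := fun z => ηp (horiz z) - ηm (horiz z)) (by fun_prop)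
      exact ⟨_, sub_pos.2 (hlt (horiz z₀)), fun z hz => hz₀ hz⟩
  -- For large `k` the vanishing expression equals a quantity independent of `k`, which is therefore
  -- 0; this is the asserted formula.
  have hev : ∀ᶠ k : ℕ in atTop, (∫ z in D, F1 z) - X + Y =
      (∫ z in D, F1 z * χp k z) + (∫ z in D, F1 z * χm k z) -
      (∫ z in D, F2 z * χp k z) - ∫ z in D, F3 z * χm k z := by
    have htd : Tendsto (fun k : ℕ => (k : ℝ) * δ) atTop atTop :=
      tendsto_natCast_atTop_atTop.atTop_mul_const hδ0
    filter_upwards [htd.eventually_ge_atTop 4, eventually_gt_atTop 0] with k hk4 hk0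
    have hk : (0 : ℝ) < k := by exact_mod_cast hk0
    have hkδ : ∀ z ∈ tsupport ψ, 4 ≤ (k : ℝ) * (ηp (horiz z) - ηm (horiz z)) := fun z hz =>
      hk4.trans (by have := hδ z hz; gcongr)
    have test := h.integral_test_cutoff hm hp hψ hψc hk hkδ
    set bp : Space (n + 1) → ℝ := fun z => -(deriv cutoff (k * (ηp (horiz z) - vert z)) * k)
      with hbp
    set bm : Space (n + 1) → ℝ := fun z => deriv cutoff (k * (vert z - ηm (horiz z))) * k with hbm
    have bp_cont : Continuous bp :=
      ((continuous_deriv_cutoff.comp (by fun_prop)).mul continuous_const).neg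
    have bm_cont : Continuous bm :=
      (continuous_deriv_cutoff.comp (by fun_prop)).mul continuous_const
    obtain ⟨B, hB⟩ := exists_norm_deriv_cutoff_le
    have bp_le : ∀ z, ‖bp z‖ ≤ B * k := fun z => by
      rw [hbp, norm_neg, norm_mul, Real.norm_of_nonneg hk.le]
      gcongr
      exact hB _
    have bm_le : ∀ z, ‖bm z‖ ≤ B * k := fun z => by
      rw [hbm, norm_mul, Real.norm_of_nonneg hk.le]
      gcongr
      exact hB _
    have dp : ∀ x t, HasDerivAt (fun t => χp k (join x t)) (bp (join x t)) t := by
      intro x t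
      have h1 : HasDerivAt (fun t => (k : ℝ) * (ηp x - t)) (k * -1) t :=
        ((hasDerivAt_id t).const_sub (ηp x)).const_mul (k : ℝ)
      have h2 := (hasDerivAt_cutoff (k * (ηp x - t))).comp t h1
      simpa [hχp, hbp, Function.comp_def] using h2
    have dm : ∀ x t, HasDerivAt (fun t => χm k (join x t)) (bm (join x t)) t := by
      intro x t
      have h1 : HasDerivAt (fun t => (k : ℝ) * (t - ηm x)) (k * 1) t :=
        ((hasDerivAt_id t).sub_const (ηm x)).const_mul (k : ℝ)
      have h2 := (hasDerivAt_cutoff (k * (t - ηm x))).comp t h1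
      simpa [hχm, hbm, Function.comp_def] using h2
    have big : ∀ {x t}, ψ (join x t) ≠ 0 → cutoff (k * (ηp x - ηm x)) = 0 := by
      intro x t hne
      have := hkδ (join x t) (subset_tsupport ψ hne)
      rw [horiz_join] at this
      exact cutoff_of_ge (by linarith)
    -- The derivative of the cutoff is of size `k` and has no direct limit. Being a vertical
    -- derivative, it is integrated by parts on lines: the cutoff is 1 on its own graph and, where
    -- `ψ ≠ 0`, 0 on the other one, so exactly one boundary term remains.
    have v1 := ht.integral_mul_vertical hcm hcp hlt hu hgN hψ hψc dp (χp_cont k)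
      (fun z => cut1 _) bp_cont bp_le (measurable_conormal ηp e) (norm_conormal_le hp e)
      (vp := fun _ => 1) (vm := fun _ => 0) (fun x _ => by simp [hχp, cutoff_of_le])
      (fun x hx => by simpa [hχp] using big hx)
    have v2 := ht.integral_mul_vertical hcm hcp hlt hu hgN hψ hψc dm (χm_cont k)
      (fun z => cut1 _) bm_cont bm_le (measurable_conormal ηm e) (norm_conormal_le hm e)
      (vp := fun _ => 0) (vm := fun _ => 1) (fun x hx => by simpa [hχm] using big hx)
      (fun x _ => by simp [hχm, cutoff_of_le])
    simp only [mul_one, mul_zero, sub_zero, zero_sub, mul_neg, integral_neg] at v1 v2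
    have w1 : ∫ z in D, u z * (conormal ηp e (horiz z) * ψ z * bp z) =
        X - ∫ z in D, F2 z * χp k z := by
      rw [v1]
      congr 1
      refine integral_congr_ae (ae_of_all _ fun z => ?_)
      simp only [hF2]
      ring
    have w2 : ∫ z in D, u z * (conormal ηm e (horiz z) * ψ z * bm z) =
        - Y - ∫ z in D, F3 z * χm k z := by
      rw [v2]
      congr 1
      refine integral_congr_ae (ae_of_all _ fun z => ?_)
      simp only [hF3]
      ring
    have m1 : ∀ {η : Space n → ℝ} {Kη : ℝ≥0} {b : Space (n + 1) → ℝ}, LipschitzWith Kη η →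
        Continuous b → (∀ z, ‖b z‖ ≤ B * k) →
        IntegrableOn (fun z => u z * (conormal η e (horiz z) * ψ z * b z)) D := by
      intro η Kη b hη hb hbB
      have hmc := measurable_conormal η e
      have hbm := hb.measurable
      refine hu.mul hK (C := (‖vert e‖ + Kη * ‖horiz e‖) * P * (B * k))
        (Measurable.aestronglyMeasurable (by fun_prop)) (fun z => ?_)
        fun z hz => by simp [hψ0 z hz]
      rw [norm_mul, norm_mul]
      gcongr
      exacts [norm_conormal_le hη e _, hP _, hbB _]
    have n1 := m1 hp bp_cont bp_le
    have n2 := m1 hm bm_cont bm_le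
    have i1p := mulχ i1 (χp_cont k) fun z => cut1 _
    have i1m := mulχ i1 (χm_cont k) fun z => cut1 _
    have i2p := mulχ i2 (χp_cont k) fun z => cut1 _
    have i2m := mulχ i2 (χm_cont k) fun z => cut1 _
    have t1 : ∫ z in D, u z * (fderiv ℝ ψ z e * (1 - χp k z - χm k z) -
        ψ z * (conormal ηp e (horiz z) * bp z + conormal ηm e (horiz z) * bm z)) =
        (∫ z in D, u z * fderiv ℝ ψ z e) - (∫ z in D, u z * fderiv ℝ ψ z e * χp k z) -
        (∫ z in D, u z * fderiv ℝ ψ z e * χm k z) -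
        (∫ z in D, u z * (conormal ηp e (horiz z) * ψ z * bp z)) -
        ∫ z in D, u z * (conormal ηm e (horiz z) * ψ z * bm z) := by
      have d1 : IntegrableOn (fun z => u z * fderiv ℝ ψ z e -
        u z * fderiv ℝ ψ z e * χp k z) D := i1.sub i1p
      have d2 : IntegrableOn (fun z => u z * fderiv ℝ ψ z e -
        u z * fderiv ℝ ψ z e * χp k z - u z * fderiv ℝ ψ z e * χm k z) D := d1.sub i1m
      have d3 : IntegrableOn (fun z => u z * fderiv ℝ ψ z e -
        u z * fderiv ℝ ψ z e * χp k z - u z * fderiv ℝ ψ z e * χm k z -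
        u z * (conormal ηp e (horiz z) * ψ z * bp z)) D := d2.sub n1
      rw [← integral_sub i1 i1p, ← integral_sub d1 i1m, ← integral_sub d2 n1,
        ← integral_sub d3 n2]
      refine integral_congr_ae (ae_of_all _ fun z => ?_)
      ring
    have t2 : ∫ z in D, g z * (ψ z * (1 - χp k z - χm k z)) =
        (∫ z in D, g z * ψ z) - (∫ z in D, g z * ψ z * χp k z) -
        (∫ z in D, g z * ψ z * χm k z) := by
      have d1 : IntegrableOn (fun z => g z * ψ z - g z * ψ z * χp k z) D := i2.sub i2p
      rw [← integral_sub i2 i2p, ← integral_sub d1 i2m]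
      refine integral_congr_ae (ae_of_all _ fun z => ?_)
      ring
    have t3 : ∫ z in D, F1 z = (∫ z in D, u z * fderiv ℝ ψ z e) + ∫ z in D, g z * ψ z :=
      integral_add i1 i2
    have t4 : ∫ z in D, F1 z * χp k z =
        (∫ z in D, u z * fderiv ℝ ψ z e * χp k z) + ∫ z in D, g z * ψ z * χp k z := by
      rw [← integral_add i1p i2p]
      refine integral_congr_ae (ae_of_all _ fun z => ?_)
      simp only [hF1]
      ring
    have t5 : ∫ z in D, F1 z * χm k z =
        (∫ z in D, u z * fderiv ℝ ψ z e * χm k z) + ∫ z in D, g z * ψ z * χm k z := by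
      rw [← integral_add i1m i2m]
      refine integral_congr_ae (ae_of_all _ fun z => ?_)
      simp only [hF1]
      ring
    have test' := t1.symm.trans (test.trans (congrArg Neg.neg t2))
    rw [w1, w2] at test'
    rw [t3, t4, t5]
    linarith
  have hfin := tendsto_nhds_unique (tendsto_const_nhds.congr' hev) hlim
  have t3 : ∫ z in D, F1 z = (∫ z in D, u z * fderiv ℝ ψ z e) + ∫ z in D, g z * ψ z :=
    integral_add i1 i2
  rw [t3] at hfin
  linarith

end ByPartsGeneral

end StripTrace

end

noncomputable section

namespace StripTrace

/-! ### Hölder and Hardy inequalities, expanding substitutions, polar coordinates -/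

section Inequalities

theorem add_add_rpow_le {p : ℝ} (hp : 0 ≤ p) (a b c : ℝ≥0∞) :
    (a + b + c) ^ p ≤ 3 ^ p * (a ^ p + b ^ p + c ^ p) := by
  have key : ∀ m : ℝ≥0∞, a ≤ m → b ≤ m → c ≤ m → (a + b + c) ^ p ≤ 3 ^ p * m ^ p := by
    intro m ha hb hc
    rw [← ENNReal.mul_rpow_of_nonneg _ _ hp]
    refine ENNReal.rpow_le_rpow ?_ hp
    calc a + b + c ≤ m + m + m := by gcongr
      _ = 3 * m := by ring
  rcases le_total a b with hab | hab
  · rcases le_total b c with hbc | hbc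
    · exact (key c (hab.trans hbc) hbc le_rfl).trans (by gcongr; exact le_add_self)
    · exact (key b hab le_rfl hbc).trans
        (by gcongr; exact le_add_self.trans le_self_add)
  · rcases le_total a c with hac | hac
    · exact (key c hac (hab.trans hac) le_rfl).trans (by gcongr; exact le_add_self)
    · exact (key a le_rfl hab hac).trans
        (by gcongr; exact le_self_add.trans le_self_add)

theorem lintegral_rpow_le_measure_univ {α : Type*} [MeasurableSpace α] (μ : Measure α)
    {p : ℝ} (hp : 1 < p) {G : α → ℝ≥0∞} (hG : AEMeasurable G μ) :
    (∫⁻ a, G a ∂μ) ^ p ≤ μ univ ^ (p - 1) * ∫⁻ a, G a ^ p ∂μ := by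
  have hp0 : p ≠ 0 := by linarith
  have hp1 : p - 1 ≠ 0 := by linarith
  have h := ENNReal.lintegral_mul_le_Lp_mul_Lq μ (Real.HolderConjugate.conjExponent hp) hG
    (aemeasurable_const (b := (1 : ℝ≥0∞)))
  simp only [Pi.mul_apply, mul_one, ENNReal.one_rpow, lintegral_const, one_mul] at h
  have := ENNReal.rpow_le_rpow h (by linarith : 0 ≤ p)
  rw [ENNReal.mul_rpow_of_nonneg _ _ (by linarith), ← ENNReal.rpow_mul, ← ENNReal.rpow_mul,
    one_div, inv_mul_cancel₀ hp0, ENNReal.rpow_one, mul_comm] at this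
  convert this using 3
  rw [Real.conjExponent, one_div_div, div_mul_cancel₀ _ hp0]

theorem lintegral_rpow_le_of_isProbabilityMeasure {α : Type*} [MeasurableSpace α] (μ : Measure α)
    [IsProbabilityMeasure μ] {p : ℝ} (hp : 1 < p) {G : α → ℝ≥0∞} (hG : AEMeasurable G μ) :
    (∫⁻ a, G a ∂μ) ^ p ≤ ∫⁻ a, G a ^ p ∂μ := by
  simpa using lintegral_rpow_le_measure_univ μ hp hG

instance : IsProbabilityMeasure (volume.restrict (Ioo (0 : ℝ) 1)) := ⟨by simp⟩

theorem lintegral_Ioo_rpow {s : ℝ} (hs : -1 < s) :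
    ∫⁻ θ in Ioo (0 : ℝ) 1, ENNReal.ofReal (θ ^ s) = ENNReal.ofReal (s + 1)⁻¹ := by
  have hi : IntervalIntegrable (fun x : ℝ => x ^ s) volume 0 1 :=
    intervalIntegral.intervalIntegrable_rpow' hs
  rw [← ofReal_integral_eq_lintegral_ofReal]
  · rw [← integral_Ioc_eq_integral_Ioo, ← intervalIntegral.integral_of_le zero_le_one,
      integral_rpow (Or.inl hs), Real.one_rpow, Real.zero_rpow (by linarith), sub_zero, one_div]
  · exact ((intervalIntegrable_iff_integrableOn_Ioo_of_le zero_le_one).1 hi)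
  · filter_upwards [ae_restrict_mem measurableSet_Ioo] with θ hθ
    exact Real.rpow_nonneg hθ.1.le _

/-- Hölder's inequality with a power weight, the core of Hardy's inequality. -/
theorem lintegral_Ioo_rpow_le_weighted {p : ℝ} (hp : 1 < p) {G : ℝ → ℝ≥0∞} (hG : Measurable G) :
    (∫⁻ θ in Ioo (0 : ℝ) 1, G θ) ^ p ≤ ENNReal.ofReal (p / (p - 1)) ^ (p - 1) *
      ∫⁻ θ in Ioo (0 : ℝ) 1, ENNReal.ofReal (θ ^ ((p - 1) / p)) * G θ ^ p := by
  have hp0 : p ≠ 0 := by linarith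
  have hp1 : p - 1 ≠ 0 := by linarith
  have hq := Real.HolderConjugate.conjExponent hp
  set q := p.conjExponent with hqdef
  have hqv : q = p / (p - 1) := rfl
  -- The exponent is chosen so that `θ^(a p) = θ^((p-1)/p)`, while the dual weight `θ^(-a q) =
  -- θ^(-1/p)` is still integrable on `(0, 1)`, with integral `q = p / (p - 1)`.
  set a : ℝ := (p - 1) / p / p with ha
  have h := ENNReal.lintegral_mul_le_Lp_mul_Lq (volume.restrict (Ioo (0 : ℝ) 1)) hq
    (f := fun θ => ENNReal.ofReal (θ ^ a) * G θ) (g := fun θ => ENNReal.ofReal (θ ^ (-a)))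
    (by fun_prop) (by fun_prop)
  have e1 : ∫⁻ θ in Ioo (0 : ℝ) 1, ((fun θ => ENNReal.ofReal (θ ^ a) * G θ) *
      fun θ => ENNReal.ofReal (θ ^ (-a))) θ = ∫⁻ θ in Ioo (0 : ℝ) 1, G θ := by
    refine setLIntegral_congr_fun measurableSet_Ioo fun θ hθ => ?_
    simp only [Pi.mul_apply]
    rw [mul_right_comm, ← ENNReal.ofReal_mul (Real.rpow_nonneg hθ.1.le _),
      ← Real.rpow_add hθ.1, add_neg_cancel, Real.rpow_zero, ENNReal.ofReal_one, one_mul]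
  have e2 : ∫⁻ θ in Ioo (0 : ℝ) 1, (ENNReal.ofReal (θ ^ a) * G θ) ^ p =
      ∫⁻ θ in Ioo (0 : ℝ) 1, ENNReal.ofReal (θ ^ ((p - 1) / p)) * G θ ^ p := by
    refine setLIntegral_congr_fun measurableSet_Ioo fun θ hθ => ?_
    rw [ENNReal.mul_rpow_of_nonneg _ _ (by linarith),
      ENNReal.ofReal_rpow_of_nonneg (Real.rpow_nonneg hθ.1.le _) (by linarith),
      ← Real.rpow_mul hθ.1.le, ha, div_mul_cancel₀ _ hp0]
  have e3 : ∫⁻ θ in Ioo (0 : ℝ) 1, ENNReal.ofReal (θ ^ (-a)) ^ q = ENNReal.ofReal q := by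
    have : ∫⁻ θ in Ioo (0 : ℝ) 1, ENNReal.ofReal (θ ^ (-a)) ^ q =
        ∫⁻ θ in Ioo (0 : ℝ) 1, ENNReal.ofReal (θ ^ (-(1 / p))) := by
      refine setLIntegral_congr_fun measurableSet_Ioo fun θ hθ => ?_
      rw [ENNReal.ofReal_rpow_of_nonneg (Real.rpow_nonneg hθ.1.le _) hq.symm.nonneg,
        ← Real.rpow_mul hθ.1.le, ha, hqv]
      congr 2
      field_simp
    have h1 : 1 / p < 1 := by rw [div_lt_one (by linarith)]; exact hp
    rw [this, lintegral_Ioo_rpow (by linarith), hqv]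
    congr 1
    rw [show -(1 / p) + 1 = (p - 1) / p by field_simp; ring, inv_div]
  rw [e1, e2, e3] at h
  have := ENNReal.rpow_le_rpow h (by linarith : 0 ≤ p)
  rw [ENNReal.mul_rpow_of_nonneg _ _ (by linarith), ← ENNReal.rpow_mul, ← ENNReal.rpow_mul,
    one_div, inv_mul_cancel₀ hp0, ENNReal.rpow_one, mul_comm] at this
  convert this using 3
  · rw [hqv]
  · rw [hqv, one_div_div, div_mul_cancel₀ _ hp0]

/-- A change of variables for a map without differentiability: its inverse is `c⁻¹`-Lipschitz on the
range, so preimages have one-dimensional Hausdorff measure at most `c⁻¹` times that of the set. -/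
theorem lintegral_comp_le_of_expanding {φ : ℝ → ℝ} (hφ : Measurable φ) {c : ℝ} (hc : 0 < c)
    (h : ∀ r s, c * |r - s| ≤ |φ r - φ s|) {F : ℝ → ℝ≥0∞} (hF : Measurable F) :
    ∫⁻ r, F (φ r) ≤ ENNReal.ofReal c⁻¹ * ∫⁻ t, F t := by
  have hanti : AntilipschitzWith (Real.toNNReal c⁻¹) φ := by
    refine AntilipschitzWith.of_le_mul_dist fun r s => ?_
    rw [Real.coe_toNNReal _ (inv_nonneg.2 hc.le), Real.dist_eq, Real.dist_eq,
      ← div_eq_inv_mul, le_div_iff₀ hc, mul_comm]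
    exact h r s
  have hle : volume.map φ ≤ ENNReal.ofReal c⁻¹ • (volume : Measure ℝ) := by
    refine Measure.le_iff.2 fun s hs => ?_
    rw [Measure.map_apply hφ hs, ← hausdorffMeasure_real]
    have := hanti.hausdorffMeasure_preimage_le zero_le_one s
    rwa [ENNReal.rpow_one] at this
  calc ∫⁻ r, F (φ r) = ∫⁻ t, F t ∂(volume.map φ) := (lintegral_map hF hφ).symm
    _ ≤ ∫⁻ t, F t ∂(ENNReal.ofReal c⁻¹ • (volume : Measure ℝ)) := lintegral_mono' hle le_rfl
    _ = ENNReal.ofReal c⁻¹ * ∫⁻ t, F t := by rw [lintegral_smul_measure, smul_eq_mul]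

theorem lintegral_Ioo_eq_mul {c : ℝ} (hc : 0 < c) {G : ℝ → ℝ≥0∞} (hG : Measurable G) :
    ∫⁻ s in Ioo 0 c, G s = ENNReal.ofReal c * ∫⁻ θ in Ioo (0 : ℝ) 1, G (c * θ) := by
  rw [← lintegral_indicator measurableSet_Ioo]
  conv_lhs => rw [← Real.smul_map_volume_mul_left hc.ne']
  rw [lintegral_smul_measure, abs_of_pos hc, smul_eq_mul,
    lintegral_map (hG.indicator measurableSet_Ioo) (measurable_const_mul c),
    ← lintegral_indicator measurableSet_Ioo]
  congr 2
  ext θ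
  by_cases hθ : θ ∈ Ioo (0 : ℝ) 1
  · rw [indicator_of_mem hθ, indicator_of_mem]
    exact ⟨by have := hθ.1; positivity, by nlinarith [hθ.2]⟩
  · rw [indicator_of_notMem hθ, indicator_of_notMem]
    rintro ⟨h1, h2⟩
    exact hθ ⟨by by_contra hh; nlinarith, by nlinarith⟩

/-- In polar coordinates the Jacobian `r^(n-1)` cancels the weight, so a uniform bound on radial
integrals without weight is enough. -/
theorem lintegral_div_norm_rpow_le {n : ℕ} (hn : 1 ≤ n) {F : Space n → ℝ≥0∞} (hF : Measurable F)
    {C : ℝ≥0∞} (h : ∀ w : Space n, ‖w‖ = 1 → ∫⁻ r in Ioi (0 : ℝ), F (r • w) ≤ C) :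
    ∫⁻ x, F x / ‖x‖ₑ ^ ((n : ℝ) - 1) ≤
      (volume : Measure (Space n)).toSphere univ * C := by
  have : Nonempty (Fin n) := ⟨⟨0, hn⟩⟩
  set H : Space n → ℝ≥0∞ := fun x => F x / ‖x‖ₑ ^ ((n : ℝ) - 1) with hH
  have hHm : Measurable H := by fun_prop
  have hmp := (volume : Measure (Space n)).measurePreserving_homeomorphUnitSphereProd
  calc ∫⁻ x, H x = ∫⁻ x in ({0}ᶜ : Set (Space n)), H x := by
        rw [restrict_compl_singleton]
    _ = ∫⁻ x : ({0}ᶜ : Set (Space n)), H x ∂(volume.comap Subtype.val) := by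
        rw [← map_comap_subtype_coe (measurableSet_singleton _).compl,
          (MeasurableEmbedding.subtype_coe (measurableSet_singleton _).compl).lintegral_map]
    _ = ∫⁻ q : Metric.sphere (0 : Space n) 1 × Ioi (0 : ℝ), H ((q.2 : ℝ) • (q.1 : Space n))
          ∂((volume : Measure (Space n)).toSphere.prod
            (Measure.volumeIoiPow (Module.finrank ℝ (Space n) - 1))) := by
        rw [← hmp.lintegral_comp (by fun_prop)]
        refine lintegral_congr fun x => ?_
        have hx : ‖(x : Space n)‖ ≠ 0 := norm_ne_zero_iff.2 x.2
        simp [smul_smul, mul_inv_cancel₀ hx]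
    _ = ∫⁻ w : Metric.sphere (0 : Space n) 1, (∫⁻ r : Ioi (0 : ℝ), H ((r : ℝ) • (w : Space n))
          ∂(Measure.volumeIoiPow (Module.finrank ℝ (Space n) - 1)))
          ∂((volume : Measure (Space n)).toSphere) :=
        lintegral_prod _ (by fun_prop)
    _ ≤ ∫⁻ w : Metric.sphere (0 : Space n) 1, C ∂((volume : Measure (Space n)).toSphere) := by
        refine lintegral_mono fun w => ?_
        have hw : ‖(w : Space n)‖ = 1 := by simp
        refine le_trans (le_of_eq ?_) (h w hw)
        rw [Measure.volumeIoiPow, lintegral_withDensity_eq_lintegral_mul _ (by fun_prop)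
          (by fun_prop), ← map_comap_subtype_coe measurableSet_Ioi,
          (MeasurableEmbedding.subtype_coe measurableSet_Ioi).lintegral_map]
        refine lintegral_congr fun r => ?_
        have hr : (0 : ℝ) < r := r.2
        have hr' : ‖(r : ℝ) • (w : Space n)‖ₑ = ENNReal.ofReal r := by
          rw [← ofReal_norm, norm_smul, hw, mul_one, Real.norm_of_nonneg hr.le]
        rw [Pi.mul_apply, hH]
        simp only
        rw [hr', finrank_euclideanSpace_fin, ENNReal.ofReal_rpow_of_pos hr,
          ← Nat.cast_pred hn, Real.rpow_natCast, ENNReal.mul_div_cancel]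
        · exact (ENNReal.ofReal_pos.2 (by positivity)).ne'
        · exact ENNReal.ofReal_ne_top
    _ = _ := by rw [lintegral_const, mul_comm]

end Inequalities

end StripTrace

end

noncomputable section

namespace StripTrace

/-! ### The screened energy of a function bounded by path integrals -/

section Screened

variable {n : ℕ}

/-- With `N = n + 1` the exponent `p + N - 2` is `p + (n - 1)`: the length `‖h‖` of a leg absorbs
the power `p`, and the rest is the weight removed by polar coordinates. -/
theorem mul_norm_rpow_div_le {p : ℝ} (hp : 1 < p) (h : Space n) (c : ℝ≥0∞) :
    (‖h‖ₑ * c) ^ p / ‖h‖ₑ ^ (p + ((n : ℝ) + 1) - 2) ≤ c ^ p / ‖h‖ₑ ^ ((n : ℝ) - 1) := by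
  by_cases h0 : ‖h‖ₑ = 0
  · rw [h0, zero_mul, ENNReal.zero_rpow_of_pos (by linarith), ENNReal.zero_div]
    exact zero_le
  · rw [ENNReal.mul_rpow_of_nonneg _ _ (by linarith),
      show p + ((n : ℝ) + 1) - 2 = p + ((n : ℝ) - 1) by ring,
      ENNReal.rpow_add _ _ h0 enorm_ne_top]
    refine le_of_eq (ENNReal.mul_div_mul_left _ _ ?_ ?_)
    · exact (ENNReal.rpow_pos (pos_iff_ne_zero.2 h0) enorm_ne_top).ne'
    · exact ENNReal.rpow_ne_top_of_nonneg (by linarith) enorm_ne_top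

/-- The integral of `g` over the vertical segment of length `M * ‖h‖` that starts at the point of
the graph of `η` above `x`, in the direction `-ε`. -/
def verticalPart (g : Space (n + 1) → ℝ≥0∞) (η : Space n → ℝ) (ε M : ℝ) (x h : Space n) : ℝ≥0∞ :=
  ‖h‖ₑ * (ENNReal.ofReal M *
    ∫⁻ θ in Ioo (0 : ℝ) 1, g (join x (η x - ε * (M * ‖h‖ * θ))))

/-- The integral of `g` over the horizontal segment with direction `h` that starts at the point
`κ * ‖h‖` away from the graph of `η`, below or above `x`. -/
def horizontalPart (g : Space (n + 1) → ℝ≥0∞) (η : Space n → ℝ) (ε κ : ℝ) (x h : Space n) :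
    ℝ≥0∞ :=
  ‖h‖ₑ * ∫⁻ θ in Ioo (0 : ℝ) 1, g (join (x + θ • h) (η x - ε * (κ * ‖h‖)))

theorem lintegral_join (F : Space (n + 1) → ℝ≥0∞) (hF : Measurable F) :
    ∫⁻ x : Space n, ∫⁻ t : ℝ, F (join x t) = ∫⁻ z, F z := by
  rw [← measurePreserving_join.lintegral_comp hF, Measure.volume_eq_prod, lintegral_prod _
    (by fun_prop)]

variable {g : Space (n + 1) → ℝ≥0∞} {η : Space n → ℝ} {ε M κ p : ℝ}

theorem measurable_verticalPart (hg : Measurable g) (hη : Continuous η) (ε M : ℝ) :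
    Measurable fun q : Space n × Space n => verticalPart g η ε M q.1 q.2 := by
  have hηm := hη.measurable
  have : Measurable fun q : Space n × Space n =>
      ∫⁻ θ in Ioo (0 : ℝ) 1, g (join q.1 (η q.1 - ε * (M * ‖q.2‖ * θ))) :=
    Measurable.lintegral_prod_right' (f := fun q : (Space n × Space n) × ℝ =>
      g (join q.1.1 (η q.1.1 - ε * (M * ‖q.1.2‖ * q.2)))) (by fun_prop)
  unfold verticalPart
  fun_prop

theorem measurable_horizontalPart (hg : Measurable g) (hη : Continuous η) (ε : ℝ) :
    Measurable fun q : ℝ × Space n × Space n => horizontalPart g η ε q.1 q.2.1 q.2.2 := by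
  have hηm := hη.measurable
  have : Measurable fun q : ℝ × Space n × Space n =>
      ∫⁻ θ in Ioo (0 : ℝ) 1, g (join (q.2.1 + θ • q.2.2) (η q.2.1 - ε * (q.1 * ‖q.2.2‖))) :=
    Measurable.lintegral_prod_right' (f := fun q : (ℝ × Space n × Space n) × ℝ =>
      g (join (q.1.2.1 + q.2 • q.1.2.2) (η q.1.2.1 - ε * (q.1.1 * ‖q.1.2.2‖)))) (by fun_prop)
  unfold horizontalPart
  fun_prop

/-- This is Hardy's inequality in the depth variable. For fixed `θ` the radial substitution costs
`(M θ)⁻¹`, which is not integrable in `θ`; the weight `θ^((p-1)/p)` from Hölder's inequality repairs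
this and leaves `θ^(-1/p)`. -/
theorem lintegral_verticalPart_le (hn : 1 ≤ n) (hp : 1 < p) (hg : Measurable g)
    (hη : Continuous η) (hε : |ε| = 1) (hM : 1 ≤ M) :
    ∫⁻ x, ∫⁻ h, verticalPart g η ε M x h ^ p / ‖h‖ₑ ^ (p + ((n : ℝ) + 1) - 2) ≤
      ENNReal.ofReal M ^ p * ENNReal.ofReal (p / (p - 1)) ^ p *
        (volume : Measure (Space n)).toSphere univ * ∫⁻ z, g z ^ p := by
  have hηm := hη.measurable
  set Q := ENNReal.ofReal (p / (p - 1)) with hQ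
  set S := (volume : Measure (Space n)).toSphere univ
  have hgp : Measurable fun z => g z ^ p := hg.pow_const p
  set W : Space n → Space n → ℝ≥0∞ := fun x h => ∫⁻ θ in Ioo (0 : ℝ) 1,
    ENNReal.ofReal (θ ^ ((p - 1) / p)) * g (join x (η x - ε * (M * ‖h‖ * θ))) ^ p with hW
  have hWm : ∀ x, Measurable (W x) := fun x =>
    Measurable.lintegral_prod_right' (f := fun q : Space n × ℝ =>
      ENNReal.ofReal (q.2 ^ ((p - 1) / p)) * g (join x (η x - ε * (M * ‖q.1‖ * q.2))) ^ p)
      (by fun_prop)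
  have hQpos : 0 < p / (p - 1) := div_pos (by linarith) (by linarith)
  have step1 : ∀ x, ∫⁻ h, W x h / ‖h‖ₑ ^ ((n : ℝ) - 1) ≤ S * (Q * ∫⁻ t, g (join x t) ^ p) := by
    intro x
    refine lintegral_div_norm_rpow_le hn (hWm x) fun w hw => ?_
    have hsl : Measurable fun t => g (join x t) ^ p := by fun_prop
    calc ∫⁻ r in Ioi (0 : ℝ), W x (r • w)
        = ∫⁻ r in Ioi (0 : ℝ), ∫⁻ θ in Ioo (0 : ℝ) 1, ENNReal.ofReal (θ ^ ((p - 1) / p)) *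
            g (join x (η x - ε * (M * r * θ))) ^ p := by
          refine setLIntegral_congr_fun measurableSet_Ioi fun r hr => ?_
          simp only [hW, norm_smul, hw, mul_one, Real.norm_of_nonneg (le_of_lt (mem_Ioi.1 hr))]
      _ = ∫⁻ θ in Ioo (0 : ℝ) 1, ∫⁻ r in Ioi (0 : ℝ), ENNReal.ofReal (θ ^ ((p - 1) / p)) *
            g (join x (η x - ε * (M * r * θ))) ^ p := by
          refine lintegral_lintegral_swap (Measurable.aemeasurable ?_)
          unfold Function.uncurry
          fun_prop
      _ ≤ ∫⁻ θ in Ioo (0 : ℝ) 1, ENNReal.ofReal (θ ^ ((p - 1) / p - 1)) *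
            ∫⁻ t, g (join x t) ^ p := by
          refine setLIntegral_mono_ae (by fun_prop) (ae_of_all _ fun θ hθ => ?_)
          rw [lintegral_const_mul _ (by fun_prop)]
          have hMθ : 0 < M * θ := mul_pos (by linarith) hθ.1
          have h1 : ∫⁻ r in Ioi (0 : ℝ), g (join x (η x - ε * (M * r * θ))) ^ p ≤
              ENNReal.ofReal (M * θ)⁻¹ * ∫⁻ t, g (join x t) ^ p := by
            refine (setLIntegral_le_lintegral _ _).trans
              (lintegral_comp_le_of_expanding (φ := fun r => η x - ε * (M * r * θ))
                (by fun_prop) hMθ (fun r s => le_of_eq ?_) hsl)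
            rw [show η x - ε * (M * r * θ) - (η x - ε * (M * s * θ)) =
              -(ε * (M * θ * (r - s))) by ring, abs_neg, abs_mul, hε, one_mul, abs_mul,
              abs_of_pos hMθ]
          refine (mul_le_mul_right h1 _).trans ?_
          rw [← mul_assoc, ← ENNReal.ofReal_mul (Real.rpow_nonneg hθ.1.le _)]
          refine mul_le_mul_left (ENNReal.ofReal_le_ofReal ?_) _
          rw [Real.rpow_sub_one hθ.1.ne', div_eq_mul_inv]
          refine mul_le_mul_of_nonneg_left ?_ (Real.rpow_nonneg hθ.1.le _)
          -- Since `M ≥ 1`, the factor `M⁻¹` gained here can be dropped.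
          exact inv_anti₀ hθ.1 (by nlinarith [hθ.1])
      _ = Q * ∫⁻ t, g (join x t) ^ p := by
          have hq : (p - 1) / p - 1 = -(1 / p) := by field_simp; ring
          have h1 : 1 / p < 1 := by rw [div_lt_one (by linarith)]; exact hp
          rw [lintegral_mul_const _ (by fun_prop), hq, lintegral_Ioo_rpow (by linarith),
            show -(1 / p) + 1 = (p - 1) / p by field_simp; ring, inv_div]
  have step2 : ∀ x h, verticalPart g η ε M x h ^ p / ‖h‖ₑ ^ (p + ((n : ℝ) + 1) - 2) ≤
      ENNReal.ofReal M ^ p * Q ^ (p - 1) * (W x h / ‖h‖ₑ ^ ((n : ℝ) - 1)) := by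
    intro x h
    refine (mul_norm_rpow_div_le hp h _).trans ?_
    rw [← mul_div_assoc, ENNReal.mul_rpow_of_nonneg _ _ (by linarith), mul_assoc]
    gcongr
    exact lintegral_Ioo_rpow_le_weighted hp (by fun_prop)
  have hwm : ∀ x, Measurable fun h => W x h / ‖h‖ₑ ^ ((n : ℝ) - 1) := fun x => by
    have := hWm x
    fun_prop
  have hsm : Measurable fun x : Space n => ∫⁻ t, g (join x t) ^ p :=
    Measurable.lintegral_prod_right' (f := fun q : Space n × ℝ => g (join q.1 q.2) ^ p)
      (by fun_prop)
  calc _ ≤ ∫⁻ x, ∫⁻ h, ENNReal.ofReal M ^ p * Q ^ (p - 1) * (W x h / ‖h‖ₑ ^ ((n : ℝ) - 1)) :=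
        lintegral_mono fun x => lintegral_mono fun h => step2 x h
    _ ≤ ∫⁻ x, ENNReal.ofReal M ^ p * Q ^ (p - 1) * (S * (Q * ∫⁻ t, g (join x t) ^ p)) := by
        refine lintegral_mono fun x => ?_
        rw [lintegral_const_mul _ (hwm x)]
        gcongr
        exact step1 x
    _ = _ := by
        rw [lintegral_const_mul _ (by fun_prop), lintegral_const_mul _ (by fun_prop),
          lintegral_const_mul _ hsm, lintegral_join (fun z => g z ^ p) hgp]
        have : Q ^ p = Q ^ (p - 1) * Q := by
          conv_rhs => rw [← ENNReal.rpow_one Q, ← ENNReal.rpow_mul, one_mul]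
          rw [← ENNReal.rpow_add _ _ (ENNReal.ofReal_pos.2 hQpos).ne' ENNReal.ofReal_ne_top,
            sub_add_cancel]
        rw [this]
        ring

/-- Jensen's inequality passes to a fixed `θ`, and a translation of the base makes the point `y`
under the segment independent of `h`. Along a ray of directions the height then moves at rate at
least `κ - Λ`, as the slope `κ` of the depth beats the oscillation of `η`. -/
theorem lintegral_horizontalPart_le (hn : 1 ≤ n) (hp : 1 < p) (hg : Measurable g) {Λ : ℝ}
    (hη : Continuous η) (hΛ : ∀ x y, |η x - η y| ≤ Λ * ‖x - y‖) (hΛ0 : 0 ≤ Λ)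
    (hε : |ε| = 1) (hκ : Λ < κ) :
    ∫⁻ h, ∫⁻ x, horizontalPart g η ε κ x h ^ p / ‖h‖ₑ ^ (p + ((n : ℝ) + 1) - 2) ≤
      ENNReal.ofReal (κ - Λ)⁻¹ *
        (volume : Measure (Space n)).toSphere univ * ∫⁻ z, g z ^ p := by
  have hηm := hη.measurable
  set S := (volume : Measure (Space n)).toSphere univ
  have hgp : Measurable fun z => g z ^ p := hg.pow_const p
  -- The integrand after the substitution `y = x + θ h`: only the height still depends on `h`.
  set W : Space n → Space n → ℝ≥0∞ := fun y h => ∫⁻ θ in Ioo (0 : ℝ) 1,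
    g (join y (η (y - θ • h) - ε * (κ * ‖h‖))) ^ p with hW
  have hWm : Measurable fun q : Space n × Space n => W q.1 q.2 :=
    Measurable.lintegral_prod_right' (f := fun q : (Space n × Space n) × ℝ =>
      g (join q.1.1 (η (q.1.1 - q.2 • q.1.2) - ε * (κ * ‖q.1.2‖))) ^ p)
      (by fun_prop)
  have step1 : ∀ y, ∫⁻ h, W y h / ‖h‖ₑ ^ ((n : ℝ) - 1) ≤
      S * (ENNReal.ofReal (κ - Λ)⁻¹ * ∫⁻ t, g (join y t) ^ p) := by
    intro y
    refine lintegral_div_norm_rpow_le hn (by fun_prop) fun w hw => ?_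
    have hsl : Measurable fun t => g (join y t) ^ p := by fun_prop
    calc ∫⁻ r in Ioi (0 : ℝ), W y (r • w)
        = ∫⁻ r in Ioi (0 : ℝ), ∫⁻ θ in Ioo (0 : ℝ) 1,
            g (join y (η (y - θ • r • w) - ε * (κ * r))) ^ p := by
          refine setLIntegral_congr_fun measurableSet_Ioi fun r hr => ?_
          simp only [hW, norm_smul, hw, mul_one, Real.norm_of_nonneg (le_of_lt (mem_Ioi.1 hr))]
      _ = ∫⁻ θ in Ioo (0 : ℝ) 1, ∫⁻ r in Ioi (0 : ℝ),
            g (join y (η (y - θ • r • w) - ε * (κ * r))) ^ p := by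
          refine lintegral_lintegral_swap (Measurable.aemeasurable ?_)
          unfold Function.uncurry
          fun_prop
      _ ≤ ∫⁻ θ in Ioo (0 : ℝ) 1, ENNReal.ofReal (κ - Λ)⁻¹ * ∫⁻ t, g (join y t) ^ p := by
          refine setLIntegral_mono_ae (by fun_prop) (ae_of_all _ fun θ hθ => ?_)
          refine (setLIntegral_le_lintegral _ _).trans
              (lintegral_comp_le_of_expanding (φ := fun r => η (y - θ • r • w) - ε * (κ * r))
                (by fun_prop) (sub_pos.2 hκ) (fun r s => ?_) hsl)
          have h1 : |η (y - θ • r • w) - η (y - θ • s • w)| ≤ Λ * |r - s| := by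
            refine (hΛ _ _).trans (mul_le_mul_of_nonneg_left ?_ hΛ0)
            rw [show y - θ • r • w - (y - θ • s • w) = (θ * (s - r)) • w by module, norm_smul, hw,
              mul_one, norm_mul, Real.norm_of_nonneg hθ.1.le, Real.norm_eq_abs, abs_sub_comm]
            exact mul_le_of_le_one_left (abs_nonneg _) hθ.2.le
          have h2 : |ε * (κ * r) - ε * (κ * s)| = κ * |r - s| := by
            rw [← mul_sub, ← mul_sub, abs_mul, hε, one_mul, abs_mul,
              abs_of_pos (hΛ0.trans_lt hκ)]
          have h3 := abs_sub_abs_le_abs_sub (ε * (κ * r) - ε * (κ * s))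
            (η (y - θ • r • w) - η (y - θ • s • w))
          rw [abs_sub_comm (ε * (κ * r) - ε * (κ * s)) (η _ - η _)] at h3
          rw [show η (y - θ • r • w) - ε * (κ * r) - (η (y - θ • s • w) - ε * (κ * s)) =
            η (y - θ • r • w) - η (y - θ • s • w) - (ε * (κ * r) - ε * (κ * s)) by ring]
          linarith
      _ = ENNReal.ofReal (κ - Λ)⁻¹ * ∫⁻ t, g (join y t) ^ p := by simp
  have hsm : Measurable fun x : Space n => ∫⁻ t, g (join x t) ^ p :=
    Measurable.lintegral_prod_right' (f := fun q : Space n × ℝ => g (join q.1 q.2) ^ p)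
      (by fun_prop)
  calc _ ≤ ∫⁻ h, ∫⁻ x, (∫⁻ θ in Ioo (0 : ℝ) 1,
            g (join (x + θ • h) (η x - ε * (κ * ‖h‖))) ^ p) / ‖h‖ₑ ^ ((n : ℝ) - 1) := by
        refine lintegral_mono fun h => lintegral_mono fun x => ?_
        refine (mul_norm_rpow_div_le hp h _).trans ?_
        gcongr
        exact lintegral_rpow_le_of_isProbabilityMeasure _ hp (by fun_prop)
    _ = ∫⁻ h, ∫⁻ y, W y h / ‖h‖ₑ ^ ((n : ℝ) - 1) := by
        refine lintegral_congr fun h => ?_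
        simp only [div_eq_mul_inv]
        have m1 : Measurable fun x => ∫⁻ θ in Ioo (0 : ℝ) 1,
            g (join (x + θ • h) (η x - ε * (κ * ‖h‖))) ^ p :=
          Measurable.lintegral_prod_right' (f := fun q : Space n × ℝ =>
            g (join (q.1 + q.2 • h) (η q.1 - ε * (κ * ‖h‖))) ^ p) (by fun_prop)
        rw [lintegral_mul_const _ m1, lintegral_mul_const _ (by fun_prop)]
        congr 1
        simp only [hW]
        refine (lintegral_lintegral_swap ?_).trans
          (Eq.trans ?_ (lintegral_lintegral_swap ?_).symm)
        · refine Measurable.aemeasurable ?_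
          unfold Function.uncurry
          fun_prop
        · refine lintegral_congr fun θ => ?_
          rw [← lintegral_add_right_eq_self (fun y =>
            g (join y (η (y - θ • h) - ε * (κ * ‖h‖))) ^ p) (θ • h)]
          simp only [add_sub_cancel_right]
        · refine Measurable.aemeasurable ?_
          unfold Function.uncurry
          fun_prop
    _ = ∫⁻ y, ∫⁻ h, W y h / ‖h‖ₑ ^ ((n : ℝ) - 1) := by
        refine lintegral_lintegral_swap (Measurable.aemeasurable ?_)
        unfold Function.uncurry
        fun_prop
    _ ≤ ∫⁻ y, S * (ENNReal.ofReal (κ - Λ)⁻¹ * ∫⁻ t, g (join y t) ^ p) := lintegral_mono step1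
    _ = _ := by
        rw [lintegral_const_mul _ (by fun_prop), lintegral_const_mul _ hsm,
          lintegral_join (fun z => g z ^ p) hgp]
        ring

/-- After exchanging the order of integration, the term at `x + h` has the same integral in `x` as
the term at `x`; hence the factor 2. The function `B` stands last in the sums, so additivity of the
integral asks for measurability of the `A` terms only. -/
theorem lintegral_ball_le_of_ae (hp : 0 ≤ p) {σ : Space n → ℝ} (hσ : Measurable σ)
    {A B D : Space n × Space n → ℝ≥0∞} (hA : Measurable A) (hD : Measurable D)
    {d : Space n → ℝ≥0∞} (hd : Measurable d)
    (h : ∀ᵐ h : Space n, ∀ᵐ x : Space n, ‖h‖ < σ x → D (x, h) ≤ A (x, h) + A (x + h, h) + B (x, h)) :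
    ∫⁻ x, ∫⁻ h in Metric.ball (0 : Space n) (σ x), D (x, h) ^ p / d h ≤ 3 ^ p *
      (2 * (∫⁻ x, ∫⁻ h, A (x, h) ^ p / d h) + ∫⁻ h, ∫⁻ x, B (x, h) ^ p / d h) := by
  have hset : MeasurableSet {q : Space n × Space n | ‖q.2‖ < σ q.1} :=
    measurableSet_lt (by fun_prop) (by fun_prop)
  have e1 : ∫⁻ x, ∫⁻ h in Metric.ball (0 : Space n) (σ x), D (x, h) ^ p / d h =
      ∫⁻ x, ∫⁻ h, {q : Space n × Space n | ‖q.2‖ < σ q.1}.indicator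
      (fun q => D q ^ p / d q.2) (x, h) := by
    refine lintegral_congr fun x => ?_
    rw [← lintegral_indicator Metric.isOpen_ball.measurableSet]
    refine lintegral_congr fun h => ?_
    simp only [indicator, Metric.mem_ball, dist_zero_right, mem_ofPred_eq]
  have m1 : Measurable fun q : Space n × Space n => A q ^ p / d q.2 := by fun_prop
  have f1 : ∀ h, Measurable fun x => A (x, h) ^ p / d h := fun h => by fun_prop
  have f2 : ∀ h, Measurable fun x => A (x + h, h) ^ p / d h := fun h => by fun_prop
  have g1 : Measurable fun h => ∫⁻ x, A (x, h) ^ p / d h :=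
    Measurable.lintegral_prod_right' (f := fun q : Space n × Space n => A (q.2, q.1) ^ p / d q.1)
      (by fun_prop)
  have hv : ∫⁻ x, ∫⁻ h, A (x, h) ^ p / d h = ∫⁻ h, ∫⁻ x, A (x, h) ^ p / d h := by
    refine lintegral_lintegral_swap (Measurable.aemeasurable ?_)
    unfold Function.uncurry
    fun_prop
  rw [e1, lintegral_lintegral_swap]
  swap
  · refine Measurable.aemeasurable ?_
    unfold Function.uncurry
    exact Measurable.indicator (by fun_prop) hset
  calc _ ≤ ∫⁻ h, ∫⁻ x, 3 ^ p * (A (x, h) ^ p / d h + A (x + h, h) ^ p / d h +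
          B (x, h) ^ p / d h) := by
        refine lintegral_mono_ae ?_
        filter_upwards [h] with h hh
        refine lintegral_mono_ae ?_
        filter_upwards [hh] with x hx
        by_cases hxs : ‖h‖ < σ x
        · rw [indicator_of_mem (by exact hxs), ← ENNReal.add_div, ← ENNReal.add_div,
            ← mul_div_assoc]
          refine ENNReal.div_le_div_right ?_ _
          exact (ENNReal.rpow_le_rpow (hx hxs) hp).trans (add_add_rpow_le hp _ _ _)
        · rw [indicator_of_notMem (by exact hxs)]
          exact zero_le
    _ = 3 ^ p * ((∫⁻ h, ∫⁻ x, A (x, h) ^ p / d h) + (∫⁻ h, ∫⁻ x, A (x, h) ^ p / d h) +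
        ∫⁻ h, ∫⁻ x, B (x, h) ^ p / d h) := by
        have h3 : (3 : ℝ≥0∞) ^ p ≠ ⊤ := ENNReal.rpow_ne_top_of_nonneg hp (by simp)
        have g2 : Measurable fun h => (∫⁻ x, A (x, h) ^ p / d h) + ∫⁻ x, A (x, h) ^ p / d h :=
          g1.add g1
        have f3 : ∀ h, Measurable fun x => A (x, h) ^ p / d h + A (x + h, h) ^ p / d h :=
          fun h => (f1 h).add (f2 h)
        rw [← lintegral_add_left g1, ← lintegral_add_left g2,
          ← lintegral_const_mul' _ _ h3]
        refine lintegral_congr fun h => ?_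
        rw [lintegral_const_mul' _ _ h3, lintegral_add_left (f3 h),
          lintegral_add_left (f1 h),
          lintegral_add_right_eq_self (fun x => A (x, h) ^ p / d h) h]
    _ = _ := by rw [hv]; ring

theorem screenedEnergy_le (hn : 1 ≤ n) (hp : 1 < p) (hg : Measurable g) {Λ : ℝ}
    (hη : Continuous η) (hΛ : ∀ x y, |η x - η y| ≤ Λ * ‖x - y‖) (hΛ0 : 0 ≤ Λ)
    (hε : |ε| = 1) (hM : 1 ≤ M) (hκ : Λ < κ) {σ f : Space n → ℝ} (hσ : Measurable σ)
    (hf : Measurable f)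
    (h : ∀ᵐ h : Space n, ∀ᵐ x : Space n, ‖h‖ < σ x → ‖f (x + h) - f x‖ₑ ≤
      verticalPart g η ε M x h + verticalPart g η ε M (x + h) h + horizontalPart g η ε κ x h) :
    screenedEnergy p σ f ≤ 3 ^ p * (2 * (ENNReal.ofReal M ^ p * ENNReal.ofReal (p / (p - 1)) ^ p) +
      ENNReal.ofReal (κ - Λ)⁻¹) * (volume : Measure (Space n)).toSphere univ * ∫⁻ z, g z ^ p := by
  have hA := measurable_verticalPart hg hη ε M
  have hv := lintegral_verticalPart_le hn hp hg hη hε hM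
  have hh := lintegral_horizontalPart_le hn hp hg hη hΛ hΛ0 hε hκ
  unfold screenedEnergy
  generalize verticalPart g η ε M = A at *
  generalize horizontalPart g η ε κ = B at *
  refine (lintegral_ball_le_of_ae (A := fun q => A q.1 q.2) (B := fun q => B q.1 q.2)
    (D := fun q => ‖f (q.1 + q.2) - f q.1‖ₑ)
    (d := fun h => ‖h‖ₑ ^ (p + ((n : ℝ) + 1) - 2)) (by linarith) hσ
    hA (by fun_prop) (by fun_prop) h).trans ?_
  refine (mul_le_mul_right (add_le_add (mul_le_mul_right hv _) hh) _).trans (le_of_eq ?_)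
  ring

end Screened

end StripTrace

end

noncomputable section

namespace StripTrace

/-! ### The three-leg path and the choice of its depth -/

section PointwiseBound

variable {n : ℕ} {Ω : Set (Space (n + 1))} {η f : Space n → ℝ} {u : Space (n + 1) → ℝ}
  {G : Space (n + 1) → Space (n + 1)} {ε : ℝ}

/-- The norm of the gradient, extended by zero outside `Ω`. -/
def gradNorm (Ω : Set (Space (n + 1))) (G : Space (n + 1) → Space (n + 1)) :
    Space (n + 1) → ℝ≥0∞ :=
  Ω.indicator fun z => ‖G z‖ₑ

theorem measurable_gradNorm (hΩ : MeasurableSet Ω) (hG : Measurable G) :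
    Measurable (gradNorm Ω G) :=
  hG.enorm.indicator hΩ

theorem lintegral_gradNorm_rpow (hΩ : MeasurableSet Ω) {p : ℝ} (hp : 0 < p) :
    ∫⁻ z, gradNorm Ω G z ^ p = ∫⁻ z in Ω, ‖G z‖ₑ ^ p := by
  rw [← lintegral_indicator hΩ]
  refine lintegral_congr fun z => ?_
  by_cases hz : z ∈ Ω
  · simp [gradNorm, hz]
  · simp [gradNorm, hz, hp]

/-- The estimate for the horizontal leg, with the derivative along `v` bounded by `‖v‖` times the
norm of the gradient. -/
theorem ae_enorm_sub_le_of_hasWeakDir (hΩ : IsOpen Ω)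
    (h : ∀ e, HasWeakDir Ω e u fun z => inner ℝ e (G z)) (v : Space n) :
    ∀ᵐ z, (∀ s ∈ Icc (0 : ℝ) 1, z + s • join v 0 ∈ Ω) →
      ‖u (z + join v 0) - u z‖ₑ ≤
        ‖v‖ₑ * ∫⁻ s in Ioo (0 : ℝ) 1, gradNorm Ω G (z + s • join v 0) := by
  filter_upwards [(h (join v 0)).ae_sub_eq hΩ] with z hz hzΩ
  rw [hz hzΩ, intervalIntegral.integral_of_le zero_le_one, integral_Ioc_eq_integral_Ioo,
    ← lintegral_const_mul' _ _ enorm_ne_top]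
  refine (enorm_integral_le_lintegral_enorm _).trans
    (lintegral_mono_ae ?_)
  filter_upwards [ae_restrict_mem measurableSet_Ioo] with s hs
  rw [gradNorm, indicator_of_mem (hzΩ s (Ioo_subset_Icc_self hs)), ← ofReal_norm, ← ofReal_norm v,
    ← ofReal_norm, ← ENNReal.ofReal_mul (norm_nonneg _)]
  refine ENNReal.ofReal_le_ofReal ((norm_inner_le_norm _ _).trans (le_of_eq ?_))
  rw [norm_join]
  simp

/-- On almost every vertical line, `f` differs from `u` at depth `τ` at most by the integral
of `g` from the surface down to depth `τ`. -/
def VertBound (Ω : Set (Space (n + 1))) (u : Space (n + 1) → ℝ) (g : Space (n + 1) → ℝ≥0∞)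
    (η f : Space n → ℝ) (ε : ℝ) : Prop :=
  ∀ᵐ x, ∀ᵐ t : ℝ, join x t ∈ Ω → 0 < ε * (η x - t) →
    ‖f x - u (join x t)‖ₑ ≤ ∫⁻ s in Ioo 0 (ε * (η x - t)), g (join x (η x - ε * s))

theorem setLIntegral_Ioo_comp_sub (a b : ℝ) (F : ℝ → ℝ≥0∞) :
    ∫⁻ s in Ioo 0 (b - a), F (b - s) = ∫⁻ s in Ioo a b, F s := by
  rw [← lintegral_indicator measurableSet_Ioo, ← lintegral_indicator measurableSet_Ioo,
    ← lintegral_sub_left_eq_self _ b]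
  refine lintegral_congr fun s => ?_
  simp [indicator, and_comm]

theorem setLIntegral_Ioo_comp_add (a b : ℝ) (F : ℝ → ℝ≥0∞) :
    ∫⁻ s in Ioo 0 (b - a), F (a + s) = ∫⁻ s in Ioo a b, F s := by
  rw [← lintegral_indicator measurableSet_Ioo, ← lintegral_indicator measurableSet_Ioo,
    ← lintegral_add_left_eq_self ((Ioo a b).indicator F) a]
  refine lintegral_congr fun s => ?_
  simp [indicator, lt_sub_iff_add_lt']

/-- The sign makes `η x - ε s` move into the domain: upwards from the lower graph, downwards from
the upper one. From here on both graphs are treated alike. -/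
theorem IsVertTrace.vertBound {ηm ηp fm fp : Space n → ℝ} {e : Space (n + 1)} (he : ‖e‖ ≤ 1)
    (h : IsVertTrace ηm ηp u (fun z => inner ℝ e (G z)) fm fp) :
    VertBound (graphDomain ηm ηp) u (gradNorm (graphDomain ηm ηp) G) ηm fm (-1) ∧
    VertBound (graphDomain ηm ηp) u (gradNorm (graphDomain ηm ηp) G) ηp fp 1 := by
  have key : ∀ x a b, ηm x ≤ a → a ≤ b → b ≤ ηp x →
      ‖∫ s in a..b, inner ℝ e (G (join x s))‖ₑ ≤
        ∫⁻ s in Ioo a b, gradNorm (graphDomain ηm ηp) G (join x s) := by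
    intro x a b ha hab hb
    rw [intervalIntegral.integral_of_le hab, integral_Ioc_eq_integral_Ioo]
    refine (enorm_integral_le_lintegral_enorm _).trans (lintegral_mono_ae ?_)
    filter_upwards [ae_restrict_mem measurableSet_Ioo] with s hs
    rw [gradNorm, indicator_of_mem (join_mem_graphDomain.2 ⟨ha.trans_lt hs.1, hs.2.trans_le hb⟩),
      ← ofReal_norm, ← ofReal_norm (G _)]
    exact ENNReal.ofReal_le_ofReal ((norm_inner_le_norm _ _).trans
      (mul_le_of_le_one_left (norm_nonneg _) he))
  constructor
  · filter_upwards [h] with x hx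
    filter_upwards [(ae_restrict_iff' measurableSet_Ioo).1 hx.2.1] with t ht htΩ _
    have hmem := join_mem_graphDomain.1 htΩ
    rw [ht hmem, sub_add_cancel_left, enorm_neg]
    refine (key x _ _ le_rfl hmem.1.le hmem.2.le).trans (le_of_eq ?_)
    rw [← setLIntegral_Ioo_comp_add]
    simp
  · filter_upwards [h] with x hx
    filter_upwards [(ae_restrict_iff' measurableSet_Ioo).1 hx.2.1] with t ht htΩ _
    have hmem := join_mem_graphDomain.1 htΩ
    have hi := fun s t => intervalIntegrable_of_integrableOn_Ioo (s := s) (t := t) hx.1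
    have hsub : fp x - u (join x t) = ∫ s in t..ηp x, inner ℝ e (G (join x s)) := by
      rw [ht hmem, hx.2.2, add_sub_add_left_eq_sub,
        intervalIntegral.integral_interval_sub_left]
      · exact hi _ _ (by simp [(hmem.1.trans hmem.2).le]) (by simp [(hmem.1.trans hmem.2).le])
      · exact hi _ _ (by simp [(hmem.1.trans hmem.2).le]) ⟨hmem.1.le, hmem.2.le⟩
    rw [hsub]
    refine (key x _ _ hmem.1.le hmem.2.le le_rfl).trans (le_of_eq ?_)
    rw [← setLIntegral_Ioo_comp_sub]
    simp

theorem ae_sub_const_mul {a : ℝ} (ha : a ≠ 0) (b : ℝ) {P : ℝ → Prop}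
    (h : ∀ᵐ t : ℝ, P t) : ∀ᵐ s : ℝ, P (b - a * s) := by
  have h1 : ∀ᵐ t : ℝ, P (b - t) := by
    exact (Measure.measurePreserving_sub_left volume b).quasiMeasurePreserving.ae h
  rw [ae_iff] at h1 ⊢
  have := Real.volume_preimage_mul_left ha {t | ¬ P (b - t)}
  rw [h1, mul_zero] at this
  exact this

/-- For fixed `x` and `v ≠ 0` the height of the horizontal leg is affine in `κ` with nonzero slope,
so almost every `κ` avoids the exceptional heights of all three legs. Fubini then yields one `κ` for
almost every `(h, x)`. A depth `κ‖v‖` at `x` is a depth within `Λ‖v‖` of it at `x + v`; thus `Λ ≤ a`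
keeps both depths positive and `b + Λ ≤ M` bounds them by `M‖v‖`. -/
theorem exists_depth (hη : Continuous η) {Λ M : ℝ} (hΛ : ∀ x y, |η x - η y| ≤ Λ * ‖x - y‖)
    (hΛ0 : 0 ≤ Λ) (hε : ε * ε = 1) {g : Space (n + 1) → ℝ≥0∞} (hg : Measurable g)
    (hf : Measurable f) {σ : Space n → ℝ} (hσ : Measurable σ)
    (hV : VertBound Ω u g η f ε)
    (hH : ∀ v : Space n, ∀ᵐ z, (∀ s ∈ Icc (0 : ℝ) 1, z + s • join v 0 ∈ Ω) →
      ‖u (z + join v 0) - u z‖ₑ ≤ ‖v‖ₑ * ∫⁻ s in Ioo (0 : ℝ) 1, g (z + s • join v 0))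
    {a b : ℝ} (hab : a < b) (ha : Λ ≤ a) (hM : b + Λ ≤ M)
    (hgeo : ∀ x v, v ≠ 0 → ‖v‖ < σ x → ∀ κ ∈ Ioo a b, ∀ θ ∈ Icc (0 : ℝ) 1,
      join (x + θ • v) (η x - ε * (κ * ‖v‖)) ∈ Ω) :
    ∃ κ ∈ Ioo a b, ∀ᵐ h : Space n, ∀ᵐ x : Space n, ‖h‖ < σ x → ‖f (x + h) - f x‖ₑ ≤
      verticalPart g η ε M x h + verticalPart g η ε M (x + h) h + horizontalPart g η ε κ x h := by
  set Q : Space n → ℝ → Space n → Prop := fun v κ x => κ ∈ Ioo a b → ‖v‖ < σ x →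
    ‖f (x + v) - f x‖ₑ ≤ verticalPart g η ε M x v + verticalPart g η ε M (x + v) v +
      horizontalPart g η ε κ x v with hQ
  have habs : |ε| = 1 := by
    have := abs_mul_abs_self ε
    nlinarith [abs_nonneg ε, sq_nonneg (|ε| - 1)]
  have point : ∀ v, v ≠ 0 → ∀ᵐ x, ∀ᵐ κ, Q v κ x := by
    intro v hv0
    have hv : 0 < ‖v‖ := norm_pos_iff.2 hv0
    have hH' := ae_join_iff.1 (hH v)
    rw [Measure.volume_eq_prod] at hH'
    have hV' : ∀ᵐ x, ∀ᵐ t : ℝ, join (x + v) t ∈ Ω → 0 < ε * (η (x + v) - t) →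
        ‖f (x + v) - u (join (x + v) t)‖ₑ ≤
          ∫⁻ s in Ioo 0 (ε * (η (x + v) - t)), g (join (x + v) (η (x + v) - ε * s)) :=
      (measurePreserving_add_right volume v).quasiMeasurePreserving.ae hV
    filter_upwards [hV, hV', Measure.ae_ae_of_ae_prod hH'] with x h1 h2 h3
    have hc : ε * ‖v‖ ≠ 0 := by
      intro h0
      rcases mul_eq_zero.1 h0 with h0 | h0
      · rw [h0] at hε; simp at hε
      · exact hv.ne' h0
    -- All three a.e. statements are taken at the common height `η x - ε κ ‖v‖`.
    filter_upwards [ae_sub_const_mul hc (η x) (h1.and (h2.and h3))] with κ hκ hκI hσx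
    rw [show ε * ‖v‖ * κ = ε * (κ * ‖v‖) by ring] at hκ
    set t := η x - ε * (κ * ‖v‖) with ht
    obtain ⟨k1, k2, k3⟩ := hκ
    have hΩθ : ∀ θ ∈ Icc (0 : ℝ) 1, join (x + θ • v) t ∈ Ω := hgeo x v hv0 hσx κ hκI
    have hκ0 : 0 < κ := (hΛ0.trans ha).trans_lt hκI.1
    have d1 : ε * (η x - t) = κ * ‖v‖ := by rw [ht]; linear_combination (κ * ‖v‖) * hε
    have d2 : |ε * (η (x + v) - t) - κ * ‖v‖| ≤ Λ * ‖v‖ := by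
      rw [← d1, ← mul_sub, abs_mul, habs, one_mul, sub_sub_sub_cancel_right]
      simpa using hΛ (x + v) x
    rw [abs_le] at d2
    have tail : ∀ y (R : ℝ), R ≤ M * ‖v‖ →
        ∫⁻ s in Ioo 0 R, g (join y (η y - ε * s)) ≤ verticalPart g η ε M y v := by
      intro y R hR
      have hM0 : 0 < M := by linarith
      refine (lintegral_mono_set (Ioo_subset_Ioo_right hR)).trans (le_of_eq ?_)
      rw [lintegral_Ioo_eq_mul (mul_pos hM0 hv) (by fun_prop), verticalPart,
        ENNReal.ofReal_mul hM0.le, ofReal_norm, ← mul_assoc, mul_comm (ENNReal.ofReal M)]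
    have b1 : ‖f x - u (join x t)‖ₑ ≤ verticalPart g η ε M x v := by
      refine (k1 (by simpa using hΩθ 0 (by simp)) (by rw [d1]; positivity)).trans (tail _ _ ?_)
      rw [d1]
      gcongr
      linarith [hκI.2]
    have b2 : ‖f (x + v) - u (join (x + v) t)‖ₑ ≤ verticalPart g η ε M (x + v) v := by
      refine (k2 (by simpa using hΩθ 1 (by simp)) ?_).trans (tail _ _ ?_)
      · nlinarith [hκI.1]
      · nlinarith [hκI.2]
    have hj : ∀ s : ℝ, join x t + s • join v 0 = join (x + s • v) t := by
      intro s
      rw [← join_smul, ← join_add, mul_zero, add_zero]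
    have hj1 : join x t + join v 0 = join (x + v) t := by simpa using hj 1
    have b3 : ‖u (join (x + v) t) - u (join x t)‖ₑ ≤ horizontalPart g η ε κ x v := by
      have := k3 fun s hs => by rw [hj]; exact hΩθ s hs
      simp only [hj, hj1] at this
      exact this
    calc ‖f (x + v) - f x‖ₑ
        = ‖(u (join x t) - f x) + (f (x + v) - u (join (x + v) t)) +
            (u (join (x + v) t) - u (join x t))‖ₑ := by congr 1; ring
      _ ≤ ‖u (join x t) - f x‖ₑ + ‖f (x + v) - u (join (x + v) t)‖ₑ +
            ‖u (join (x + v) t) - u (join x t)‖ₑ :=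
          (enorm_add_le _ _).trans (add_le_add_left (enorm_add_le _ _) _)
      _ ≤ _ := by
          rw [enorm_sub_rev (u (join x t)) (f x)]
          gcongr
  have mA := measurable_verticalPart hg hη ε M
  have mB := measurable_horizontalPart hg hη ε
  have hQm : MeasurableSet {q : (Space n × ℝ) × Space n | Q q.1.1 q.1.2 q.2} := by
    have s1 : MeasurableSet {q : (Space n × ℝ) × Space n | q.1.2 ∈ Ioo a b} :=
      measurableSet_Ioo.preimage (by fun_prop : Measurable fun q : (Space n × ℝ) × Space n => q.1.2)
    have s2 : MeasurableSet {q : (Space n × ℝ) × Space n | ‖q.1.1‖ < σ q.2} :=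
      measurableSet_lt (by fun_prop) (by fun_prop)
    have a1 : Measurable fun q : (Space n × ℝ) × Space n => verticalPart g η ε M q.2 q.1.1 :=
      mA.comp (f := fun q : (Space n × ℝ) × Space n => (q.2, q.1.1)) (by fun_prop)
    have a2 : Measurable fun q : (Space n × ℝ) × Space n =>
        verticalPart g η ε M (q.2 + q.1.1) q.1.1 :=
      mA.comp (f := fun q : (Space n × ℝ) × Space n => (q.2 + q.1.1, q.1.1)) (by fun_prop)
    have a3 : Measurable fun q : (Space n × ℝ) × Space n =>
        horizontalPart g η ε q.1.2 q.2 q.1.1 :=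
      mB.comp (f := fun q : (Space n × ℝ) × Space n => (q.1.2, q.2, q.1.1)) (by fun_prop)
    have s3 : MeasurableSet {q : (Space n × ℝ) × Space n | ‖f (q.2 + q.1.1) - f q.2‖ₑ ≤
        verticalPart g η ε M q.2 q.1.1 + verticalPart g η ε M (q.2 + q.1.1) q.1.1 +
          horizontalPart g η ε q.1.2 q.2 q.1.1} :=
      measurableSet_le (by fun_prop) ((a1.add a2).add a3)
    exact s1.imp (s2.imp s3)
  have hQs : ∀ v, MeasurableSet {q : Space n × ℝ | Q v q.2 q.1} := fun v =>
    hQm.preimage (by fun_prop : Measurable fun q : Space n × ℝ => ((v, q.2), q.1))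
  have hQae : MeasurableSet {q : Space n × ℝ | ∀ᵐ x, Q q.1 q.2 x} :=
    measurable_measure_prodMk_left (ν := (volume : Measure (Space n))) hQm.compl
      (measurableSet_singleton 0)
  -- The substitution degenerates at `v = 0`, which is a null set unless the base is a single point;
  -- in that case the left-hand side is 0.
  have hne : ∀ᵐ v : Space n, ∀ᵐ x, ∀ᵐ κ, Q v κ x := by
    by_cases hn : Nontrivial (Space n)
    · filter_upwards [compl_mem_ae_iff.2 (measure_singleton (0 : Space n))] with v hv
      exact point v hv
    · rw [not_nontrivial_iff_subsingleton] at hn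
      refine ae_of_all _ fun v => ae_of_all _ fun x => ae_of_all _ fun κ _ _ => ?_
      rw [Subsingleton.elim (x + v) x]
      simp
  have hfin : ∀ᵐ κ : ℝ, ∀ᵐ v : Space n, ∀ᵐ x, Q v κ x := by
    refine (Measure.ae_ae_comm (p := fun (v : Space n) (κ : ℝ) => ∀ᵐ x, Q v κ x) hQae).1 ?_
    filter_upwards [hne] with v hv
    exact (Measure.ae_ae_comm (hQs v)).1 hv
  have hpos : volume (Ioo a b) ≠ 0 := by simp [hab]
  obtain ⟨κ, hκI, hκ⟩ := (hfin.and_frequently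
    (frequently_ae_mem_iff.2 hpos)).exists.imp fun κ h => And.intro h.2 h.1
  refine ⟨κ, hκI, ?_⟩
  filter_upwards [hκ] with v hv
  filter_upwards [hv] with x hx
  exact hx hκI

end PointwiseBound

end StripTrace

end

noncomputable section

namespace StripTrace

/-! ### The screened estimate for the traces and local integrability -/

section ScreenedTrace

variable {n : ℕ}

/-- A constant, depending only on the dimension and on `p`, for the screened estimate. -/
def screenedConst (n : ℕ) (p : ℝ) : ℝ :=
  3 ^ p * (2 * (2 ^ p * (p / (p - 1)) ^ p) + 2) *
    ((volume : Measure (Space n)).toSphere univ).toReal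

theorem screenedConst_nonneg {p : ℝ} (hp : 1 < p) : 0 ≤ screenedConst n p := by
  have : 0 < p / (p - 1) := div_pos (by linarith) (by linarith)
  unfold screenedConst
  positivity

theorem screenedEnergy_le_screenedConst (hn : 1 ≤ n) {p : ℝ} (hp : 1 < p) {Ω : Set (Space (n + 1))}
    (hΩ : IsOpen Ω) {u : Space (n + 1) → ℝ} {G : Space (n + 1) → Space (n + 1)} (hG : Measurable G)
    (h : ∀ e, HasWeakDir Ω e u fun z => inner ℝ e (G z)) {η f : Space n → ℝ} {ε : ℝ}
    (hη : Continuous η) {Λ L l : ℝ} (hΛ : ∀ x y, |η x - η y| ≤ Λ * ‖x - y‖) (hΛ0 : 0 ≤ Λ)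
    (hΛL : Λ ≤ L) (hl : 0 < l) (hε : ε * ε = 1) (hf : Measurable f) {σ : Space n → ℝ}
    (hσ : Measurable σ) (hV : VertBound Ω u (gradNorm Ω G) η f ε)
    (hgeo : ∀ x v, v ≠ 0 → ‖v‖ < σ x → ∀ κ, Λ < κ → κ < Λ + min 1 l → ∀ θ ∈ Icc (0 : ℝ) 1,
      join (x + θ • v) (η x - ε * (κ * ‖v‖)) ∈ Ω) :
    screenedEnergy p σ f ≤ ENNReal.ofReal (max 1 l⁻¹ * (1 + L) ^ p * screenedConst n p) *
      ∫⁻ z in Ω, ‖G z‖ₑ ^ p := by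
  have hm0 : 0 < min 1 l := lt_min one_pos hl
  have hm1 : min 1 l ≤ 1 := min_le_left _ _
  have hg := measurable_gradNorm (G := G) hΩ.measurableSet hG
  -- The upper half of the admissible range: `κ - Λ` is at least `min 1 l / 2`, which gives `(κ -
  -- Λ)⁻¹ ≤ 2 max 1 l⁻¹`, and `κ + Λ ≤ 2 Λ + 1 ≤ 2 (1 + L)` bounds the vertical legs.
  obtain ⟨κ, hκ, hb⟩ := exists_depth (M := 2 * (1 + L)) (a := Λ + min 1 l / 2) (b := Λ + min 1 l)
    hη hΛ hΛ0 hε hg hf hσ hV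
    (ae_enorm_sub_le_of_hasWeakDir hΩ h) (by linarith) (by linarith) (by linarith)
    (fun x v hv hvσ κ hκ => hgeo x v hv hvσ κ (by linarith [hκ.1]) hκ.2)
  have habs : |ε| = 1 := by
    have := abs_mul_abs_self ε
    nlinarith [abs_nonneg ε, sq_nonneg (|ε| - 1)]
  refine (screenedEnergy_le hn hp hg hη hΛ hΛ0 habs (by linarith) (by linarith [hκ.1]) hσ hf
    hb).trans ?_
  rw [lintegral_gradNorm_rpow hΩ.measurableSet (by linarith)]
  refine mul_le_mul_left ?_ _
  have hQ : 0 < p / (p - 1) := div_pos (by linarith) (by linarith)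
  have hS : (volume : Measure (Space n)).toSphere univ =
      ENNReal.ofReal ((volume : Measure (Space n)).toSphere univ).toReal :=
    (ENNReal.ofReal_toReal (measure_ne_top _ _)).symm
  have hM : 0 < 2 * (1 + L) := by linarith
  have hκΛ : 0 < κ - Λ := by linarith [hκ.1]
  have e3 : (3 : ℝ≥0∞) ^ p = ENNReal.ofReal (3 ^ p) := by
    rw [← ENNReal.ofReal_rpow_of_pos (by norm_num), ENNReal.ofReal_ofNat]
  have e2 : ∀ X : ℝ, (2 : ℝ≥0∞) * ENNReal.ofReal X = ENNReal.ofReal (2 * X) := fun X => by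
    rw [ENNReal.ofReal_mul (by norm_num), ENNReal.ofReal_ofNat]
  rw [hS, ENNReal.ofReal_rpow_of_pos hM, ENNReal.ofReal_rpow_of_pos hQ,
    ← ENNReal.ofReal_mul (by positivity), e3, e2,
    ← ENNReal.ofReal_add (by positivity) (by positivity), ← ENNReal.ofReal_mul (by positivity),
    ← ENNReal.ofReal_mul (by positivity)]
  refine ENNReal.ofReal_le_ofReal ?_
  unfold screenedConst
  set S := ((volume : Measure (Space n)).toSphere univ).toReal
  have hS0 : 0 ≤ S := ENNReal.toReal_nonneg
  have hmax : (κ - Λ)⁻¹ ≤ 2 * max 1 l⁻¹ := by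
    have h1 : (κ - Λ)⁻¹ ≤ (min 1 l / 2)⁻¹ := inv_anti₀ (by positivity) (by linarith [hκ.1])
    refine h1.trans ?_
    rw [inv_div, div_eq_mul_inv]
    rcases le_total 1 l with hh | hh
    · rw [min_eq_left hh, inv_one]; gcongr; exact le_max_left _ _
    · rw [min_eq_right hh]; gcongr; exact le_max_right _ _
  have hL1 : 1 ≤ (1 + L) ^ p := Real.one_le_rpow (by linarith) (by linarith)
  have hx1 : 1 ≤ max 1 l⁻¹ := le_max_left _ _
  rw [Real.mul_rpow (by norm_num) (by linarith)]
  have e : max 1 l⁻¹ * (1 + L) ^ p * (3 ^ p * (2 * (2 ^ p * (p / (p - 1)) ^ p) + 2) * S) =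
      3 ^ p * (2 * ((max 1 l⁻¹ * (2 ^ p * (1 + L) ^ p)) * (p / (p - 1)) ^ p) +
        (1 + L) ^ p * (2 * max 1 l⁻¹)) * S := by ring
  rw [e]
  have h1 : 2 ^ p * (1 + L) ^ p ≤ max 1 l⁻¹ * (2 ^ p * (1 + L) ^ p) :=
    le_mul_of_one_le_left (mul_nonneg (by positivity) (by linarith)) hx1
  have h2 : (κ - Λ)⁻¹ ≤ (1 + L) ^ p * (2 * max 1 l⁻¹) :=
    hmax.trans (le_mul_of_one_le_left (by positivity) hL1)
  exact mul_le_mul_of_nonneg_right (mul_le_mul_of_nonneg_left (add_le_add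
    (mul_le_mul_of_nonneg_left (mul_le_mul_of_nonneg_right h1 (by positivity)) (by norm_num)) h2)
    (by positivity)) hS0

variable {ηm ηp fm fp : Space n → ℝ} {u : Space (n + 1) → ℝ} {G : Space (n + 1) → Space (n + 1)}

/-- This is where the screening radius is used. The horizontal leg clears its own graph because `κ >
Λ`. It clears the opposite graph because `κ` plus the other Lipschitz constant is less than `L + min
1 l ≤ 2 l`, where `L` is the sum of both constants, while the width over `x` exceeds `2 l ‖v‖`. -/
theorem IsVertTrace.screenedEnergy_le (hn : 1 ≤ n) {p : ℝ} (hp : 1 < p)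
    (hm : ∃ K : ℝ≥0, LipschitzWith K ηm) (hp' : ∃ K : ℝ≥0, LipschitzWith K ηp) (hG : Measurable G)
    (h : ∀ e, HasWeakDir (graphDomain ηm ηp) e u fun z => inner ℝ e (G z)) {e : Space (n + 1)}
    (he : ‖e‖ ≤ 1) (ht : IsVertTrace ηm ηp u (fun z => inner ℝ e (G z)) fm fp)
    (hfm : Measurable fm) (hfp : Measurable fp) {l : ℝ} (hl : 0 < l)
    (hL : lipSeminorm ηm + lipSeminorm ηp ≤ l) :
    screenedEnergy p (fun x => (ηp x - ηm x) / (2 * l)) fm ≤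
        ENNReal.ofReal (max 1 l⁻¹ * (1 + (lipSeminorm ηm + lipSeminorm ηp)) ^ p *
          screenedConst n p) * ∫⁻ z in graphDomain ηm ηp, ‖G z‖ₑ ^ p ∧
      screenedEnergy p (fun x => (ηp x - ηm x) / (2 * l)) fp ≤
        ENNReal.ofReal (max 1 l⁻¹ * (1 + (lipSeminorm ηm + lipSeminorm ηp)) ^ p *
          screenedConst n p) * ∫⁻ z in graphDomain ηm ηp, ‖G z‖ₑ ^ p := by
  have hcm : Continuous ηm := hm.elim fun K h => h.continuous
  have hcp : Continuous ηp := hp'.elim fun K h => h.continuous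
  have hmm := hcm.measurable
  have hmp := hcp.measurable
  have hV := ht.vertBound he
  have lm := abs_sub_le_lipSeminorm hm
  have lp := abs_sub_le_lipSeminorm hp'
  have m0 := lipSeminorm_nonneg ηm
  have p0 := lipSeminorm_nonneg ηp
  have hθ : ∀ (v : Space n) (θ : ℝ), θ ∈ Icc (0 : ℝ) 1 → ‖θ • v‖ ≤ ‖v‖ := fun v θ hθ => by
    rw [norm_smul, Real.norm_of_nonneg hθ.1]
    exact mul_le_of_le_one_left (norm_nonneg _) hθ.2
  have width : ∀ x (v : Space n), ‖v‖ < (ηp x - ηm x) / (2 * l) → 2 * l * ‖v‖ < ηp x - ηm x :=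
    fun x v hv => by rwa [lt_div_iff₀ (by positivity), mul_comm] at hv
  have hml : min 1 l ≤ l := min_le_right _ _
  constructor
  · refine screenedEnergy_le_screenedConst hn hp (isOpen_graphDomain hcm hcp) hG h hcm lm m0
      (by linarith) hl (by norm_num) hfm (by fun_prop) hV.1 fun x v hv hvσ κ hκ1 hκ2 θ hθI => ?_
    have hv' := norm_pos_iff.2 hv
    have w := width x v hvσ
    have a1 := abs_le.1 (lm (x + θ • v) x)
    have a2 := abs_le.1 (lp (x + θ • v) x)
    rw [dist_eq_norm, add_sub_cancel_left] at a1 a2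
    have b1 := mul_le_mul_of_nonneg_left (hθ v θ hθI) m0
    have b2 := mul_le_mul_of_nonneg_left (hθ v θ hθI) p0
    rw [join_mem_graphDomain]
    constructor
    · nlinarith
    · nlinarith
  · refine screenedEnergy_le_screenedConst hn hp (isOpen_graphDomain hcm hcp) hG h hcp lp p0
      (by linarith) hl (by norm_num) hfp (by fun_prop) hV.2 fun x v hv hvσ κ hκ1 hκ2 θ hθI => ?_
    have hv' := norm_pos_iff.2 hv
    have w := width x v hvσ
    have a1 := abs_le.1 (lm (x + θ • v) x)
    have a2 := abs_le.1 (lp (x + θ • v) x)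
    rw [dist_eq_norm, add_sub_cancel_left] at a1 a2
    have b1 := mul_le_mul_of_nonneg_left (hθ v θ hθI) m0
    have b2 := mul_le_mul_of_nonneg_left (hθ v θ hθI) p0
    rw [join_mem_graphDomain]
    constructor
    · nlinarith
    · nlinarith

/-- A function with finite screened energy is locally in `L^p`. -/
theorem memLp_of_screenedEnergy_ne_top {p : ℝ} (hp : 1 < p) (hn : 1 ≤ n) {σ f : Space n → ℝ}
    (hσ : Continuous σ)
    (hσ0 : ∀ x, 0 < σ x) (hf : Measurable f) (hfin : screenedEnergy p σ f ≠ ⊤) {K : Set (Space n)}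
    (hK : IsCompact K) : MemLp f (ENNReal.ofReal p) (volume.restrict K) := by
  have hp0 : 0 < p := by linarith
  have hp' : ENNReal.ofReal p ≠ 0 := (ENNReal.ofReal_pos.2 hp0).ne'
  have key : ∀ x₀, ∃ r > 0, ∫⁻ x in Metric.ball x₀ r, ‖f x‖ₑ ^ p < ⊤ := by
    intro x₀
    have hev : ∀ᶠ x in 𝓝 x₀, σ x₀ / 2 < σ x :=
      hσ.continuousAt.eventually (lt_mem_nhds (by linarith [hσ0 x₀]))
    obtain ⟨r₀, hr₀, hball⟩ := Metric.eventually_nhds_iff_ball.1 hev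
    -- On this ball `σ` exceeds `σ x₀ / 2 ≥ 2 r`, so any two of its points are within the screening
    -- radius of each other.
    set r := min r₀ (σ x₀ / 4) with hr
    have hr0 : 0 < r := lt_min hr₀ (by linarith [hσ0 x₀])
    have hrσ : ∀ x ∈ Metric.ball x₀ r, 2 * r < σ x := fun x hx => by
      have := hball x (Metric.ball_subset_ball (min_le_left _ _) hx)
      linarith [min_le_right r₀ (σ x₀ / 4)]
    refine ⟨r, hr0, ?_⟩
    set b := Metric.ball x₀ r with hb
    -- For increments of length below `2 r` the kernel is at least `D⁻¹`, so the energy controls the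
    -- unweighted oscillation.
    set D : ℝ≥0∞ := ENNReal.ofReal (2 * r) ^ (p + ((n : ℝ) + 1) - 2) with hD
    have hexp : 0 < p + ((n : ℝ) + 1) - 2 := by
      have : (1 : ℝ) ≤ n := by exact_mod_cast hn
      linarith
    have hD0 : D ≠ ⊤ := ENNReal.rpow_ne_top_of_nonneg hexp.le ENNReal.ofReal_ne_top
    have h1 : ∀ x ∈ b, ∫⁻ y in b, ‖f y - f x‖ₑ ^ p ≤
        D * ∫⁻ h in Metric.ball (0 : Space n) (σ x),
          ‖f (x + h) - f x‖ₑ ^ p / ‖h‖ₑ ^ (p + ((n : ℝ) + 1) - 2) := by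
      intro x hx
      rw [← lintegral_const_mul' _ _ hD0, ← lintegral_indicator Metric.isOpen_ball.measurableSet,
        ← lintegral_indicator Metric.isOpen_ball.measurableSet,
        ← lintegral_add_left_eq_self (b.indicator _) x]
      refine lintegral_mono fun h => ?_
      by_cases hxh : x + h ∈ b
      · have hh : ‖h‖ < 2 * r := by
          have h2 : dist (x + h) x < r + r :=
            (dist_triangle_right _ _ x₀).trans_lt (add_lt_add hxh hx)
          rw [dist_eq_norm, add_sub_cancel_left] at h2
          linarith
        rw [indicator_of_mem hxh, indicator_of_mem
          (by rw [Metric.mem_ball, dist_zero_right]; exact hh.trans (hrσ x hx))]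
        by_cases h0 : h = 0
        · subst h0
          simp [hp0]
        · have hpos : 0 < ‖h‖ₑ := enorm_pos.2 h0
          rw [← mul_div_assoc, mul_comm,
            ENNReal.le_div_iff_mul_le (Or.inl (ENNReal.rpow_pos hpos enorm_ne_top).ne')
              (Or.inl (ENNReal.rpow_ne_top_of_nonneg hexp.le enorm_ne_top))]
          refine mul_le_mul_right ?_ _
          refine ENNReal.rpow_le_rpow ?_ hexp.le
          rw [← ofReal_norm]
          exact ENNReal.ofReal_le_ofReal hh.le
      · rw [indicator_of_notMem hxh]
        exact zero_le
    have hmeas : Measurable fun x => ∫⁻ h in Metric.ball (0 : Space n) (σ x),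
          ‖f (x + h) - f x‖ₑ ^ p / ‖h‖ₑ ^ (p + ((n : ℝ) + 1) - 2) := by
      have hs : MeasurableSet {q : Space n × Space n | ‖q.2‖ < σ q.1} :=
        measurableSet_lt (by fun_prop) (by fun_prop)
      have := Measurable.lintegral_prod_right' (ν := (volume : Measure (Space n)))
        (f := {q : Space n × Space n | ‖q.2‖ < σ q.1}.indicator fun q : Space n × Space n =>
          ‖f (q.1 + q.2) - f q.1‖ₑ ^ p / ‖q.2‖ₑ ^ (p + ((n : ℝ) + 1) - 2))
        (Measurable.indicator (by fun_prop) hs)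
      convert! this using 2 with x
      rw [← lintegral_indicator Metric.isOpen_ball.measurableSet]
      refine lintegral_congr fun h => ?_
      simp only [indicator, Metric.mem_ball, dist_zero_right, mem_ofPred_eq]
    have hae := ae_lt_top hmeas hfin
    have hvol : volume b ≠ 0 := (Metric.measure_ball_pos volume x₀ hr0).ne'
    -- One point `x` of the ball with finite inner integral is enough: there `f` is the sum of `f -
    -- f x`, which is in `L^p` of the ball, and a constant.
    obtain ⟨x, hxb, hx⟩ := ((frequently_ae_mem_iff.2 hvol).and_eventually hae).exists
    have hlt : ∫⁻ y in b, ‖f y - f x‖ₑ ^ p < ⊤ :=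
      (h1 x hxb).trans_lt (ENNReal.mul_lt_top hD0.lt_top hx)
    calc ∫⁻ y in b, ‖f y‖ₑ ^ p
        ≤ ∫⁻ y in b, 2 ^ (p - 1) * (‖f y - f x‖ₑ ^ p + ‖f x‖ₑ ^ p) := by
          refine lintegral_mono fun y => ?_
          refine le_trans (ENNReal.rpow_le_rpow ?_ hp0.le)
            (ENNReal.rpow_add_le_mul_rpow_add_rpow _ _ hp.le)
          simpa using enorm_add_le (f y - f x) (f x)
      _ < ⊤ := by
          have h2 : (2 : ℝ≥0∞) ^ (p - 1) ≠ ⊤ :=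
            ENNReal.rpow_ne_top_of_nonneg (by linarith) (by simp)
          rw [lintegral_const_mul' _ _ h2, lintegral_add_right _ measurable_const,
            setLIntegral_const]
          refine ENNReal.mul_lt_top h2.lt_top (ENNReal.add_lt_top.2 ⟨hlt, ENNReal.mul_lt_top
            (ENNReal.rpow_lt_top_of_nonneg hp0.le enorm_ne_top) measure_ball_lt_top⟩)
  refine ⟨hf.aestronglyMeasurable, ?_⟩
  rw [eLpNorm_lt_top_iff_lintegral_rpow_enorm_lt_top hp' ENNReal.ofReal_ne_top,
    ENNReal.toReal_ofReal hp0.le]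
  refine hK.induction_on (p := fun s => ∫⁻ x in s, ‖f x‖ₑ ^ p < ⊤) (by simp)
    (fun s t hst ht => (lintegral_mono_set hst).trans_lt ht)
    (fun s t hs ht => (lintegral_union_le _ _ _).trans_lt (ENNReal.add_lt_top.2 ⟨hs, ht⟩))
    fun x _ => ?_
  obtain ⟨r, hr, hlt⟩ := key x
  exact ⟨Metric.ball x r, mem_nhdsWithin_of_mem_nhds (Metric.ball_mem_nhds x hr), hlt⟩

end ScreenedTrace

end StripTrace

end

noncomputable section

namespace StripTrace

/-! ### Uniqueness and linearity of the vertical boundary values -/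

section TraceAlgebra

variable {n : ℕ} {ηm ηp fm fp fm' fp' : Space n → ℝ} {u u' g g' : Space (n + 1) → ℝ}

theorem continuousOn_primitive_Icc {G : ℝ → ℝ} {a b : ℝ} (hab : a < b)
    (hG : IntegrableOn G (Ioo a b)) (c : ℝ) :
    ContinuousOn (fun t => c + ∫ s in a..t, G s) (Icc a b) := by
  have h : IntegrableOn G (uIcc a b) := by
    rwa [uIcc_of_le hab.le, integrableOn_Icc_iff_integrableOn_Ioo]
  have := intervalIntegral.continuousOn_primitive_interval h
  rw [uIcc_of_le hab.le] at this
  exact continuousOn_const.add this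

/-- Two continuous functions on a closed interval that agree a.e. also agree at the endpoints. This
gives both the agreement with continuous representatives and the independence of the trace from all
choices. -/
theorem IsVertTrace.boundary_values (hlt : ∀ x, ηm x < ηp x) (h : IsVertTrace ηm ηp u g fm fp) :
    ∀ᵐ x, ∀ φ : ℝ → ℝ, ContinuousOn φ (Icc (ηm x) (ηp x)) →
      (∀ᵐ t ∂volume.restrict (Ioo (ηm x) (ηp x)), u (join x t) = φ t) →
      fm x = φ (ηm x) ∧ fp x = φ (ηp x) := by
  filter_upwards [h] with x hx φ hφ hu
  have hW := continuousOn_primitive_Icc (hlt x) hx.1 (fm x)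
  have hae : (fun t => fm x + ∫ s in ηm x..t, g (join x s)) =ᵐ[volume.restrict
      (Icc (ηm x) (ηp x))] φ := by
    rw [← Measure.restrict_congr_set Ioo_ae_eq_Icc]
    filter_upwards [hx.2.1, hu] with t h1 h2
    rw [← h1, h2]
  have heq := Measure.eqOn_Icc_of_ae_eq volume (hlt x).ne hae hW hφ
  have e1 := heq (left_mem_Icc.2 (hlt x).le)
  have e2 := heq (right_mem_Icc.2 (hlt x).le)
  simp only [intervalIntegral.integral_same, add_zero] at e1 e2
  exact ⟨e1, hx.2.2.trans e2⟩

theorem IsVertTrace.ae_eq (hm : Continuous ηm) (hp : Continuous ηp) (hlt : ∀ x, ηm x < ηp x)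
    (h : IsVertTrace ηm ηp u g fm fp) (h' : IsVertTrace ηm ηp u' g' fm' fp')
    (hu : u =ᵐ[volume.restrict (graphDomain ηm ηp)] u') : fm =ᵐ[volume] fm' ∧ fp =ᵐ[volume] fp' := by
  have key : ∀ᵐ x, fm x = fm' x ∧ fp x = fp' x := by
    filter_upwards [h.boundary_values hlt, h', ae_graphDomain_iff hm hp hu] with x h1 h2 h3
    have := h1 _ (continuousOn_primitive_Icc (hlt x) h2.1 (fm' x)) (by
      filter_upwards [h2.2.1, h3] with t k1 k2
      rw [k2, k1])
    simp only [intervalIntegral.integral_same, add_zero] at this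
    exact ⟨this.1, this.2.trans h2.2.2.symm⟩
  exact ⟨key.mono fun x hx => hx.1, key.mono fun x hx => hx.2⟩

theorem IsVertTrace.add (h : IsVertTrace ηm ηp u g fm fp) (hlt : ∀ x, ηm x < ηp x)
    (h' : IsVertTrace ηm ηp u' g' fm' fp') :
    IsVertTrace ηm ηp (fun z => u z + u' z) (fun z => g z + g' z) (fun x => fm x + fm' x)
      (fun x => fp x + fp' x) := by
  filter_upwards [h, h'] with x h1 h2
  have hi : ∀ t ∈ Icc (ηm x) (ηp x), ∫ s in ηm x..t, (g (join x s) + g' (join x s)) =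
      (∫ s in ηm x..t, g (join x s)) + ∫ s in ηm x..t, g' (join x s) := fun t ht =>
    intervalIntegral.integral_add
      (intervalIntegrable_of_integrableOn_Ioo h1.1 (left_mem_Icc.2 (hlt x).le) ht)
      (intervalIntegrable_of_integrableOn_Ioo h2.1 (left_mem_Icc.2 (hlt x).le) ht)
  refine ⟨h1.1.add h2.1, ?_, ?_⟩
  · filter_upwards [h1.2.1, h2.2.1, ae_restrict_mem measurableSet_Ioo] with t k1 k2 ht
    rw [hi t (Ioo_subset_Icc_self ht), k1, k2]
    ring
  · rw [hi _ (right_mem_Icc.2 (hlt x).le), h1.2.2, h2.2.2]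
    ring

theorem IsVertTrace.const_mul (h : IsVertTrace ηm ηp u g fm fp) (c : ℝ) :
    IsVertTrace ηm ηp (fun z => c * u z) (fun z => c * g z) (fun x => c * fm x)
      (fun x => c * fp x) := by
  filter_upwards [h] with x h1
  refine ⟨h1.1.const_mul c, ?_, ?_⟩
  · filter_upwards [h1.2.1] with t k1
    rw [intervalIntegral.integral_const_mul, k1]
    ring
  · rw [intervalIntegral.integral_const_mul, h1.2.2]
    ring

/-- Hölder's inequality on a segment of length `ηp x - ηm x` produces exactly the weight of the
estimate, with constant 1. -/
theorem IsVertTrace.difference_bound (hm : Continuous ηm) (hp : Continuous ηp)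
    (hlt : ∀ x, ηm x < ηp x) (h : IsVertTrace ηm ηp u g fm fp) (hg : Measurable g) {p : ℝ}
    (h1p : 1 < p) :
    ∫⁻ x, ‖fp x - fm x‖ₑ ^ p / ENNReal.ofReal ((ηp x - ηm x) ^ (p - 1)) ≤
      ∫⁻ z in graphDomain ηm ηp, ‖g z‖ₑ ^ p := by
  rw [lintegral_graphDomain hm hp (by fun_prop)]
  refine lintegral_mono_ae ?_
  filter_upwards [h] with x hx
  have hpos : 0 < ηp x - ηm x := sub_pos.2 (hlt x)
  have h1 : ‖fp x - fm x‖ₑ ≤ ∫⁻ t in Ioo (ηm x) (ηp x), ‖g (join x t)‖ₑ := by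
    rw [hx.2.2, add_sub_cancel_left, intervalIntegral.integral_of_le (hlt x).le,
      integral_Ioc_eq_integral_Ioo]
    exact enorm_integral_le_lintegral_enorm _
  have h2 := lintegral_rpow_le_measure_univ (volume.restrict (Ioo (ηm x) (ηp x))) h1p
    (G := fun t => ‖g (join x t)‖ₑ) (by fun_prop)
  rw [Measure.restrict_apply_univ, Real.volume_Ioo, ENNReal.ofReal_rpow_of_pos hpos] at h2
  refine ENNReal.div_le_of_le_mul' ?_
  exact (ENNReal.rpow_le_rpow h1 (by linarith)).trans h2

theorem isFiniteMeasure_graphDomain_inter (hm : Continuous ηm) (hp : Continuous ηp)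
    {K : Set (Space n)} (hK : IsCompact K) :
    volume (graphDomain ηm ηp ∩ horiz ⁻¹' K) < ⊤ := by
  obtain ⟨a, ha⟩ := (hK.image hm).bddBelow
  obtain ⟨b, hb⟩ := (hK.image hp).bddAbove
  have hc : IsCompact ((fun q : Space n × ℝ => join q.1 q.2) '' (K ×ˢ Icc a b)) :=
    (hK.prod isCompact_Icc).image (by fun_prop)
  refine (measure_mono ?_).trans_lt hc.measure_lt_top
  rintro z ⟨hz, hzK⟩
  refine ⟨(horiz z, vert z), ⟨hzK, (ha ⟨_, hzK, rfl⟩).trans hz.1.le,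
    hz.2.le.trans (hb ⟨_, hzK, rfl⟩)⟩, join_horiz_vert z⟩

theorem integrableOverCompacts_of_memLp (hm : Continuous ηm) (hp : Continuous ηp) {q : ℝ≥0∞}
    (hq : 1 ≤ q) (hg : MemLp g q (volume.restrict (graphDomain ηm ηp))) :
    IntegrableOverCompacts ηm ηp g := by
  intro K hK
  have : IsFiniteMeasure (volume.restrict (graphDomain ηm ηp ∩ horiz ⁻¹' K)) :=
    ⟨by simpa using isFiniteMeasure_graphDomain_inter hm hp hK⟩
  exact (hg.mono_measure (Measure.restrict_mono_set _ inter_subset_left)).integrable hq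

end TraceAlgebra

/-! ### Integration and normal vector on the boundary -/

section Boundary

variable {n : ℕ} {ηm ηp : Space n → ℝ} {Km Kp : ℝ≥0}

/-- The surface measure on the boundary of `graphDomain ηm ηp`. -/
abbrev boundaryMeasure (ηm ηp : Space n → ℝ) : Measure (Space (n + 1)) :=
  (Measure.euclideanHausdorffMeasure n).restrict (frontier (graphDomain ηm ηp))

theorem areaDensity_le {η : Space n → ℝ} {K : ℝ≥0} (hη : LipschitzWith K η) (x : Space n) :
    areaDensity η x ≤ 1 + K := by
  have h1 : ‖∇ η x‖ ≤ K := by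
    rw [gradient, LinearIsometryEquiv.norm_map]
    exact norm_fderiv_le_of_lipschitz ℝ hη
  refine Real.sqrt_le_iff.2 ⟨by positivity, ?_⟩
  nlinarith [norm_nonneg (∇ η x), K.coe_nonneg, mul_self_le_mul_self (norm_nonneg (∇ η x)) h1]

theorem lintegral_frontier_graphDomain (hm : LipschitzWith Km ηm) (hp : LipschitzWith Kp ηp)
    (hlt : ∀ x, ηm x < ηp x) {F : Space (n + 1) → ℝ≥0∞} (hF : Measurable F) :
    ∫⁻ z, F z ∂boundaryMeasure ηm ηp = (∫⁻ x, ENNReal.ofReal (areaDensity ηp x) * F (graphMap ηp x)) +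
      ∫⁻ x, ENNReal.ofReal (areaDensity ηm x) * F (graphMap ηm x) := by
  have key : ∀ {η : Space n → ℝ}, Continuous η → ∫⁻ z, F z ∂((areaMeasure η).map (graphMap η)) =
      ∫⁻ x, ENNReal.ofReal (areaDensity η x) * F (graphMap η x) := by
    intro η hη
    have hgm := (continuous_graphMap hη).measurable
    rw [lintegral_map hF hgm, areaMeasure, lintegral_withDensity_eq_lintegral_mul _
      (measurable_areaDensity η).ennreal_ofReal (by fun_prop)]
    rfl
  rw [boundaryMeasure, restrict_frontier_graphDomain hm hp hlt, lintegral_add_measure, key hm.continuous,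
    key hp.continuous]

theorem integral_frontier_graphDomain (hm : LipschitzWith Km ηm) (hp : LipschitzWith Kp ηp)
    (hlt : ∀ x, ηm x < ηp x) {F : Space (n + 1) → ℝ}
    (h1 : Integrable fun x => areaDensity ηp x * F (graphMap ηp x))
    (h2 : Integrable fun x => areaDensity ηm x * F (graphMap ηm x)) :
    Integrable F (boundaryMeasure ηm ηp) ∧ ∫ z, F z ∂boundaryMeasure ηm ηp = (∫ x, areaDensity ηp x * F (graphMap ηp x)) +
      ∫ x, areaDensity ηm x * F (graphMap ηm x) := by
  have key : ∀ {η : Space n → ℝ}, Continuous η →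
      Integrable (fun x => areaDensity η x * F (graphMap η x)) →
      Integrable F ((areaMeasure η).map (graphMap η)) ∧
      ∫ z, F z ∂((areaMeasure η).map (graphMap η)) =
        ∫ x, areaDensity η x * F (graphMap η x) := by
    intro η hη hi
    have hE := measurableEmbedding_graphMap hη
    have hd : Measurable fun x => (areaDensity η x).toNNReal :=
      (measurable_areaDensity η).real_toNNReal
    have hpos : ∀ x, ((areaDensity η x).toNNReal : ℝ) = areaDensity η x := fun x =>
      Real.coe_toNNReal _ (zero_le_one.trans (one_le_areaDensity η x))
    have harea : areaMeasure η = volume.withDensity fun x =>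
        (((areaDensity η x).toNNReal : ℝ≥0) : ℝ≥0∞) := rfl
    rw [hE.integrable_map_iff, hE.integral_map, harea,
      integrable_withDensity_iff_integrable_smul hd, integral_withDensity_eq_integral_smul hd]
    simp only [NNReal.smul_def, hpos, smul_eq_mul, Function.comp_apply]
    exact ⟨hi, trivial⟩
  have k1 := key hp.continuous h1
  have k2 := key hm.continuous h2
  rw [boundaryMeasure, restrict_frontier_graphDomain hm hp hlt]
  exact ⟨k1.1.add_measure k2.1, by rw [integral_add_measure k1.1 k2.1, k1.2, k2.2]⟩

open Classical in
/-- The function with the values `fp` on the graph of `ηp` and `fm` elsewhere. -/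
def boundaryFun (ηp fm fp : Space n → ℝ) (z : Space (n + 1)) : ℝ :=
  if vert z = ηp (horiz z) then fp (horiz z) else fm (horiz z)

theorem boundaryFun_graphMap_top (ηp fm fp : Space n → ℝ) (x : Space n) :
    boundaryFun ηp fm fp (graphMap ηp x) = fp x := by
  simp [boundaryFun]

theorem boundaryFun_graphMap_bot (hlt : ∀ x, ηm x < ηp x) (fm fp : Space n → ℝ) (x : Space n) :
    boundaryFun ηp fm fp (graphMap ηm x) = fm x := by
  simp [boundaryFun, (hlt x).ne]

theorem measurable_boundaryFun {fm fp : Space n → ℝ} (hp : Continuous ηp) (hfm : Measurable fm)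
    (hfp : Measurable fp) : Measurable (boundaryFun ηp fm fp) := by
  have hpm := hp.measurable
  refine Measurable.ite (measurableSet_eq_fun (by fun_prop) (by fun_prop)) (by fun_prop)
    (by fun_prop)

/-- A compact subset of the boundary projects to a compact set of the base, and the area density is
bounded by the Lipschitz constant plus 1. -/
theorem memLp_boundaryFun (hm : LipschitzWith Km ηm) (hp : LipschitzWith Kp ηp)
    (hlt : ∀ x, ηm x < ηp x) {fm fp : Space n → ℝ} (hfm : Measurable fm) (hfp : Measurable fp)
    {p : ℝ} (hp0 : 0 < p)
    (hm' : ∀ K : Set (Space n), IsCompact K → MemLp fm (ENNReal.ofReal p) (volume.restrict K))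
    (hp' : ∀ K : Set (Space n), IsCompact K → MemLp fp (ENNReal.ofReal p) (volume.restrict K))
    {K : Set (Space (n + 1))} (hK : IsCompact K) (hKf : K ⊆ frontier (graphDomain ηm ηp)) :
    MemLp (boundaryFun ηp fm fp) (ENNReal.ofReal p)
      ((Measure.euclideanHausdorffMeasure n).restrict K) := by
  have hpe : ENNReal.ofReal p ≠ 0 := (ENNReal.ofReal_pos.2 hp0).ne'
  have hbm := measurable_boundaryFun hp.continuous hfm hfp
  refine ⟨hbm.aestronglyMeasurable, ?_⟩
  rw [eLpNorm_lt_top_iff_lintegral_rpow_enorm_lt_top hpe ENNReal.ofReal_ne_top,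
    ENNReal.toReal_ofReal hp0.le]
  set S : Set (Space n) := horiz '' K
  have hS : IsCompact S := hK.image continuous_horiz
  have hSm : MeasurableSet (horiz ⁻¹' S : Set (Space (n + 1))) := measurable_horiz hS.measurableSet
  have piece : ∀ {η f : Space n → ℝ} {C : ℝ≥0}, LipschitzWith C η →
      (∀ x, boundaryFun ηp fm fp (graphMap η x) = f x) →
      MemLp f (ENNReal.ofReal p) (volume.restrict S) →
      ∫⁻ x, ENNReal.ofReal (areaDensity η x) *
        (horiz ⁻¹' S).indicator (fun z => ‖boundaryFun ηp fm fp z‖ₑ ^ p) (graphMap η x) < ⊤ := by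
    intro η f C hη hf hfL
    have hfin := (eLpNorm_lt_top_iff_lintegral_rpow_enorm_lt_top hpe ENNReal.ofReal_ne_top).1 hfL.2
    rw [ENNReal.toReal_ofReal hp0.le, ← lintegral_indicator hS.measurableSet] at hfin
    refine lt_of_le_of_lt ?_ (ENNReal.mul_lt_top (ENNReal.ofReal_lt_top (r := 1 + C)) hfin)
    rw [← lintegral_const_mul' _ _ ENNReal.ofReal_ne_top]
    refine lintegral_mono fun x => mul_le_mul' (ENNReal.ofReal_le_ofReal (areaDensity_le hη x)) ?_
    by_cases hx : x ∈ S
    · rw [indicator_of_mem (by simpa using hx), indicator_of_mem hx, hf]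
    · rw [indicator_of_notMem (by simpa using hx)]
      exact zero_le
  calc ∫⁻ z in K, ‖boundaryFun ηp fm fp z‖ₑ ^ p ∂(Measure.euclideanHausdorffMeasure n)
      = ∫⁻ z in K, ‖boundaryFun ηp fm fp z‖ₑ ^ p ∂boundaryMeasure ηm ηp := by
        rw [Measure.restrict_restrict hK.measurableSet, inter_eq_left.2 hKf]
    _ ≤ ∫⁻ z in horiz ⁻¹' S, ‖boundaryFun ηp fm fp z‖ₑ ^ p ∂boundaryMeasure ηm ηp :=
        lintegral_mono_set (subset_preimage_image _ _)
    _ = ∫⁻ z, (horiz ⁻¹' S).indicator (fun z => ‖boundaryFun ηp fm fp z‖ₑ ^ p) z ∂boundaryMeasure ηm ηp :=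
        (lintegral_indicator hSm _).symm
    _ < ⊤ := by
        rw [lintegral_frontier_graphDomain hm hp hlt (Measurable.indicator (by fun_prop) hSm)]
        exact ENNReal.add_lt_top.2 ⟨piece hp (boundaryFun_graphMap_top ηp fm fp) (hp' S hS),
          piece hm (boundaryFun_graphMap_bot hlt fm fp) (hm' S hS)⟩

theorem inner_gradient_eq_fderiv {η : Space n → ℝ} (x v : Space n) :
    inner ℝ (∇ η x) v = fderiv ℝ η x v := by
  rw [gradient, InnerProductSpace.toDual_symm_apply]

/-- The area density cancels the normalization of the normal vector, which identifies the boundary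
terms of the integration by parts with surface integrals. On the lower graph the outward direction
brings a minus sign. -/
theorem areaDensity_mul_outerNormal_top (ηm ηp : Space n → ℝ) (x : Space n) (i : Fin (n + 1)) :
    areaDensity ηp x * outerNormal ηm ηp (graphMap ηp x) i =
      conormal ηp (EuclideanSpace.single i 1) x := by
  have h0 : areaDensity ηp x ≠ 0 := (zero_lt_one.trans_le (one_le_areaDensity ηp x)).ne'
  have h1 : outerNormal ηm ηp (graphMap ηp x) = (areaDensity ηp x)⁻¹ • join (-∇ ηp x) 1 := by
    simp [outerNormal, areaDensity]
  rw [h1, PiLp.smul_apply, smul_eq_mul, mul_inv_cancel_left₀ h0, conormal]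
  refine Fin.lastCases ?_ (fun j => ?_) i
  · simp [single_last_eq_join]
  · rw [single_castSucc_eq_join, vert_join, horiz_join, ← inner_gradient_eq_fderiv,
      EuclideanSpace.inner_single_right]
    simp

theorem areaDensity_mul_outerNormal_bot (hlt : ∀ x, ηm x < ηp x) (x : Space n) (i : Fin (n + 1)) :
    areaDensity ηm x * outerNormal ηm ηp (graphMap ηm x) i =
      - conormal ηm (EuclideanSpace.single i 1) x := by
  have h0 : areaDensity ηm x ≠ 0 := (zero_lt_one.trans_le (one_le_areaDensity ηm x)).ne'
  have h1 : outerNormal ηm ηp (graphMap ηm x) = (areaDensity ηm x)⁻¹ • join (∇ ηm x) (-1) := by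
    simp [outerNormal, areaDensity, (hlt x).ne]
  rw [h1, PiLp.smul_apply, smul_eq_mul, mul_inv_cancel_left₀ h0, conormal]
  refine Fin.lastCases ?_ (fun j => ?_) i
  · simp [single_last_eq_join]
  · rw [single_castSucc_eq_join, vert_join, horiz_join, ← inner_gradient_eq_fderiv,
      EuclideanSpace.inner_single_right]
    simp

/-- The last component is `±1` over the square root at every point, also where the gradient has only
its default value. This makes the trace recoverable from vertical integration by parts. -/
theorem outerNormal_last_ne_zero (ηm ηp : Space n → ℝ) (z : Space (n + 1)) :
    outerNormal ηm ηp z (Fin.last n) ≠ 0 := by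
  have h : ∀ a : Space n, (√(1 + ‖a‖ ^ 2))⁻¹ ≠ 0 := fun a =>
    inv_ne_zero (Real.sqrt_pos.2 (by positivity)).ne'
  unfold outerNormal
  split_ifs
  · simpa using h _
  · simpa using h _

end Boundary

end StripTrace

end

noncomputable section

namespace StripTrace

/-! ### Boundary values of Sobolev functions -/

section TraceData

variable {n : ℕ} {p : ℝ} {ηm ηp : Space n → ℝ}

/-- `fm` and `fp` are the boundary values of `u` on the two graphs, and `G` is a measurable
representative of the weak gradient of `u`. -/
structure IsTraceData (u : HomSobolev (ENNReal.ofReal p) (graphDomain ηm ηp))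
    (G : Space (n + 1) → Space (n + 1)) (fm fp : Space n → ℝ) : Prop where
  measurable_grad : Measurable G
  ae_eq : G =ᵐ[volume.restrict (graphDomain ηm ηp)] weakGrad u
  measurable_bot : Measurable fm
  measurable_top : Measurable fp
  isVertTrace : IsVertTrace ηm ηp u.1
    (fun z => inner ℝ (EuclideanSpace.single (Fin.last n) 1) (G z)) fm fp

theorem hasWeakDir_of_ae_eq_weakGrad {u : HomSobolev (ENNReal.ofReal p) (graphDomain ηm ηp)}
    {G : Space (n + 1) → Space (n + 1)}
    (h : G =ᵐ[volume.restrict (graphDomain ηm ηp)] weakGrad u) (e : Space (n + 1)) :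
    HasWeakDir (graphDomain ηm ηp) e u.1 fun z => inner ℝ e (G z) := by
  refine (HasWeakPartial.hasWeakDir (weakGrad_spec u).2 e).congr_right ?_
  filter_upwards [h] with z hz
  rw [hz]

theorem inner_single_eq (i : Fin (n + 1)) (v : Space (n + 1)) :
    inner ℝ (EuclideanSpace.single i 1) v = v i := by
  rw [EuclideanSpace.inner_single_left]
  simp

theorem lintegral_rpow_lt_top {q : ℝ} (hq : 0 < q) {α E : Type*} [MeasurableSpace α]
    [NormedAddCommGroup E] {μ : Measure α} {f : α → E} (hf : MemLp f (ENNReal.ofReal q) μ) :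
    ∫⁻ a, ‖f a‖ₑ ^ q ∂μ < ⊤ := by
  have := (eLpNorm_lt_top_iff_lintegral_rpow_enorm_lt_top (ENNReal.ofReal_pos.2 hq).ne'
    ENNReal.ofReal_ne_top).1 hf.2
  rwa [ENNReal.toReal_ofReal hq.le] at this

/-- The chosen weak gradient is only a.e. strongly measurable, so it is replaced by a measurable
representative before slicing. -/
theorem exists_isTraceData (hp : 1 < p) (hm : Continuous ηm) (hp' : Continuous ηp)
    (hlt : ∀ x, ηm x < ηp x) (u : HomSobolev (ENNReal.ofReal p) (graphDomain ηm ηp)) :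
    ∃ G fm fp, IsTraceData u G fm fp := by
  have hG := (weakGrad_spec u).1
  obtain ⟨G, hGs, hGae⟩ := hG.1
  have hGm : Measurable G := hGs.measurable
  have hae : G =ᵐ[volume.restrict (graphDomain ηm ηp)] weakGrad u := hGae.symm
  have hd := hasWeakDir_of_ae_eq_weakGrad hae (EuclideanSpace.single (Fin.last n) 1)
  have hLp : MemLp (fun z => inner ℝ (EuclideanSpace.single (Fin.last n) 1) (G z))
      (ENNReal.ofReal p) (volume.restrict (graphDomain ηm ηp)) :=
    ((memLp_congr_ae hae).2 hG).const_inner _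
  have hgm : Measurable fun z => inner ℝ (EuclideanSpace.single (Fin.last n) 1) (G z) :=
    hGm.const_inner
  have hfin := lintegral_rpow_lt_top (by linarith) hLp
  have hsl := ae_integrableOn_slice hm hp' hgm hp.le hfin.ne
  have hum : Measurable (u.1 : Space (n + 1) → ℝ) := u.1.stronglyMeasurable.measurable
  obtain ⟨fm, fp, h1, h2, h3⟩ := exists_isVertTrace hm hp' hlt hum hgm hd hsl
  exact ⟨G, fm, fp, hGm, hae, h1, h2, h3⟩

variable {u : HomSobolev (ENNReal.ofReal p) (graphDomain ηm ηp)}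
  {G : Space (n + 1) → Space (n + 1)} {fm fp : Space n → ℝ}

theorem IsTraceData.memLp (h : IsTraceData u G fm fp) :
    MemLp G (ENNReal.ofReal p) (volume.restrict (graphDomain ηm ηp)) :=
  (memLp_congr_ae h.ae_eq).2 (weakGrad_spec u).1

theorem IsTraceData.difference_bound (h : IsTraceData u G fm fp) (hp : 1 < p)
    (hm : Continuous ηm) (hp' : Continuous ηp) (hlt : ∀ x, ηm x < ηp x) :
    ∫⁻ x, ‖fp x - fm x‖ₑ ^ p / ENNReal.ofReal ((ηp x - ηm x) ^ (p - 1)) ≤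
      ∫⁻ x in graphDomain ηm ηp, ‖weakGrad u x (Fin.last n)‖ₑ ^ p := by
  have hG := h.measurable_grad
  refine (h.isVertTrace.difference_bound hm hp' hlt (by fun_prop) hp).trans (le_of_eq ?_)
  refine lintegral_congr_ae ?_
  filter_upwards [h.ae_eq] with z hz
  rw [hz, inner_single_eq]

theorem IsTraceData.screened_bound (h : IsTraceData u G fm fp) (hn : 1 ≤ n) (hp : 1 < p)
    (hm : ∃ K : ℝ≥0, LipschitzWith K ηm) (hp' : ∃ K : ℝ≥0, LipschitzWith K ηp) {l : ℝ}
    (hl : 0 < l) (hL : lipSeminorm ηm + lipSeminorm ηp ≤ l) :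
    screenedEnergy p (fun x => (ηp x - ηm x) / (2 * l)) fm ≤
        ENNReal.ofReal (max 1 l⁻¹ * (1 + (lipSeminorm ηm + lipSeminorm ηp)) ^ p *
          screenedConst n p) * ∫⁻ z in graphDomain ηm ηp, ‖weakGrad u z‖ₑ ^ p ∧
      screenedEnergy p (fun x => (ηp x - ηm x) / (2 * l)) fp ≤
        ENNReal.ofReal (max 1 l⁻¹ * (1 + (lipSeminorm ηm + lipSeminorm ηp)) ^ p *
          screenedConst n p) * ∫⁻ z in graphDomain ηm ηp, ‖weakGrad u z‖ₑ ^ p := by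
  have hI : ∫⁻ z in graphDomain ηm ηp, ‖weakGrad u z‖ₑ ^ p =
      ∫⁻ z in graphDomain ηm ηp, ‖G z‖ₑ ^ p := by
    refine lintegral_congr_ae ?_
    filter_upwards [h.ae_eq] with z hz
    rw [hz]
  rw [hI]
  exact h.isVertTrace.screenedEnergy_le hn hp hm hp' h.measurable_grad
    (hasWeakDir_of_ae_eq_weakGrad h.ae_eq) (by simp) h.measurable_bot h.measurable_top hl hL

theorem IsTraceData.memLp_boundary (h : IsTraceData u G fm fp) (hn : 1 ≤ n) (hp : 1 < p)
    (hm : ∃ K : ℝ≥0, LipschitzWith K ηm) (hp' : ∃ K : ℝ≥0, LipschitzWith K ηp)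
    (hlt : ∀ x, ηm x < ηp x) {K : Set (Space n)} (hK : IsCompact K) :
    MemLp fm (ENNReal.ofReal p) (volume.restrict K) ∧
      MemLp fp (ENNReal.ofReal p) (volume.restrict K) := by
  have hcm : Continuous ηm := hm.elim fun K h => h.continuous
  have hcp : Continuous ηp := hp'.elim fun K h => h.continuous
  -- Any positive `l` above the sum of the seminorms serves here; the maximum with 1 covers constant
  -- `ηm` and `ηp`, where the sum is 0.
  set l := max 1 (lipSeminorm ηm + lipSeminorm ηp) with hldef
  have hl : 0 < l := lt_max_of_lt_left one_pos
  have hb := h.screened_bound hn hp hm hp' hl (le_max_right _ _)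
  have hfin : ∫⁻ z in graphDomain ηm ηp, ‖weakGrad u z‖ₑ ^ p < ⊤ :=
    lintegral_rpow_lt_top (by linarith) (weakGrad_spec u).1
  have hσ : Continuous fun x => (ηp x - ηm x) / (2 * l) := by fun_prop
  have hσ0 : ∀ x, 0 < (ηp x - ηm x) / (2 * l) := fun x =>
    div_pos (sub_pos.2 (hlt x)) (by positivity)
  have htop := (ENNReal.mul_lt_top (ENNReal.ofReal_lt_top
    (r := max 1 l⁻¹ * (1 + (lipSeminorm ηm + lipSeminorm ηp)) ^ p * screenedConst n p)) hfin)
  exact ⟨memLp_of_screenedEnergy_ne_top hp hn hσ hσ0 h.measurable_bot (hb.1.trans_lt htop).ne hK,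
    memLp_of_screenedEnergy_ne_top hp hn hσ hσ0 h.measurable_top (hb.2.trans_lt htop).ne hK⟩

theorem IsTraceData.integral_by_parts (h : IsTraceData u G fm fp) (hn : 1 ≤ n) (hp : 1 < p)
    (hm : ∃ K : ℝ≥0, LipschitzWith K ηm) (hp' : ∃ K : ℝ≥0, LipschitzWith K ηp)
    (hlt : ∀ x, ηm x < ηp x) {w : Space (n + 1) → ℝ} (hwp : ∀ᵐ x, w (graphMap ηp x) = fp x)
    (hwm : ∀ᵐ x, w (graphMap ηm x) = fm x) {ψ : Space (n + 1) → ℝ} (hψ : ContDiff ℝ 1 ψ)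
    (hψc : HasCompactSupport ψ) (i : Fin (n + 1)) :
    IntegrableOn (fun x => u.1 x * pderiv i ψ x) (graphDomain ηm ηp) ∧
    IntegrableOn (fun x => ψ x * weakGrad u x i) (graphDomain ηm ηp) ∧
    IntegrableOn (fun x => ψ x * w x * outerNormal ηm ηp x i)
      (frontier (graphDomain ηm ηp)) (Measure.euclideanHausdorffMeasure n) ∧
    ∫ x in graphDomain ηm ηp, u.1 x * pderiv i ψ x
      = - (∫ x in graphDomain ηm ηp, ψ x * weakGrad u x i)
        + ∫ x in frontier (graphDomain ηm ηp),
            ψ x * w x * outerNormal ηm ηp x i ∂(Measure.euclideanHausdorffMeasure n) := by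
  obtain ⟨Km, hKm⟩ := hm
  obtain ⟨Kp, hKp⟩ := hp'
  have hcm := hKm.continuous
  have hcp := hKp.continuous
  have hq : 1 ≤ ENNReal.ofReal p := by rw [ENNReal.one_le_ofReal]; exact hp.le
  have hloc : ∀ K : Set (Space n), IsCompact K → IntegrableOn fm K ∧ IntegrableOn fp K := by
    intro K hK
    have : IsFiniteMeasure (volume.restrict K) := ⟨by simpa using hK.measure_lt_top⟩
    have := h.memLp_boundary hn hp ⟨Km, hKm⟩ ⟨Kp, hKp⟩ hlt hK
    exact ⟨this.1.integrable hq, this.2.integrable hq⟩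
  have hgc : ∀ e : Space (n + 1), IntegrableOverCompacts ηm ηp fun z => inner ℝ e (G z) := fun e =>
    integrableOverCompacts_of_memLp hcm hcp hq (h.memLp.const_inner e)
  have huc : IntegrableOverCompacts ηm ηp u.1 :=
    h.isVertTrace.integrableOverCompacts hcm hcp hlt u.1.stronglyMeasurable.measurable (hgc _)
      fun K hK => (hloc K hK).1
  obtain ⟨c1, c2, c3, c4, c5⟩ := h.isVertTrace.integral_by_parts hKm hKp hlt
    (hasWeakDir_of_ae_eq_weakGrad h.ae_eq (EuclideanSpace.single i 1)) huc (hgc _) (hgc _)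
    (fun K hK => (hloc K hK).1) (fun K hK => (hloc K hK).2) hψ hψc
  have hae : (fun z => inner ℝ (EuclideanSpace.single i 1) (G z) * ψ z)
      =ᵐ[volume.restrict (graphDomain ηm ηp)] fun z => ψ z * weakGrad u z i := by
    filter_upwards [h.ae_eq] with z hz
    rw [hz, inner_single_eq, mul_comm]
  have ep : (fun x => conormal ηp (EuclideanSpace.single i 1) x * (fp x * ψ (join x (ηp x))))
      =ᵐ[volume] fun x => areaDensity ηp x *
        (ψ (graphMap ηp x) * w (graphMap ηp x) * outerNormal ηm ηp (graphMap ηp x) i) := by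
    filter_upwards [hwp] with x hx
    rw [hx, ← areaDensity_mul_outerNormal_top ηm, graphMap]
    ring
  have em : (fun x => -(conormal ηm (EuclideanSpace.single i 1) x * (fm x * ψ (join x (ηm x)))))
      =ᵐ[volume] fun x => areaDensity ηm x *
        (ψ (graphMap ηm x) * w (graphMap ηm x) * outerNormal ηm ηp (graphMap ηm x) i) := by
    filter_upwards [hwm] with x hx
    rw [hx, ← neg_mul, ← areaDensity_mul_outerNormal_bot hlt, graphMap]
    ring
  obtain ⟨d1, d2⟩ := integral_frontier_graphDomain hKm hKp hlt
    (F := fun z => ψ z * w z * outerNormal ηm ηp z i) (c3.congr ep) (c4.neg.congr em)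
  refine ⟨c1, c2.congr hae, d1, ?_⟩
  rw [d2, ← integral_congr_ae ep, ← integral_congr_ae em, ← integral_congr_ae hae, integral_neg]
  exact c5

end TraceData

/-! ### The linear trace operator and its uniqueness -/

section TraceOperator

variable {n : ℕ} {p : ℝ} {ηm ηp : Space n → ℝ}

/-- `w` has the boundary values of `u`. -/
def IsBoundaryTrace (u : HomSobolev (ENNReal.ofReal p) (graphDomain ηm ηp))
    (w : BoundaryLpLoc (ENNReal.ofReal p) (graphDomain ηm ηp)) : Prop :=
  ∃ G fm fp, IsTraceData u G fm fp ∧ (∀ᵐ x, w.1 (graphMap ηp x) = fp x) ∧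
    ∀ᵐ x, w.1 (graphMap ηm x) = fm x

theorem exists_isBoundaryTrace (hn : 1 ≤ n) (hp : 1 < p) {Km Kp : ℝ≥0} (hm : LipschitzWith Km ηm)
    (hp' : LipschitzWith Kp ηp) (hlt : ∀ x, ηm x < ηp x)
    (u : HomSobolev (ENNReal.ofReal p) (graphDomain ηm ηp)) : ∃ w, IsBoundaryTrace u w := by
  obtain ⟨G, fm, fp, h⟩ := exists_isTraceData hp hm.continuous hp'.continuous hlt u
  have hmeas := measurable_boundaryFun hp'.continuous h.measurable_bot h.measurable_top
  set w : Space (n + 1) →ₘ[boundaryMeasure ηm ηp] ℝ :=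
    AEEqFun.mk (boundaryFun ηp fm fp) hmeas.aestronglyMeasurable with hw
  have hwae : w =ᵐ[boundaryMeasure ηm ηp] boundaryFun ηp fm fp := AEEqFun.coeFn_mk _ _
  have hw2 := (ae_frontier_iff hm hp' hlt).1 hwae
  refine ⟨⟨w, fun K hK hKf => ?_⟩, G, fm, fp, h, ?_, ?_⟩
  · refine (memLp_congr_ae (ae_mono (Measure.restrict_mono_set _ hKf) hwae)).2
      (memLp_boundaryFun hm hp' hlt h.measurable_bot h.measurable_top (by linarith)
        (fun K hK => (h.memLp_boundary hn hp ⟨Km, hm⟩ ⟨Kp, hp'⟩ hlt hK).1)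
        (fun K hK => (h.memLp_boundary hn hp ⟨Km, hm⟩ ⟨Kp, hp'⟩ hlt hK).2) hK hKf)
  · filter_upwards [hw2.1] with x hx
    rw [hx, boundaryFun_graphMap_top]
  · filter_upwards [hw2.2] with x hx
    rw [hx, boundaryFun_graphMap_bot hlt]

variable {u v u' : HomSobolev (ENNReal.ofReal p) (graphDomain ηm ηp)}
  {w w' w₁ : BoundaryLpLoc (ENNReal.ofReal p) (graphDomain ηm ηp)}

theorem boundary_ext {Km Kp : ℝ≥0} (hm : LipschitzWith Km ηm) (hp' : LipschitzWith Kp ηp)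
    (hlt : ∀ x, ηm x < ηp x) (h1 : ∀ᵐ x, w.1 (graphMap ηp x) = w'.1 (graphMap ηp x))
    (h2 : ∀ᵐ x, w.1 (graphMap ηm x) = w'.1 (graphMap ηm x)) : w = w' :=
  Subtype.ext (AEEqFun.ext ((ae_frontier_iff hm hp' hlt).2 ⟨h1, h2⟩))

/-- The traces of `u`, `v` and `u + v` are chosen independently; uniqueness of the vertical boundary
values makes them compatible. This is what allows a linear operator to be built by choice. -/
theorem IsBoundaryTrace.add {Km Kp : ℝ≥0} (hm : LipschitzWith Km ηm) (hp' : LipschitzWith Kp ηp)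
    (hlt : ∀ x, ηm x < ηp x) (hu : IsBoundaryTrace u w) (hv : IsBoundaryTrace v w')
    (huv : IsBoundaryTrace (u + v) w₁) : w₁ = w + w' := by
  obtain ⟨G, fm, fp, h, a1, a2⟩ := hu
  obtain ⟨G', fm', fp', h', b1, b2⟩ := hv
  obtain ⟨G₁, fm₁, fp₁, h₁, c1, c2⟩ := huv
  have hsum : ((u + v).1 : Space (n + 1) → ℝ) =ᵐ[volume.restrict (graphDomain ηm ηp)]
      fun z => u.1 z + v.1 z := AEEqFun.coeFn_add u.1 v.1
  have heq := h₁.isVertTrace.ae_eq hm.continuous hp'.continuous hlt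
    (h.isVertTrace.add hlt h'.isVertTrace) hsum
  have hw : ((w + w').1 : Space (n + 1) → ℝ) =ᵐ[boundaryMeasure ηm ηp]
      fun z => w.1 z + w'.1 z := AEEqFun.coeFn_add w.1 w'.1
  have hw' := (ae_frontier_iff hm hp' hlt).1 hw
  refine boundary_ext hm hp' hlt ?_ ?_
  · filter_upwards [hw'.1, heq.2, a1, b1, c1] with x k1 k2 k3 k4 k5
    rw [k1, k5, k2, k3, k4]
  · filter_upwards [hw'.2, heq.1, a2, b2, c2] with x k1 k2 k3 k4 k5
    rw [k1, k5, k2, k3, k4]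

theorem IsBoundaryTrace.smul {Km Kp : ℝ≥0} (hm : LipschitzWith Km ηm) (hp' : LipschitzWith Kp ηp)
    (hlt : ∀ x, ηm x < ηp x) (c : ℝ) (hu : IsBoundaryTrace u w)
    (huc : IsBoundaryTrace (c • u) w₁) : w₁ = c • w := by
  obtain ⟨G, fm, fp, h, a1, a2⟩ := hu
  obtain ⟨G₁, fm₁, fp₁, h₁, c1, c2⟩ := huc
  have hsm : ((c • u).1 : Space (n + 1) → ℝ) =ᵐ[volume.restrict (graphDomain ηm ηp)]
      fun z => c * u.1 z := AEEqFun.coeFn_smul c u.1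
  have heq := h₁.isVertTrace.ae_eq hm.continuous hp'.continuous hlt
    (h.isVertTrace.const_mul c) hsm
  have hw : ((c • w).1 : Space (n + 1) → ℝ) =ᵐ[boundaryMeasure ηm ηp]
      fun z => c * w.1 z := AEEqFun.coeFn_smul c w.1
  have hw' := (ae_frontier_iff hm hp' hlt).1 hw
  refine boundary_ext hm hp' hlt ?_ ?_
  · filter_upwards [hw'.1, heq.2, a1, c1] with x k1 k2 k3 k5
    rw [k1, k5, k2, k3]
  · filter_upwards [hw'.2, heq.1, a2, c2] with x k1 k2 k3 k5
    rw [k1, k5, k2, k3]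

theorem exists_linearMap_isBoundaryTrace (hn : 1 ≤ n) (hp : 1 < p) {Km Kp : ℝ≥0}
    (hm : LipschitzWith Km ηm) (hp' : LipschitzWith Kp ηp) (hlt : ∀ x, ηm x < ηp x) :
    ∃ T : HomSobolev (ENNReal.ofReal p) (graphDomain ηm ηp) →ₗ[ℝ]
      BoundaryLpLoc (ENNReal.ofReal p) (graphDomain ηm ηp), ∀ u, IsBoundaryTrace u (T u) := by
  choose T hT using exists_isBoundaryTrace (p := p) hn hp hm hp' hlt
  exact ⟨{ toFun := T
           map_add' := fun u v => (hT u).add hm hp' hlt (hT v) (hT (u + v))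
           map_smul' := fun c u => (hT u).smul hm hp' hlt c (hT (c • u)) }, hT⟩

theorem IsBoundaryTrace.eq_of_continuousOn {Km Kp : ℝ≥0} (hm : LipschitzWith Km ηm)
    (hp' : LipschitzWith Kp ηp) (hlt : ∀ x, ηm x < ηp x) (h : IsBoundaryTrace u w)
    {v : Space (n + 1) → ℝ} (hv : ContinuousOn v (closure (graphDomain ηm ηp)))
    (huv : (u.1 : Space (n + 1) → ℝ) =ᵐ[volume.restrict (graphDomain ηm ηp)] v) :
    (w.1 : Space (n + 1) → ℝ) =ᵐ[boundaryMeasure ηm ηp] v := by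
  obtain ⟨G, fm, fp, h, a1, a2⟩ := h
  have key : ∀ᵐ x, fm x = v (join x (ηm x)) ∧ fp x = v (join x (ηp x)) := by
    filter_upwards [h.isVertTrace.boundary_values hlt,
      ae_graphDomain_iff hm.continuous hp'.continuous huv] with x h1 h2
    refine h1 (fun t => v (join x t)) ?_ h2
    refine hv.comp (by fun_prop) fun t ht => ?_
    rw [closure_graphDomain hm.continuous hp'.continuous hlt]
    simpa [mem_ofPred_eq] using ht
  refine (ae_frontier_iff hm hp' hlt).2 ⟨?_, ?_⟩
  · filter_upwards [key, a1] with x k1 k2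
    rw [k2, k1.2, graphMap]
  · filter_upwards [key, a2] with x k1 k2
    rw [k2, k1.1, graphMap]

/-- A trace that satisfies the integration by parts formula is determined by it. -/
theorem eq_of_integral_by_parts {w w' : Space (n + 1) → ℝ}
    (hi : ∀ ψ : Space (n + 1) → ℝ, ContDiff ℝ 1 ψ → HasCompactSupport ψ →
      Integrable (fun x => ψ x * w x * outerNormal ηm ηp x (Fin.last n)) (boundaryMeasure ηm ηp) ∧
      Integrable (fun x => ψ x * w' x * outerNormal ηm ηp x (Fin.last n)) (boundaryMeasure ηm ηp) ∧
      ∫ x, ψ x * w x * outerNormal ηm ηp x (Fin.last n) ∂(boundaryMeasure ηm ηp) =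
        ∫ x, ψ x * w' x * outerNormal ηm ηp x (Fin.last n) ∂(boundaryMeasure ηm ηp)) :
    w =ᵐ[boundaryMeasure ηm ηp] w' := by
  set ν : Space (n + 1) → ℝ := fun x => outerNormal ηm ηp x (Fin.last n) with hν
  have hloc : LocallyIntegrable (fun x => (w x - w' x) * ν x) (boundaryMeasure ηm ηp) := by
    intro x
    -- Only integrals against test functions are known to converge; a bump that is 1 on a ball turns
    -- this into local integrability.
    let b : ContDiffBump x := ⟨1, 2, one_pos, one_lt_two⟩
    have hb := hi b b.contDiff b.hasCompactSupport
    refine ⟨Metric.closedBall x 1, Metric.closedBall_mem_nhds x one_pos, ?_⟩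
    have h1 : IntegrableOn (fun z => b z * w z * ν z - b z * w' z * ν z) (Metric.closedBall x 1)
        (boundaryMeasure ηm ηp) := (hb.1.sub hb.2.1).integrableOn
    refine h1.congr_fun (fun z hz => ?_) Metric.isClosed_closedBall.measurableSet
    simp only
    rw [b.one_of_mem_closedBall hz]
    ring
  have h0 := ae_eq_zero_of_integral_contDiff_smul_eq_zero hloc fun ψ hψ hψc => by
    obtain ⟨h1, h2, h3⟩ := hi ψ (hψ.of_le (by simp)) hψc
    have : ∀ x, ψ x • ((w x - w' x) * ν x) = ψ x * w x * ν x - ψ x * w' x * ν x := fun x => by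
      rw [smul_eq_mul]; ring
    simp only [this]
    rw [integral_sub h1 h2, h3, sub_self]
  filter_upwards [h0] with x hx
  rcases mul_eq_zero.1 hx with h | h
  · exact sub_eq_zero.1 h
  · exact absurd h (outerNormal_last_ne_zero ηm ηp x)

/-- The summand 1 in the constant covers the difference estimate, whose own constant is 1, and makes
the constant positive. -/
theorem isTraceOperator_of_isBoundaryTrace (hn : 1 ≤ n) (hp : 1 < p)
    (hm : ∃ K : ℝ≥0, LipschitzWith K ηm) (hp' : ∃ K : ℝ≥0, LipschitzWith K ηp)
    (hlt : ∀ x, ηm x < ηp x)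
    {T : HomSobolev (ENNReal.ofReal p) (graphDomain ηm ηp) →ₗ[ℝ]
      BoundaryLpLoc (ENNReal.ofReal p) (graphDomain ηm ηp)} (hT : ∀ u, IsBoundaryTrace u (T u)) :
    IsTraceOperator p ηm ηp (screenedConst n p + 1) T := by
  have hc := screenedConst_nonneg (n := n) hp
  -- The operator returns a.e. classes, so the energy must not change on null sets; for each `x` the
  -- translate by `x` also preserves null sets.
  have energy : ∀ (σ f f' : Space n → ℝ), f =ᵐ[volume] f' →
      screenedEnergy p σ f = screenedEnergy p σ f' := by
    intro σ f f' hff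
    have h2 : ∀ᵐ x : Space n, ∀ᵐ h : Space n, f (x + h) = f' (x + h) := ae_of_all _ fun x =>
      (measurePreserving_add_left volume x).quasiMeasurePreserving.ae hff
    refine lintegral_congr_ae ?_
    filter_upwards [hff, h2] with x h1 h2
    refine lintegral_congr_ae (ae_restrict_of_ae ?_)
    filter_upwards [h2] with h h3
    rw [h1, h3]
  refine ⟨fun u v hv huv => ?_, fun u => ?_, fun u l hl hL η hη => ?_, fun u ψ hψ hψc i => ?_⟩
  · obtain ⟨Km, hm⟩ := hm
    obtain ⟨Kp, hp'⟩ := hp'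
    exact (hT u).eq_of_continuousOn hm hp' hlt hv huv
  · obtain ⟨G, fm, fp, h, a1, a2⟩ := hT u
    have hb := h.difference_bound hp (hm.elim fun K h => h.continuous)
      (hp'.elim fun K h => h.continuous) hlt
    refine le_trans (le_of_eq ?_) (hb.trans (le_mul_of_one_le_left zero_le ?_))
    · refine lintegral_congr_ae ?_
      filter_upwards [a1, a2] with x k1 k2
      rw [← k1, ← k2, graphMap, graphMap]
    · rw [ENNReal.one_le_ofReal]
      linarith
  · obtain ⟨G, fm, fp, h, a1, a2⟩ := hT u
    have hb := h.screened_bound hn hp hm hp' hl hL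
    have m0 := lipSeminorm_nonneg ηm
    have p0 := lipSeminorm_nonneg ηp
    have hle : ENNReal.ofReal (max 1 l⁻¹ * (1 + (lipSeminorm ηm + lipSeminorm ηp)) ^ p *
          screenedConst n p) ≤ ENNReal.ofReal (max 1 l⁻¹ *
          (1 + (lipSeminorm ηm + lipSeminorm ηp)) ^ p * (screenedConst n p + 1)) := by
      refine ENNReal.ofReal_le_ofReal (mul_le_mul_of_nonneg_left (by linarith) ?_)
      positivity
    rcases hη with rfl | rfl
    · exact (energy _ _ fm a2).le.trans (hb.1.trans (mul_le_mul_left hle _))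
    · exact (energy _ _ fp a1).le.trans (hb.2.trans (mul_le_mul_left hle _))
  · obtain ⟨G, fm, fp, h, a1, a2⟩ := hT u
    exact h.integral_by_parts hn hp hm hp' hlt a1 a2 hψ hψc i

end TraceOperator

end StripTrace

end

open StripTrace in
theorem theorem4p1 (n : ℕ) (hn : 1 ≤ n) (p : ℝ) (hp : 1 < p) :
    ∃ c : ℝ, 0 < c ∧ ∀ ηm ηp : Space n → ℝ,
      (∃ K : ℝ≥0, LipschitzWith K ηm) → (∃ K : ℝ≥0, LipschitzWith K ηp) →
      (∀ x, ηm x < ηp x) →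
      ∃ T : HomSobolev (ENNReal.ofReal p) (graphDomain ηm ηp) →ₗ[ℝ]
          BoundaryLpLoc (ENNReal.ofReal p) (graphDomain ηm ηp),
        IsTraceOperator p ηm ηp c T ∧
        ∀ T' : HomSobolev (ENNReal.ofReal p) (graphDomain ηm ηp) →ₗ[ℝ]
            BoundaryLpLoc (ENNReal.ofReal p) (graphDomain ηm ηp),
          (∃ c' : ℝ, 0 < c' ∧ IsTraceOperator p ηm ηp c' T') → T' = T := by
  refine ⟨screenedConst n p + 1, by linarith [screenedConst_nonneg (n := n) hp],
    fun ηm ηp hm hp' hlt => ?_⟩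
  obtain ⟨T, hT⟩ := hm.elim fun Km h1 => hp'.elim fun Kp h2 =>
    exists_linearMap_isBoundaryTrace (p := p) hn hp h1 h2 hlt
  have hop := isTraceOperator_of_isBoundaryTrace hn hp hm hp' hlt hT
  refine ⟨T, hop, fun T' ⟨c', _, hop'⟩ => ?_⟩
  refine LinearMap.ext fun u => Subtype.ext (AEEqFun.ext ?_)
  -- Both operators satisfy the formula with the same interior integrals, so their vertical boundary
  -- integrals agree for every `ψ`; the estimates play no role in uniqueness.
  refine eq_of_integral_by_parts fun ψ hψ hψc => ?_
  obtain ⟨-, -, i1, e1⟩ := hop'.integral_by_parts u ψ hψ hψc (Fin.last n)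
  obtain ⟨-, -, i2, e2⟩ := hop.integral_by_parts u ψ hψ hψc (Fin.last n)
  exact ⟨i1, i2, add_left_cancel (e1.symm.trans e2)⟩
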